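/- Let $n\ge 2$, let $F_n$ be the free group on $x,y_1,\dots,y_{n-1}$, let $\mathrm{A}(F_n)$ be its automorphism group, let $\mathrm{A}^+(F_n)$ be the subgroup of automorphisms acting on $F_n/F_n'\cong\mathbb Z^n$ with determinant $1$, and let $\mathrm{IA}(F_n)$ be the subgroup of automorphisms acting trivially on $F_n/F_n'$. Let $C_2=\langle g\rangle$ be the group of order $2$, let $\pi:F_n\to C_2$ be the homomorphism with $\pi(x)=g$ and $\pi(y_i)=1$ for all $i$, let $R=\ker\pi$ and $\bar R=R/R'$. Let $\Gamma(C_2,\pi)$ be the group of all $\varphi\in\mathrm{A}(F_n)$ with $\varphi(R)=R$ that induce the identity on $F_n/R$, and $\Gamma^+(C_2,\pi)=\Gamma(C_2,\pi)\cap\mathrm{A}^+(F_n)$. The group $F_n$ acts on $\bar R$ by conjugation, which gives an action of $C_2$ on $\bar R$. Let $\bar R_{1}$ and $\bar R_{-1}$ be the subgroups of $\bar R$ on which $g$ acts as $1$ and as $-1$. Writing $\bar r$ for the class of $r\in R$ in $\bar R$, put $v_i=\bar y_i+\overline{xy_ix^{-1}}$ and $w_i=\bar y_i-\overline{xy_ix^{-1}}$.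 Then $\overline{x^2},v_1,\dots,v_{n-1}$ is a $\mathbb Z$-basis of $\bar R_1$ and $w_1,\dots,w_{n-1}$ is a $\mathbb Z$-basis of $\bar R_{-1}$. The action of $\Gamma^+(C_2,\pi)$ on $\bar R$ preserves $\bar R_1$ and $\bar R_{-1}$, and in these bases (the coordinates of the image of the $j$-th basis vector forming the $j$-th column) it gives representations $\sigma_1:\Gamma^+(C_2,\pi)\to\mathrm{GL}(n,\mathbb Z)$ and $\sigma_{-1}:\Gamma^+(C_2,\pi)\to\mathrm{GL}(n-1,\mathbb Z)$. Let $\Gamma^1(n,2)\le\mathrm{SL}(n,\mathbb Z)$ be the subgroup of matrices whose first row is congruent to $(1,0,\dots,0)$ modulo $2$. Define automorphisms of $F_n$ as follows, where generators not mentioned are fixed, all indices lie in $\{1,\dots,n-1\}$, and $[a,b]=aba^{-1}b^{-1}$: $\delta_i(x)=y_ix$, $\epsilon_i(x)=xy_i$, $\varphi_i(y_i)=xy_i$, $\psi_i(y_i)=y_ix$; $\lambda_{ij}(y_i)=y_jy_i$ and $\nu_{ij}(y_i)=y_iy_j$ for $i\ne j$; $\kappa_{jk}(x)=x[y_j,y_k]$;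 $\kappa_{ijk}(y_i)=y_i[y_j,y_k]$ for $i\ne j$, $i\ne k$; $\tau_{ij}(y_i)=y_i[x,y_j]$ for $i\neq j$. Let $T_n$ be the set of all $\kappa_{jk}$, $\kappa_{ijk}$, $\tau_{ij}$, $\delta_i^{-1}\circ\epsilon_i$, $\varphi_i^{-1}\circ\psi_i$ and $\lambda_{ij}\circ\nu_{ij}^{-1}$. Then the following hold. (i) $\Gamma^+(C_2,\pi)$ is generated by all $\delta_i$, $\epsilon_i$, $\lambda_{ij}$, $\nu_{ij}$ ($i\ne j$), $\varphi_i^2$ and the elements of $T_n$. (ii) The image of $\sigma_1$ is equal to $\Gamma^1(n,2)$. (iii) The index of $\Gamma^+(C_2,\pi)$ in $\mathrm{A}^+(F_n)$ is $2^n-1$. (iv) $\sigma_{-1}$ is surjective onto $\mathrm{GL}(n-1,\mathbb Z)$. (v) For $n=3$, $\mathrm{IA}(F_3)\le\Gamma^+(C_2,\pi)$, and $\sigma_{-1}(\mathrm{IA}(F_3))\le\mathrm{GL}(2,\mathbb Z)$ is generated by the matrices $$\begin{pmatrix}-1&0\\0&1\end{pmatrix},\quad\begin{pmatrix}1&0\\0&-1\end{pmatrix},\quad\begin{pmatrix}1&2\\0&1\end{pmatrix},\quad\begin{pmatrix}1&0\\2&1\end{pmatrix}.$$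 -/

import Mathlib

open scoped commutatorElement

namespace AutFree

/-! ### Relation modules -/

section General

/-- The action of the automorphisms of a group `G` on the `ℤ`-module `G / G'`. -/
noncomputable def abAut (G : Type*) [Group G] :
    MulAut G →* (Additive (Abelianization G) ≃ₗ[ℤ] Additive (Abelianization G)) where
  toFun φ := (MulEquiv.toAdditive φ.abelianizationCongr).toIntLinearEquiv
  map_one' := by
    ext a
    induction a using Additive.rec with
    | ofMul a =>
      induction a using QuotientGroup.induction_on with
      | H a => rfl
  map_mul' φ ψ := by
    ext a
    induction a using Additive.rec with
    | ofMul a =>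
      induction a using QuotientGroup.induction_on with
      | H a => rfl

/-- The class of `g : G` in `G / G'`, written additively. -/
def abCls {G : Type*} [Group G] (g : G) : Additive (Abelianization G) :=
  Additive.ofMul (Abelianization.of g)

theorem abAut_abCls {G : Type*} [Group G] (φ : MulAut G) (g : G) :
    abAut G φ (abCls g) = abCls (φ g) := rfl

theorem abCls_mul {G : Type*} [Group G] (a b : G) : abCls (a * b) = abCls a + abCls b := rfl

theorem abCls_inv {G : Type*} [Group G] (a : G) : abCls a⁻¹ = -abCls a := rfl

theorem abCls_induction {G : Type*} [Group G] {p : Additive (Abelianization G) → Prop}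
    (h : ∀ g : G, p (abCls g)) (a : Additive (Abelianization G)) : p a := by
  induction a using Additive.rec with
  | ofMul a =>
    induction a using QuotientGroup.induction_on with
    | H a => exact h a

/-- `Γ(R) = {φ ∈ Aut F | φ(R) = R}`. -/
def stab {F : Type*} [Group F] (R : Subgroup F) : Subgroup (MulAut F) where
  carrier := {φ | R.map φ.toMonoidHom = R}
  one_mem' := Subgroup.map_id R
  mul_mem' {φ ψ} hφ hψ := by
    have h : R.map (φ * ψ).toMonoidHom = (R.map ψ.toMonoidHom).map φ.toMonoidHom :=
      (Subgroup.map_map R φ.toMonoidHom ψ.toMonoidHom).symm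
    simp only [Set.mem_ofPred_eq] at *
    rw [h, hψ, hφ]
  inv_mem' {φ} hφ := by
    simp only [Set.mem_ofPred_eq] at *
    conv_lhs => rw [← hφ]
    rw [Subgroup.map_map]
    convert Subgroup.map_id R
    ext x
    exact φ.symm_apply_apply x

theorem mem_of_mem_stab {F : Type*} [Group F] {R : Subgroup F} {φ : MulAut F}
    (hφ : φ ∈ stab R) {r : F} (hr : r ∈ R) : φ r ∈ R := by
  have h : R.map φ.toMonoidHom = R := hφ
  rw [← h]
  exact ⟨r, hr, rfl⟩

/-- Restriction to `R` of the automorphisms of `F` that preserve `R`. -/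
def restr {F : Type*} [Group F] (R : Subgroup F) : stab R →* MulAut R where
  toFun φ :=
    { toFun := fun r => ⟨(φ : MulAut F) r, mem_of_mem_stab φ.2 r.2⟩
      invFun := fun r => ⟨(φ : MulAut F)⁻¹ r, mem_of_mem_stab (inv_mem φ.2) r.2⟩
      left_inv := fun r => Subtype.ext ((φ : MulAut F).symm_apply_apply r)
      right_inv := fun r => Subtype.ext ((φ : MulAut F).apply_symm_apply r)
      map_mul' := fun r s => Subtype.ext (map_mul (φ : MulAut F) (r : F) (s : F)) }
  map_one' := rfl
  map_mul' _ _ := rfl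

variable {F G : Type*} [Group F] [Group G]

/-- `Γ(G, π)`: the automorphisms `φ` of `F` with `φ(R) = R` that induce the identity on
`F / R`, where `R = ker π`. -/
def Gam (π : F →* G) : Subgroup (MulAut F) where
  carrier := {φ | φ ∈ stab π.ker ∧ ∀ f : F, ((φ f : F) : F ⧸ π.ker) = (f : F ⧸ π.ker)}
  one_mem' := ⟨one_mem _, fun _ => rfl⟩
  mul_mem' {φ ψ} hφ hψ := ⟨mul_mem hφ.1 hψ.1, fun f => (hφ.2 (ψ f)).trans (hψ.2 f)⟩
  inv_mem' {φ} hφ := ⟨inv_mem hφ.1, fun f => by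
    have h := hφ.2 (φ⁻¹ f)
    rw [MulAut.apply_inv_self] at h
    exact h.symm⟩

theorem Gam_le_stab (π : F →* G) : Gam π ≤ stab π.ker := fun _ h => h.1

theorem Gam_map_eq {π : F →* G} {φ : MulAut F} (hφ : φ ∈ Gam π) (f : F) : π (φ f) = π f := by
  have h := QuotientGroup.eq.1 (hφ.2 f)
  rw [MonoidHom.mem_ker, map_mul, map_inv, inv_mul_eq_one] at h
  exact h

/-- The relation module `R / R'` of `π`, where `R = ker π`. -/
abbrev RelMod (π : F →* G) : Type _ := Additive (Abelianization π.ker)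

/-- The action of `F` on the relation module induced by conjugation on `R`. -/
noncomputable def conjAct (π : F →* G) : F →* (RelMod π ≃ₗ[ℤ] RelMod π) :=
  (abAut π.ker).comp MulAut.conjNormal

theorem conjAct_abCls (π : F →* G) (f : F) (r : π.ker) :
    conjAct π f (abCls r) = abCls (MulAut.conjNormal f r) := rfl

theorem ker_le_conjAct_ker (π : F →* G) : π.ker ≤ (conjAct π).ker := by
  intro f hf
  rw [MonoidHom.mem_ker]
  ext a
  induction a using abCls_induction with
  | h r =>
    have h : (MulAut.conjNormal f r : π.ker) = ⟨f, hf⟩ * r * ⟨f, hf⟩⁻¹ := by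
      ext; simp
    rw [conjAct_abCls, h, abCls_mul, abCls_mul, abCls_inv]
    simp

/-- The action of `G` on the relation module of a surjective `π : F → G`: the element `π f`
acts through conjugation by `f`. -/
noncomputable def relAct (π : F →* G) (hπ : Function.Surjective π) :
    G →* (RelMod π ≃ₗ[ℤ] RelMod π) :=
  (QuotientGroup.lift π.ker (conjAct π) (ker_le_conjAct_ker π)).comp
    (QuotientGroup.quotientKerEquivOfSurjective π hπ).symm.toMonoidHom

theorem relAct_map (π : F →* G) (hπ : Function.Surjective π) (f : F) :
    relAct π hπ (π f) = conjAct π f := by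
  have h : (QuotientGroup.quotientKerEquivOfSurjective π hπ).symm (π f) = (f : F ⧸ π.ker) := by
    rw [MulEquiv.symm_apply_eq]; rfl
  simp only [relAct, MonoidHom.comp_apply]
  erw [h]
  rfl

/-- The action `φ ↦ φ̄` of `Γ(G, π)` on the relation module. -/
noncomputable def rhoBar (π : F →* G) : Gam π →* (RelMod π ≃ₗ[ℤ] RelMod π) :=
  (abAut π.ker).comp ((restr π.ker).comp (Subgroup.inclusion (Gam_le_stab π)))

theorem rhoBar_abCls (π : F →* G) (φ : Gam π) (r : π.ker) :
    rhoBar π φ (abCls r) = abCls ⟨(φ : MulAut F) r, mem_of_mem_stab φ.2.1 r.2⟩ := rfl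

/-- `φ̄` is `G`-equivariant for `φ ∈ Γ(G, π)`. -/
theorem rhoBar_relAct (π : F →* G) (hπ : Function.Surjective π) (φ : Gam π) (g : G)
    (a : RelMod π) : rhoBar π φ (relAct π hπ g a) = relAct π hπ g (rhoBar π φ a) := by
  obtain ⟨f, rfl⟩ := hπ g
  conv_rhs => rw [← Gam_map_eq φ.2 f]
  rw [relAct_map, relAct_map]
  induction a using abCls_induction with
  | h r =>
    simp only [conjAct_abCls, rhoBar_abCls]
    congr 1
    ext
    simp

/-- The submodule of the relation module on which `g` acts as multiplication by `ε`. -/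
noncomputable abbrev eigen (π : F →* G) (hπ : Function.Surjective π) (g : G) (ε : ℤ) :
    Submodule ℤ (RelMod π) :=
  Module.End.eigenspace (relAct π hπ g : Module.End ℤ (RelMod π)) ε

theorem mem_eigen {π : F →* G} {hπ : Function.Surjective π} {g : G} {ε : ℤ} {a : RelMod π} :
    a ∈ eigen π hπ g ε ↔ relAct π hπ g a = ε • a :=
  Module.End.mem_eigenspace_iff

theorem rhoBar_mem_eigen {π : F →* G} {hπ : Function.Surjective π} {g : G} {ε : ℤ}
    (φ : Gam π) {a : RelMod π} (ha : a ∈ eigen π hπ g ε) : rhoBar π φ a ∈ eigen π hπ g ε := by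
  rw [mem_eigen] at *
  rw [← rhoBar_relAct, ha, map_zsmul]

/-- The action of `Γ(G, π)` on the submodule `eigen π hπ g ε` of the relation module. -/
noncomputable def eigenAct (π : F →* G) (hπ : Function.Surjective π) (g : G) (ε : ℤ) :
    Gam π →* (eigen π hπ g ε ≃ₗ[ℤ] eigen π hπ g ε) where
  toFun φ :=
    { toFun := fun a => ⟨rhoBar π φ a, rhoBar_mem_eigen φ a.2⟩
      invFun := fun a => ⟨rhoBar π φ⁻¹ a, rhoBar_mem_eigen φ⁻¹ a.2⟩
      left_inv := fun a => Subtype.ext (by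
        change (rhoBar π φ⁻¹) (rhoBar π φ a) = a
        rw [map_inv]; exact (rhoBar π φ).symm_apply_apply a)
      right_inv := fun a => Subtype.ext (by
        change (rhoBar π φ) (rhoBar π φ⁻¹ a) = a
        rw [map_inv]; exact (rhoBar π φ).apply_symm_apply a)
      map_add' := fun a b => Subtype.ext (map_add (rhoBar π φ) (a : RelMod π) (b : RelMod π))
      map_smul' := fun c a => Subtype.ext (map_zsmul (rhoBar π φ) c (a : RelMod π)) }
  map_one' := by
    ext a
    change ((rhoBar π 1) a : RelMod π) = a
    rw [map_one]; rfl
  map_mul' φ ψ := by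
    ext a
    change ((rhoBar π (φ * ψ)) a : RelMod π) = rhoBar π φ (rhoBar π ψ a)
    rw [map_mul]; rfl

/-- The matrix representation of the linear automorphisms of `M` in the basis `b`; the
coordinates of the image of the `j`-th basis vector form the `j`-th column. -/
noncomputable def matRep {ι M : Type*} [Fintype ι] [DecidableEq ι] [AddCommGroup M]
    (b : Module.Basis ι ℤ M) : (M ≃ₗ[ℤ] M) →* GL ι ℤ :=
  (Units.map (LinearMap.toMatrixAlgEquiv b).toMonoidHom).comp
    (LinearMap.GeneralLinearGroup.generalLinearEquiv ℤ M).symm.toMonoidHom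

end General

/-! ### Automorphisms of the free group -/

/-- The free group `F_n` for `n = m + 1`. -/
abbrev Fr (m : ℕ) : Type := FreeGroup (Fin (m + 1))

/-- The free generator `x`. -/
def X (m : ℕ) : Fr m := FreeGroup.of 0

/-- The free generators `y_1, …, y_{n-1}`, here indexed by `Fin m`. -/
def Y {m : ℕ} (i : Fin m) : Fr m := FreeGroup.of i.succ

/-- `A⁺(F_n)`: the automorphisms of `F_n` that act with determinant `1` on `F_n / F_n' ≅ ℤⁿ`. -/
noncomputable def APlus (m : ℕ) : Subgroup (MulAut (Fr m)) :=
  ((LinearEquiv.det).comp (abAut (Fr m))).ker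

/-- `IA(F_n)`: the automorphisms of `F_n` that act trivially on `F_n / F_n'`. -/
noncomputable def IA (m : ℕ) : Subgroup (MulAut (Fr m)) := (abAut (Fr m)).ker

section Nielsen

variable {α : Type*} [DecidableEq α]

/-- The endomorphism of the free group sending the generator `k` to `w` and fixing all the
other generators. -/
def repl (k : α) (w : FreeGroup α) : FreeGroup α →* FreeGroup α :=
  FreeGroup.lift (Function.update FreeGroup.of k w)

theorem repl_self (k : α) (w : FreeGroup α) : repl k w (FreeGroup.of k) = w := by
  simp [repl]

theorem repl_of_ne {k j : α} (h : j ≠ k) (w : FreeGroup α) :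
    repl k w (FreeGroup.of j) = FreeGroup.of j := by
  simp [repl, h]

/-- If `u` does not involve the generator `k`, then it is fixed by all `repl k w`. -/
theorem repl_eq_self {k : α} {u : FreeGroup α} (hu : repl k 1 u = u) (w : FreeGroup α) :
    repl k w u = u := by
  have h : (repl k w).comp (repl k 1) = repl k 1 := by
    ext j
    rcases eq_or_ne j k with rfl | hj
    · simp [repl_self]
    · simp [repl_of_ne hj]
  calc repl k w u = repl k w (repl k 1 u) := by rw [hu]
    _ = repl k 1 u := DFunLike.congr_fun h u
    _ = u := hu

/-- The automorphism of the free group sending the generator `k` to `u k v` and fixing all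
the other generators, where `u` and `v` are words that do not involve `k`. -/
def nielsen (k : α) (u v : FreeGroup α) (hu : repl k 1 u = u) (hv : repl k 1 v = v) :
    MulAut (FreeGroup α) :=
  MonoidHom.toMulEquiv (repl k (u * FreeGroup.of k * v)) (repl k (u⁻¹ * FreeGroup.of k * v⁻¹))
    (by
      ext j
      rcases eq_or_ne j k with rfl | hj
      · simp [repl_self, repl_eq_self hu, repl_eq_self hv, mul_assoc]
      · simp [repl_of_ne hj])
    (by
      ext j
      rcases eq_or_ne j k with rfl | hj
      · simp [repl_self, repl_eq_self hu, repl_eq_self hv, mul_assoc]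
      · simp [repl_of_ne hj])

theorem nielsen_self (k : α) (u v : FreeGroup α) (hu : repl k 1 u = u) (hv : repl k 1 v = v) :
    nielsen k u v hu hv (FreeGroup.of k) = u * FreeGroup.of k * v :=
  repl_self _ _

theorem nielsen_of_ne {k j : α} (h : j ≠ k) (u v : FreeGroup α) (hu : repl k 1 u = u)
    (hv : repl k 1 v = v) : nielsen k u v hu hv (FreeGroup.of j) = FreeGroup.of j :=
  repl_of_ne h _

end Nielsen

variable {m : ℕ}

theorem repl_zero_Y (w : Fr m) (i : Fin m) : repl 0 w (Y i) = Y i :=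
  repl_of_ne (Fin.succ_ne_zero i) w

theorem repl_succ_X (w : Fr m) (i : Fin m) : repl i.succ w (X m) = X m :=
  repl_of_ne (Fin.succ_ne_zero i).symm w

theorem repl_succ_Y {i j : Fin m} (h : i ≠ j) (w : Fr m) : repl i.succ w (Y j) = Y j :=
  repl_of_ne (fun e => h (Fin.succ_injective _ e).symm) w

/-- `δ_i : x ↦ y_i x`. -/
def delta (i : Fin m) : MulAut (Fr m) :=
  nielsen 0 (Y i) 1 (repl_zero_Y 1 i) (map_one _)

/-- `ε_i : x ↦ x y_i`. -/
def eps (i : Fin m) : MulAut (Fr m) :=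
  nielsen 0 1 (Y i) (map_one _) (repl_zero_Y 1 i)

/-- `φ_i : y_i ↦ x y_i`. -/
def phi (i : Fin m) : MulAut (Fr m) :=
  nielsen i.succ (X m) 1 (repl_succ_X 1 i) (map_one _)

/-- `ψ_i : y_i ↦ y_i x`. -/
def psi (i : Fin m) : MulAut (Fr m) :=
  nielsen i.succ 1 (X m) (map_one _) (repl_succ_X 1 i)

/-- `λ_{ij} : y_i ↦ y_j y_i`. -/
def lam (i j : Fin m) (h : i ≠ j) : MulAut (Fr m) :=
  nielsen i.succ (Y j) 1 (repl_succ_Y h 1) (map_one _)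

/-- `ν_{ij} : y_i ↦ y_i y_j`. -/
def nu (i j : Fin m) (h : i ≠ j) : MulAut (Fr m) :=
  nielsen i.succ 1 (Y j) (map_one _) (repl_succ_Y h 1)

/-- `κ_{jk} : x ↦ x [y_j, y_k]`. -/
def kappaX (j k : Fin m) : MulAut (Fr m) :=
  nielsen 0 1 (⁅Y j, Y k⁆ : Fr m) (map_one _) (by
    rw [map_commutatorElement, repl_zero_Y, repl_zero_Y])

/-- `κ_{ijk} : y_i ↦ y_i [y_j, y_k]`. -/
def kappaY (i j k : Fin m) (hj : i ≠ j) (hk : i ≠ k) : MulAut (Fr m) :=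
  nielsen i.succ 1 (⁅Y j, Y k⁆ : Fr m) (map_one _) (by
    rw [map_commutatorElement, repl_succ_Y hj, repl_succ_Y hk])

/-- `τ_{ij} : y_i ↦ y_i [x, y_j]`. -/
def tau (i j : Fin m) (h : i ≠ j) : MulAut (Fr m) :=
  nielsen i.succ 1 (⁅X m, Y j⁆ : Fr m) (map_one _) (by
    rw [map_commutatorElement, repl_succ_X, repl_succ_Y h])

/-- The set `T_n`, `n = m + 1`. The product in `MulAut` is composition of maps. -/
def T (m : ℕ) : Set (MulAut (Fr m)) :=
  {a | ∃ j k, a = kappaX j k} ∪ {a | ∃ i j k hj hk, a = kappaY i j k hj hk} ∪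
    {a | ∃ i j h, a = tau i j h} ∪ {a | ∃ i, a = (delta i)⁻¹ * eps i} ∪
    {a | ∃ i, a = (phi i)⁻¹ * psi i} ∪ {a | ∃ i j h, a = lam i j h * (nu i j h)⁻¹}

/-- The elements `δ_i`, `ε_i`, `λ_{ij}`, `ν_{ij}`, `φ_i²` together with the set `T_n`. -/
def gens (m : ℕ) : Set (MulAut (Fr m)) :=
  {a | ∃ i, a = delta i} ∪ {a | ∃ i, a = eps i} ∪ {a | ∃ i j h, a = lam i j h} ∪
    {a | ∃ i j h, a = nu i j h} ∪ {a | ∃ i, a = phi i ^ 2} ∪ T m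

/-! ### The presentation of the group of order two -/

/-- The cyclic group of order two. -/
abbrev C2 : Type := Multiplicative (ZMod 2)

/-- The generator of the cyclic group of order two. -/
def gC2 : C2 := Multiplicative.ofAdd 1

/-- `π : F_n → C_2` with `π(x) = g` and `π(y_i) = 1`. -/
def pi2 (m : ℕ) : Fr m →* C2 := FreeGroup.lift (Fin.cons gC2 fun _ => 1)

@[simp] theorem pi2_X : pi2 m (X m) = gC2 := by simp [pi2, X]

@[simp] theorem pi2_Y (i : Fin m) : pi2 m (Y i) = 1 := by simp [pi2, Y]

theorem pi2_surjective (m : ℕ) : Function.Surjective (pi2 m) := by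
  have h : ∀ c : C2, c = 1 ∨ c = gC2 := by decide
  intro c
  rcases h c with rfl | rfl
  · exact ⟨1, map_one _⟩
  · exact ⟨X m, pi2_X⟩

/-- `Γ⁺(C_2, π) = Γ(C_2, π) ∩ A⁺(F_n)`. -/
noncomputable def GamPlus (m : ℕ) : Subgroup (MulAut (Fr m)) := Gam (pi2 m) ⊓ APlus m

/-- `R̄_1`, the part of the relation module on which `g` acts as `1`. -/
noncomputable abbrev RPlus (m : ℕ) : Submodule ℤ (RelMod (pi2 m)) :=
  eigen (pi2 m) (pi2_surjective m) gC2 1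

/-- `R̄_{-1}`, the part of the relation module on which `g` acts as `-1`. -/
noncomputable abbrev RMinus (m : ℕ) : Submodule ℤ (RelMod (pi2 m)) :=
  eigen (pi2 m) (pi2_surjective m) gC2 (-1)

/-- The class of `x²` in the relation module. -/
def xx (m : ℕ) : RelMod (pi2 m) :=
  abCls ⟨X m ^ 2, by rw [MonoidHom.mem_ker, map_pow, pi2_X]; decide⟩

/-- The class of `y_i` in the relation module. -/
def yb (i : Fin m) : RelMod (pi2 m) := abCls ⟨Y i, by simp [MonoidHom.mem_ker]⟩

/-- The class of `x y_i x⁻¹` in the relation module. -/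
def xyx (i : Fin m) : RelMod (pi2 m) :=
  abCls ⟨X m * Y i * (X m)⁻¹, by simp [MonoidHom.mem_ker]⟩

/-! The classes of `x²`, `y_i`, `x y_i x⁻¹` form a `ℤ`-basis of the relation module. -/

theorem relAct_xx : relAct (pi2 m) (pi2_surjective m) gC2 (xx m) = xx m := by
  rw [← pi2_X (m := m), relAct_map, xx, conjAct_abCls]
  congr 1
  ext
  simp only [MulAut.conjNormal_apply]
  group

theorem relAct_yb (i : Fin m) :
    relAct (pi2 m) (pi2_surjective m) gC2 (yb i) = xyx i := by
  rw [← pi2_X (m := m), relAct_map, yb, conjAct_abCls, xyx]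
  congr 1

theorem relAct_xyx (i : Fin m) :
    relAct (pi2 m) (pi2_surjective m) gC2 (xyx i) = yb i := by
  have h := relAct_xx (m := m)
  rw [← relAct_yb, ← LinearEquiv.mul_apply, ← map_mul]
  have h2 : gC2 * gC2 = 1 := by decide
  rw [h2, map_one]
  rfl

/-- Integer combinations of the classes of `x²`, `y_i`, `x y_i x⁻¹`. -/
noncomputable def comb (m : ℕ) : ℤ × (Fin m → ℤ) × (Fin m → ℤ) →ₗ[ℤ] RelMod (pi2 m) :=
  (LinearMap.toSpanSingleton ℤ _ (xx m)).coprod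
    ((Fintype.linearCombination ℤ yb).coprod (Fintype.linearCombination ℤ xyx))

theorem comb_apply (k : ℤ) (p q : Fin m → ℤ) :
    comb m (k, p, q) = k • xx m + (∑ i, p i • yb i + ∑ i, q i • xyx i) := rfl

theorem xx_mem_range : xx m ∈ LinearMap.range (comb m) :=
  ⟨(1, 0, 0), by simp [comb_apply]⟩

theorem yb_mem_range (i : Fin m) : yb i ∈ LinearMap.range (comb m) :=
  ⟨(0, Pi.single i 1, 0), by simp [comb_apply, Pi.single_apply]⟩

theorem xyx_mem_range (i : Fin m) : xyx i ∈ LinearMap.range (comb m) :=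
  ⟨(0, 0, Pi.single i 1), by simp [comb_apply, Pi.single_apply]⟩

/-- The subgroup generated by `x²`, `y_i`, `x y_i x⁻¹`. -/
def H (m : ℕ) : Subgroup (Fr m) :=
  Subgroup.closure ({X m ^ 2} ∪ Set.range Y ∪ Set.range fun i => X m * Y i * (X m)⁻¹)

theorem X_sq_mem_H : X m ^ 2 ∈ H m := Subgroup.subset_closure (by simp)

theorem Y_mem_H (i : Fin m) : Y i ∈ H m := Subgroup.subset_closure (by simp)

theorem XYX_mem_H (i : Fin m) : X m * Y i * (X m)⁻¹ ∈ H m := Subgroup.subset_closure (by simp)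

theorem conj_mem_H {h : Fr m} (hh : h ∈ H m) : X m * h * (X m)⁻¹ ∈ H m := by
  induction hh using Subgroup.closure_induction with
  | mem y hy =>
    rcases hy with (hy | ⟨i, rfl⟩) | ⟨i, rfl⟩
    · rw [Set.mem_singleton_iff.1 hy]
      convert X_sq_mem_H using 1
      group
    · exact XYX_mem_H i
    · convert mul_mem (mul_mem X_sq_mem_H (Y_mem_H i)) (inv_mem X_sq_mem_H) using 1
      simp only [pow_two]
      group
  | one => simp
  | mul a b _ _ ha hb =>
    convert mul_mem ha hb using 1
    group
  | inv a _ ha =>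
    convert inv_mem ha using 1
    group

theorem mem_H_or (f : Fr m) : f ∈ H m ∨ X m * f ∈ H m := by
  have hx : ∀ f : Fr m, (f ∈ H m ∨ X m * f ∈ H m) → (X m * f ∈ H m ∨ X m * (X m * f) ∈ H m) := by
    rintro f (hf | hf)
    · right
      rw [← mul_assoc, ← pow_two]
      exact mul_mem X_sq_mem_H hf
    · exact Or.inl hf
  have hx' : ∀ f : Fr m, (f ∈ H m ∨ X m * f ∈ H m) →
      ((X m)⁻¹ * f ∈ H m ∨ X m * ((X m)⁻¹ * f) ∈ H m) := by
    rintro f (hf | hf)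
    · right; simpa using hf
    · left
      convert mul_mem (inv_mem X_sq_mem_H) hf using 1
      simp only [pow_two]
      group
  have hy : ∀ (i : Fin m) (f : Fr m), (f ∈ H m ∨ X m * f ∈ H m) →
      (Y i * f ∈ H m ∨ X m * (Y i * f) ∈ H m) := by
    rintro i f (hf | hf)
    · exact Or.inl (mul_mem (Y_mem_H i) hf)
    · right
      convert mul_mem (XYX_mem_H i) hf using 1
      group
  have hy' : ∀ (i : Fin m) (f : Fr m), (f ∈ H m ∨ X m * f ∈ H m) →
      ((Y i)⁻¹ * f ∈ H m ∨ X m * ((Y i)⁻¹ * f) ∈ H m) := by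
    rintro i f (hf | hf)
    · exact Or.inl (mul_mem (inv_mem (Y_mem_H i)) hf)
    · right
      convert mul_mem (inv_mem (XYX_mem_H i)) hf using 1
      group
  have key : ∀ a : Fr m, ∀ f : Fr m, (f ∈ H m ∨ X m * f ∈ H m) →
      (a * f ∈ H m ∨ X m * (a * f) ∈ H m) := by
    intro a
    induction a using FreeGroup.induction_on with
    | C1 => intro f hf; simpa using hf
    | of j =>
      intro f hf
      refine Fin.cases ?_ (fun i => ?_) j
      · exact hx f hf
      · exact hy i f hf
    | inv_of j _ =>
      intro f hf
      refine Fin.cases ?_ (fun i => ?_) j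
      · exact hx' f hf
      · exact hy' i f hf
    | mul a b ha hb =>
      intro f hf
      rw [mul_assoc]
      exact ha _ (hb f hf)
  simpa using key f 1 (Or.inl (one_mem _))

theorem H_induction {p : Fr m → Prop} (h1 : p 1) (hmul : ∀ a b, p a → p b → p (a * b))
    (hinv : ∀ a, p a → p a⁻¹) (hx : p (X m ^ 2)) (hy : ∀ i, p (Y i))
    (hxy : ∀ i, p (X m * Y i * (X m)⁻¹)) {f : Fr m} (hf : f ∈ H m) : p f := by
  induction hf using Subgroup.closure_induction with
  | mem y hy' =>
    rcases hy' with (h | ⟨i, rfl⟩) | ⟨i, rfl⟩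
    · rw [Set.mem_singleton_iff.1 h]; exact hx
    · exact hy i
    · exact hxy i
  | one => exact h1
  | mul a b _ _ ha hb => exact hmul a b ha hb
  | inv a _ ha => exact hinv a ha

theorem H_eq : H m = (pi2 m).ker := by
  have hle : H m ≤ (pi2 m).ker := fun f hf => H_induction (p := fun f => f ∈ (pi2 m).ker)
    (one_mem _) (fun _ _ => mul_mem) (fun _ => inv_mem)
    (by rw [MonoidHom.mem_ker, map_pow, pi2_X]; decide)
    (fun i => by simp [MonoidHom.mem_ker]) (fun i => by simp [MonoidHom.mem_ker]) hf
  refine le_antisymm hle fun f hf => ?_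
  rcases mem_H_or f with h | h
  · exact h
  · have h2 := hle h
    rw [MonoidHom.mem_ker] at h2 hf
    rw [map_mul, hf, pi2_X] at h2
    exact absurd h2 (by decide)

theorem comb_surjective : Function.Surjective (comb m) := by
  intro a
  induction a using abCls_induction with
  | h r =>
    have key : ∃ hr : (r : Fr m) ∈ (pi2 m).ker,
        abCls ⟨(r : Fr m), hr⟩ ∈ LinearMap.range (comb m) := by
      have hr : (r : Fr m) ∈ H m := by rw [H_eq]; exact r.2
      refine H_induction
        (p := fun f => ∃ hf : f ∈ (pi2 m).ker, abCls ⟨f, hf⟩ ∈ LinearMap.range (comb m))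
        ?_ ?_ ?_ ?_ ?_ ?_ hr
      · exact ⟨one_mem _, zero_mem _⟩
      · rintro a b ⟨ha, ha'⟩ ⟨hb, hb'⟩
        exact ⟨mul_mem ha hb, add_mem ha' hb'⟩
      · rintro a ⟨ha, ha'⟩
        exact ⟨inv_mem ha, neg_mem ha'⟩
      · exact ⟨_, xx_mem_range⟩
      · exact fun i => ⟨_, yb_mem_range i⟩
      · exact fun i => ⟨_, xyx_mem_range i⟩
    exact key.2

/-- Pairs of integer vectors, written multiplicatively. -/
abbrev V (m : ℕ) : Type := Multiplicative (Fin m → ℤ × ℤ)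

/-- The exchange of the two vectors. -/
def swapV (m : ℕ) : MulAut (V m) :=
  AddEquiv.toMultiplicative (AddEquiv.piCongrRight fun _ : Fin m => AddEquiv.prodComm)

/-- An auxiliary homomorphism that detects the classes of `y_i` and `x y_i x⁻¹`. -/
def aux (m : ℕ) : Fr m →* V m ⋊[MonoidHom.id (MulAut (V m))] MulAut (V m) :=
  FreeGroup.lift (Fin.cons (SemidirectProduct.inr (swapV m))
    fun i => SemidirectProduct.inl (Multiplicative.ofAdd (Pi.single i (1, 0))))

theorem aux_X : aux m (X m) = SemidirectProduct.inr (swapV m) := by simp [aux, X]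

theorem aux_Y (i : Fin m) :
    aux m (Y i) = SemidirectProduct.inl (Multiplicative.ofAdd (Pi.single i (1, 0))) := by
  simp [aux, Y]

theorem swapV_sq : swapV m * swapV m = 1 := rfl

theorem aux_right {f : Fr m} (hf : f ∈ (pi2 m).ker) : (aux m f).right = 1 := by
  rw [← H_eq] at hf
  refine H_induction (p := fun f => (aux m f).right = 1) ?_ ?_ ?_ ?_ ?_ ?_ hf
  · simp
  · intro a b ha hb
    rw [map_mul, SemidirectProduct.mul_right, ha, hb, one_mul]
  · intro a ha
    rw [map_inv, SemidirectProduct.inv_right, ha, inv_one]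
  · rw [pow_two, map_mul, aux_X, SemidirectProduct.mul_right, SemidirectProduct.right_inr,
      swapV_sq]
  · intro i
    rw [aux_Y, SemidirectProduct.right_inl]
  · intro i
    rw [map_mul, map_mul, map_inv, aux_X, aux_Y, SemidirectProduct.mul_right,
      SemidirectProduct.mul_right, SemidirectProduct.inv_right, SemidirectProduct.right_inl,
      SemidirectProduct.right_inr, mul_one, mul_inv_cancel]

/-- The coefficients of the classes of `y_i` and `x y_i x⁻¹`. -/
noncomputable def coordY (m : ℕ) : RelMod (pi2 m) →+ (Fin m → ℤ × ℤ) :=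
  MonoidHom.toAdditiveLeft (Abelianization.lift
    { toFun := fun r : (pi2 m).ker => (aux m r).left
      map_one' := by simp
      map_mul' := fun r s => by
        rw [Subgroup.coe_mul, map_mul, SemidirectProduct.mul_left, aux_right r.2]
        simp })

theorem coordY_abCls (r : (pi2 m).ker) :
    coordY m (abCls r) = Multiplicative.toAdd (aux m r).left := rfl

/-- Twice the coefficient of the class of `x²`. -/
noncomputable def coordX (m : ℕ) : RelMod (pi2 m) →+ ℤ :=
  MonoidHom.toAdditiveLeft (Abelianization.lift
    ((FreeGroup.lift (Fin.cons (Multiplicative.ofAdd 1) fun _ => 1) :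
      Fr m →* Multiplicative ℤ).comp (pi2 m).ker.subtype))

theorem coordX_abCls (r : (pi2 m).ker) :
    coordX m (abCls r) = Multiplicative.toAdd
      ((FreeGroup.lift (Fin.cons (Multiplicative.ofAdd 1) fun _ => 1) :
        Fr m →* Multiplicative ℤ) r) := rfl

theorem coordX_xx : coordX m (xx m) = 2 := by
  simp [xx, coordX_abCls, X]

theorem coordX_yb (i : Fin m) : coordX m (yb i) = 0 := by
  simp [yb, coordX_abCls, Y]

theorem coordX_xyx (i : Fin m) : coordX m (xyx i) = 0 := by
  simp [xyx, coordX_abCls, Y]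

theorem coordY_xx : coordY m (xx m) = 0 := by
  simp [xx, coordY_abCls, pow_two, aux_X]

theorem coordY_yb (i : Fin m) : coordY m (yb i) = Pi.single i (1, 0) := by
  simp [yb, coordY_abCls, aux_Y]

theorem coordY_xyx (i : Fin m) : coordY m (xyx i) = Pi.single i (0, 1) := by
  rw [xyx, coordY_abCls]
  simp only [map_mul, map_inv, aux_X, aux_Y, SemidirectProduct.mul_left,
    SemidirectProduct.left_inr, SemidirectProduct.left_inl, SemidirectProduct.right_inr,
    SemidirectProduct.inv_left, one_mul, map_one, mul_one, inv_one, MonoidHom.id_apply]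
  funext j
  rcases eq_or_ne j i with rfl | h
  · simp [swapV]
  · simp [swapV, h]

theorem coordX_comb (k : ℤ) (p q : Fin m → ℤ) : coordX m (comb m (k, p, q)) = 2 * k := by
  simp only [comb_apply, map_add, map_sum, map_zsmul, coordX_xx, coordX_yb, coordX_xyx]
  simp [mul_comm]

theorem coordY_comb (k : ℤ) (p q : Fin m → ℤ) (i : Fin m) :
    coordY m (comb m (k, p, q)) i = (p i, q i) := by
  simp only [comb_apply, map_add, map_sum, map_zsmul, coordY_xx, coordY_yb, coordY_xyx]
  have h1 : (∑ j, p j • (Pi.single j (1, 0) : Fin m → ℤ × ℤ)) i = p i • (1, 0) := by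
    rw [Finset.sum_apply, Finset.sum_eq_single i] <;> simp +contextual [eq_comm]
  have h2 : (∑ j, q j • (Pi.single j (0, 1) : Fin m → ℤ × ℤ)) i = q i • (0, 1) := by
    rw [Finset.sum_apply, Finset.sum_eq_single i] <;> simp +contextual [eq_comm]
  rw [smul_zero, zero_add, Pi.add_apply, h1, h2]
  simp only [Prod.smul_mk, Prod.mk_add_mk, smul_eq_mul, mul_one, mul_zero, add_zero, zero_add]

theorem comb_injective : Function.Injective (comb m) := by
  rintro ⟨k, p, q⟩ ⟨k', p', q'⟩ h
  have h1 : 2 * k = 2 * k' := by rw [← coordX_comb k p q, h, coordX_comb]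
  have h2 : ∀ i, (p i, q i) = (p' i, q' i) := fun i => by
    rw [← coordY_comb k p q, h, coordY_comb]
  have hp : p = p' := funext fun i => congrArg Prod.fst (h2 i)
  have hq : q = q' := funext fun i => congrArg Prod.snd (h2 i)
  have hk : k = k' := by omega
  rw [hp, hq, hk]

theorem relAct_comb (k : ℤ) (p q : Fin m → ℤ) :
    relAct (pi2 m) (pi2_surjective m) gC2 (comb m (k, p, q)) = comb m (k, q, p) := by
  simp only [comb_apply, map_add, map_sum, map_zsmul, relAct_xx, relAct_yb, relAct_xyx]
  rw [add_comm (∑ i, p i • xyx i)]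

/-! ### The representations `σ_1` and `σ_{-1}` -/

/-- The vectors `x², v_1, …, v_{n-1}` of `R̄_1`, where `v_i = y_i + x y_i x⁻¹`. -/
def vecPlus (m : ℕ) : Fin (m + 1) → RPlus m :=
  Fin.cons ⟨xx m, mem_eigen.2 (by rw [relAct_xx, one_smul])⟩
    fun i => ⟨yb i + xyx i, mem_eigen.2 (by
      rw [map_add, relAct_yb, relAct_xyx, one_smul]; exact add_comm _ _)⟩

/-- The vectors `w_1, …, w_{n-1}` of `R̄_{-1}`, where `w_i = y_i - x y_i x⁻¹`. -/
def vecMinus (m : ℕ) : Fin m → RMinus m :=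
  fun i => ⟨yb i - xyx i, mem_eigen.2 (by
    rw [map_sub, relAct_yb, relAct_xyx, neg_smul, one_smul, neg_sub])⟩

theorem sum_vecPlus (c : Fin (m + 1) → ℤ) :
    ((∑ i, c i • vecPlus m i : RPlus m) : RelMod (pi2 m)) =
      comb m (c 0, fun i => c i.succ, fun i => c i.succ) := by
  rw [comb_apply, Fin.sum_univ_succ, ← Finset.sum_add_distrib]
  simp [vecPlus, smul_add]

theorem sum_vecMinus (c : Fin m → ℤ) :
    ((∑ i, c i • vecMinus m i : RMinus m) : RelMod (pi2 m)) = comb m (0, c, -c) := by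
  rw [comb_apply, ← Finset.sum_add_distrib]
  simp [vecMinus, sub_eq_add_neg]

theorem vecPlus_li : LinearIndependent ℤ (vecPlus m) := by
  rw [Fintype.linearIndependent_iff]
  intro c hc
  have h := sum_vecPlus c
  rw [hc, Submodule.coe_zero, ← map_zero (comb m)] at h
  have h' := comb_injective h
  intro i
  refine Fin.cases ?_ (fun i => ?_) i
  · exact (congrArg Prod.fst h').symm
  · exact (congrFun (congrArg (fun z => z.2.1) h') i).symm

theorem vecMinus_li : LinearIndependent ℤ (vecMinus m) := by
  rw [Fintype.linearIndependent_iff]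
  intro c hc
  have h := sum_vecMinus c
  rw [hc, Submodule.coe_zero, ← map_zero (comb m)] at h
  have h' := comb_injective h
  exact fun i => (congrFun (congrArg (fun z => z.2.1) h') i).symm

theorem vecPlus_span : ⊤ ≤ Submodule.span ℤ (Set.range (vecPlus m)) := by
  rintro ⟨a, ha⟩ -
  obtain ⟨⟨k, p, q⟩, rfl⟩ := comb_surjective a
  have h := mem_eigen.1 ha
  rw [relAct_comb, one_smul] at h
  have hq : q = p := congrArg (fun z => z.2.1) (comb_injective h)
  subst hq
  rw [Submodule.mem_span_range_iff_exists_fun]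
  refine ⟨Fin.cons k q, Subtype.ext ?_⟩
  rw [sum_vecPlus]
  rfl

theorem vecMinus_span : ⊤ ≤ Submodule.span ℤ (Set.range (vecMinus m)) := by
  rintro ⟨a, ha⟩ -
  obtain ⟨⟨k, p, q⟩, rfl⟩ := comb_surjective a
  have h := mem_eigen.1 ha
  rw [relAct_comb, ← map_smul] at h
  have h' := comb_injective h
  have hk : k = -1 * k := congrArg (fun z => z.1) h'
  have hp : p = -q := by simpa using congrArg (fun z => z.2.2) h'
  obtain rfl : k = 0 := by omega
  subst hp
  rw [Submodule.mem_span_range_iff_exists_fun]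
  refine ⟨-q, Subtype.ext ?_⟩
  rw [sum_vecMinus, neg_neg]

/-- The `ℤ`-basis `x², v_1, …, v_{n-1}` of `R̄_1`. -/
noncomputable def basisPlus (m : ℕ) : Module.Basis (Fin (m + 1)) ℤ (RPlus m) :=
  Module.Basis.mk vecPlus_li vecPlus_span

/-- The `ℤ`-basis `w_1, …, w_{n-1}` of `R̄_{-1}`. -/
noncomputable def basisMinus (m : ℕ) : Module.Basis (Fin m) ℤ (RMinus m) :=
  Module.Basis.mk vecMinus_li vecMinus_span

/-- `σ_1 : Γ⁺(C_2, π) → GL(n, ℤ)`. -/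
noncomputable def sigmaPlus (m : ℕ) : GamPlus m →* GL (Fin (m + 1)) ℤ :=
  (matRep (basisPlus m)).comp ((eigenAct (pi2 m) (pi2_surjective m) gC2 1).comp
    (Subgroup.inclusion inf_le_left))

/-- `σ_{-1} : Γ⁺(C_2, π) → GL(n - 1, ℤ)`. -/
noncomputable def sigmaMinus (m : ℕ) : GamPlus m →* GL (Fin m) ℤ :=
  (matRep (basisMinus m)).comp ((eigenAct (pi2 m) (pi2_surjective m) gC2 (-1)).comp
    (Subgroup.inclusion inf_le_left))

/-! ### Matrix groups -/

/-- `Γ¹(n, q) ≤ SL(n, ℤ)` for `n = m + 1`: the matrices whose first row is congruent to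
`(1, 0, …, 0)` modulo `q`. -/
def Gamma1 (m q : ℕ) : Subgroup (Matrix.SpecialLinearGroup (Fin (m + 1)) ℤ) where
  carrier := {A | ∀ j, A.1 0 j ≡ (Pi.single 0 1 : Fin (m + 1) → ℤ) j [ZMOD q]}
  one_mem' := fun j => by
    simp [Matrix.one_apply, Pi.single_apply, eq_comm]
  mul_mem' {A B} hA hB := fun j => by
    have h : ∑ k, A.1 0 k * B.1 k j ≡
        ∑ k, (Pi.single 0 1 : Fin (m + 1) → ℤ) k * B.1 k j [ZMOD q] :=
      Int.ModEq.sum fun k _ => (hA k).mul_right _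
    have h2 : ∑ k, (Pi.single 0 1 : Fin (m + 1) → ℤ) k * B.1 k j = B.1 0 j := by
      simp [Pi.single_apply]
    rw [h2] at h
    exact h.trans (hB j)
  inv_mem' {A} hA := fun j => by
    have h : ∑ k, A.1 0 k * A⁻¹.1 k j ≡
        ∑ k, (Pi.single 0 1 : Fin (m + 1) → ℤ) k * A⁻¹.1 k j [ZMOD q] :=
      Int.ModEq.sum fun k _ => (hA k).mul_right _
    have h2 : ∑ k, (Pi.single 0 1 : Fin (m + 1) → ℤ) k * A⁻¹.1 k j = A⁻¹.1 0 j := by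
      simp [Pi.single_apply]
    have h3 : ∑ k, A.1 0 k * A⁻¹.1 k j = (Pi.single 0 1 : Fin (m + 1) → ℤ) j := by
      have h4 : (A * A⁻¹).1 0 j = (1 : Matrix (Fin (m + 1)) (Fin (m + 1)) ℤ) 0 j := by
        rw [mul_inv_cancel]; rfl
      rw [Matrix.one_apply] at h4
      rw [Pi.single_apply]
      simp only [eq_comm (a := j)]
      exact h4
    rw [h2, h3] at h
    exact h.symm

/-- A `2 × 2` integer matrix with determinant `±1` as an element of `GL(2, ℤ)`. -/
noncomputable def mat2 (a b c d : ℤ) (h : a * d - b * c = 1 ∨ a * d - b * c = -1) :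
    GL (Fin 2) ℤ :=
  Matrix.GeneralLinearGroup.mk'' !![a, b; c, d]
    (by rw [Matrix.det_fin_two_of]; exact Int.isUnit_iff.2 h)

end AutFree

/-! Generation. Write K for the group generated by `gens m`, D for the group generated by all δ_i
and ε_i, and let `shear S` send y_i to x y_i for i in S. The union of the double cosets K · `shear
S` · D over all S contains every automorphism of determinant one (`APlus_subset_cosetCover`). If
such a product preserves π, then S is empty: K preserves π, D fixes every y_i, and `shear S` changes
the value of π on y_i exactly for i in S. Since D lies in K, the product then lies in K.

The covering rests on Nielsen's theorem in the form `APlus_eq_EAut`: automorphisms of determinant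
one are products of transvections. Its proof minimises the total length of the images of the
generators and breaks ties by a weight on half words. For a minimal automorphism no image in a
reduced product is cancelled entirely, so words do not get shorter (`NielsenMinimal.norm_le`);
applied to an inverse, this leaves a signed permutation of the generators.

It remains to see that the union is stable under right multiplication by transvections and their
inverses. The λ_ij and ν_ij permute the cosets K · `shear S` and normalise D. The φ_i and ψ_i do not
normalise D, but for j in S the conjugate of K by `shear S` and its translate by δ_j already cover D
(`mem_or_of_mem`). So only the factors 1 and δ_j have to be treated, and the case S = {i} follows
from the braid relations between φ_i and δ_i and between ψ_i and ε_i.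

Invariant part and index. The inclusion of R in F_n maps the basis of R̄_1 to twice the basis of F_n
/ F_n', equivariantly; hence σ_1 is the ordinary action on F_n / F_n'. Preserving π is a condition
modulo 2 on the first row of that matrix, and the action of all automorphisms is onto GL(n, ℤ)
because elementary and sign matrices generate it. The cosets of Γ⁺ correspond to the translates of
π, which are all the nontrivial homomorphisms to C_2.

Anti-invariant part. If y_i and x y_i x⁻¹ have coefficients p and q in the class of φ(y_j), then
σ_{-1}(φ) has the entry p - q, while the matrix on F_n / F_n' has p + q. So the λ_ij and the partial
conjugations by x give transvections and sign changes, whence surjectivity, and IA-automorphisms map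
into the matrices congruent to 1 modulo 2. For n = 3 a Euclidean algorithm with even steps generates
this congruence group by four matrices, which partial conjugations and inverses of the τ_ij realise.
-/

namespace AutFree

/-! ### Common prefixes of reduced words -/

section Lcp

variable {β : Type*} [DecidableEq β]

/-- The length of the longest common prefix of two lists. -/
def lcp : List β → List β → ℕ
  | a :: s, b :: t => if a = b then lcp s t + 1 else 0
  | _, _ => 0

theorem lcp_nil_left (t : List β) : lcp [] t = 0 := by simp [lcp]

theorem lcp_nil_right (t : List β) : lcp t [] = 0 := by cases t <;> simp [lcp]

theorem lcp_comm : ∀ s t : List β, lcp s t = lcp t s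
  | [], t => by rw [lcp_nil_left, lcp_nil_right]
  | s, [] => by rw [lcp_nil_left, lcp_nil_right]
  | a :: s, b :: t => by
    simp only [lcp, lcp_comm s t, eq_comm (a := a)]

theorem lcp_le_left : ∀ s t : List β, lcp s t ≤ s.length
  | [], t => by rw [lcp_nil_left]; simp
  | s, [] => by rw [lcp_nil_right]; simp
  | a :: s, b :: t => by
    have := lcp_le_left s t
    simp only [lcp]
    split_ifs <;> simp [this]

/-- The ultrametric inequality of the prefix tree; it later identifies a cancellation length from
two estimates. -/
theorem lcp_ultra : ∀ s t u : List β, min (lcp s t) (lcp t u) ≤ lcp s u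
  | [], t, u => by simp [lcp_nil_left]
  | s, [], u => by simp [lcp_nil_left, lcp_nil_right]
  | s, t, [] => by simp [lcp_nil_right]
  | a :: s, b :: t, c :: u => by
    have := lcp_ultra s t u
    simp only [lcp]
    split_ifs <;> simp_all

theorem lcp_decomp : ∀ s t : List β, ∃ p s' t', s = p ++ s' ∧ t = p ++ t' ∧
    p.length = lcp s t ∧ ∀ a ∈ s'.head?, ∀ b ∈ t'.head?, a ≠ b
  | [], t => ⟨[], [], t, by simp [lcp_nil_left]⟩
  | s, [] => ⟨[], s, [], by simp [lcp_nil_right]⟩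
  | a :: s, b :: t => by
    by_cases h : a = b
    · obtain ⟨p, s', t', h1, h2, h3, h4⟩ := lcp_decomp s t
      exact ⟨a :: p, s', t', by simp [h1], by simp [h, h2], by simp [lcp, h, h3], h4⟩
    · exact ⟨[], a :: s, b :: t, by simp [lcp, h]⟩

end Lcp

/-! ### Length and cancellation in free groups -/

section FreeGroupLength

theorem invRev_getElem {α : Type*} (L : List (α × Bool)) (i : ℕ) (hi : i < L.length) :
    (FreeGroup.invRev L)[i]'(by simpa [FreeGroup.invRev] using hi) =
      ((L[L.length - 1 - i]'(by omega)).1, !(L[L.length - 1 - i]'(by omega)).2) := by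
  simp [FreeGroup.invRev]

open FreeGroup

variable {α : Type*} [DecidableEq α]

/-- The length of the longest common prefix of two elements of a free group. -/
def gro (u v : FreeGroup α) : ℕ := lcp u.toWord v.toWord

theorem gro_comm (u v : FreeGroup α) : gro u v = gro v u := lcp_comm _ _

theorem gro_le_left (u v : FreeGroup α) : gro u v ≤ u.norm := lcp_le_left _ _

theorem gro_le_right (u v : FreeGroup α) : gro u v ≤ v.norm := gro_comm v u ▸ gro_le_left v u

theorem gro_ultra (u v w : FreeGroup α) : min (gro u v) (gro v w) ≤ gro u w := lcp_ultra _ _ _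

theorem gro_decomp (u v : FreeGroup α) : ∃ p s t, u.toWord = p ++ s ∧ v.toWord = p ++ t ∧
    p.length = gro u v ∧ ∀ a ∈ s.head?, ∀ b ∈ t.head?, a ≠ b := lcp_decomp _ _

theorem toWord_mk_of_isReduced {L : List (α × Bool)} (h : IsReduced L) : (mk L).toWord = L := by
  rw [toWord_mk, h.reduce_eq]

/-- Reduction only deletes letters, so a word that loses no length was already reduced. -/
theorem toWord_mk_of_norm {L : List (α × Bool)} (h : (mk L).norm = L.length) :
    (mk L).toWord = L := by
  rw [toWord_mk]
  exact (Red.sublist reduce.red).eq_of_length (by rw [← toWord_mk]; exact h)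

/-- Once the common prefix is removed, the remainders start with different letters, so the inverse
of one followed by the other is reduced: the common prefix is exactly what cancels. -/
theorem norm_inv_mul (u v : FreeGroup α) : (u⁻¹ * v).norm + 2 * gro u v = u.norm + v.norm := by
  obtain ⟨p, s, t, hu, hv, hp, hst⟩ := gro_decomp u v
  have hus : IsReduced s := (isReduced_toWord (x := u)).infix ⟨p, [], by simp [hu]⟩
  have hvt : IsReduced t := (isReduced_toWord (x := v)).infix ⟨p, [], by simp [hv]⟩
  have hus' : IsReduced (invRev s) := by
    rw [isReduced_iff_reduce_eq, reduce_invRev, hus.reduce_eq]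
  have hred : IsReduced (invRev s ++ t) := by
    refine List.isChain_append.2 ⟨hus', hvt, ?_⟩
    intro x hx y hy
    cases s with
    | nil => simp at hx
    | cons a s =>
      rw [invRev_cons] at hx
      have hx' : x = (a.1, !a.2) := by simpa [invRev, eq_comm] using hx
      have := hst a (by simp) y hy
      subst hx'
      intro h1
      simp only at h1 ⊢
      by_contra h2
      apply this
      ext
      · exact h1
      · cases h3 : a.2 <;> cases h4 : y.2 <;> simp_all
  have e : u⁻¹ * v = mk (invRev s ++ t) := by
    rw [← mk_toWord (x := u), ← mk_toWord (x := v), hu, hv, ← mul_mk, ← mul_mk, ← mul_mk, ← inv_mk]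
    group
  have h1 : (u⁻¹ * v).norm = s.length + t.length := by
    rw [e, FreeGroup.norm, toWord_mk_of_isReduced hred]; simp
  have h2 : u.norm = p.length + s.length := by rw [FreeGroup.norm, hu]; simp
  have h3 : v.norm = p.length + t.length := by rw [FreeGroup.norm, hv]; simp
  omega

theorem norm_mul_add (u v : FreeGroup α) : (u * v).norm + 2 * gro u⁻¹ v = u.norm + v.norm := by
  have := norm_inv_mul u⁻¹ v
  rwa [inv_inv, norm_inv_eq] at this

theorem take_eq_of_le_gro {u v : FreeGroup α} {k : ℕ} (h : k ≤ gro u v) :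
    u.toWord.take k = v.toWord.take k := by
  obtain ⟨p, s, t, hu, hv, hp, -⟩ := gro_decomp u v
  rw [hu, hv, List.take_append_of_le_length (by omega), List.take_append_of_le_length (by omega)]

/-- A word of length `2 h` is the quotient of the prefixes of length `h` of it and its inverse. -/
theorem toWord_eq_append_invRev {v : FreeGroup α} {h : ℕ} (hv : v.norm = 2 * h) :
    v.toWord = v.toWord.take h ++ invRev (v⁻¹.toWord.take h) := by
  conv_lhs => rw [← List.take_append_drop h v.toWord]
  congr 1
  rw [toWord_inv, invRev, invRev, List.take_reverse, List.map_reverse]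
  rw [List.map_drop, List.map_map]
  have h1 : ((fun g : α × Bool => (g.1, !g.2)) ∘ fun g : α × Bool => (g.1, !g.2)) = id := by
    ext <;> simp
  have h2 : v.toWord.length = 2 * h := hv
  rw [h1, List.reverse_reverse, List.map_id, List.length_map, h2]
  congr 1
  omega

/-- If v and its inverse agreed on half of their letters, then for even length the two halves of v
would be inverse to each other and v = 1, and for odd length the middle letter would be its own
inverse. -/
theorem two_mul_gro_inv_self_lt {v : FreeGroup α} (hv : v ≠ 1) : 2 * gro v⁻¹ v < v.norm := by
  by_contra! hcon
  rcases Nat.even_or_odd' v.norm with ⟨k, hk | hk⟩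
  · have h1 := take_eq_of_le_gro (u := v⁻¹) (v := v) (k := k) (by omega)
    have h2 := toWord_eq_append_invRev hk
    rw [h1] at h2
    apply hv
    rw [← mk_toWord (x := v), h2, ← mul_mk, ← inv_mk, mul_inv_cancel]
  · have h1 := take_eq_of_le_gro (u := v⁻¹) (v := v) (k := k + 1) (by omega)
    have hl : v.toWord.length = 2 * k + 1 := hk
    have h2 : (v⁻¹.toWord.take (k + 1))[k]? = (v.toWord.take (k + 1))[k]? := by rw [h1]
    rw [List.getElem?_take_of_lt (by omega), List.getElem?_take_of_lt (by omega)] at h2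
    have h3 : k < v⁻¹.toWord.length := by rw [toWord_inv]; simp; omega
    rw [List.getElem?_eq_getElem h3, List.getElem?_eq_getElem (by omega), Option.some_inj] at h2
    have h4 := invRev_getElem v.toWord k (by omega)
    have h5 : v.toWord.length - 1 - k = k := by omega
    simp only [toWord_inv] at h2
    rw [h2] at h4
    simp only [h5] at h4
    have := congrArg Prod.snd h4
    simp at this

end FreeGroupLength

/-! ### Nielsen reduction -/

section NielsenReduction

open FreeGroup hiding map_one map_inv map_mul

variable {α : Type*}

/-- The transvections of a free group. -/
def transvections (α : Type*) : Set (MulAut (FreeGroup α)) :=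
  {e | ∃ i j, i ≠ j ∧ (∀ k, k ≠ i → e (of k) = of k) ∧
    (e (of i) = of i * of j ∨ e (of i) = of j * of i)}

/-- The subgroup generated by the transvections. -/
def EAut (α : Type*) : Subgroup (MulAut (FreeGroup α)) := Subgroup.closure (transvections α)

theorem mk_true (i : α) : mk [(i, true)] = of i := rfl

theorem mk_false (i : α) : mk [(i, false)] = (of i)⁻¹ := rfl

variable [DecidableEq α]

theorem repl_of_letter {i j : α} (h : i ≠ j) : repl i 1 (of j) = of j := repl_of_ne h.symm _

theorem nielsen_right_mem_EAut {i j : α} (h : i ≠ j) :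
    nielsen i 1 (of j) (map_one _) (repl_of_letter h) ∈ EAut α :=
  Subgroup.subset_closure ⟨i, j, h, fun _ hk => nielsen_of_ne hk _ _ _ _,
    Or.inl (by rw [nielsen_self, one_mul])⟩

theorem nielsen_left_mem_EAut {i j : α} (h : i ≠ j) :
    nielsen i (of j) 1 (repl_of_letter h) (map_one _) ∈ EAut α :=
  Subgroup.subset_closure ⟨i, j, h, fun _ hk => nielsen_of_ne hk _ _ _ _,
    Or.inr (by rw [nielsen_self, mul_one])⟩

theorem nielsen_inv_self {k : α} {u v : FreeGroup α} (hu : repl k 1 u = u) (hv : repl k 1 v = v) :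
    (nielsen k u v hu hv)⁻¹ (of k) = u⁻¹ * of k * v⁻¹ := repl_self _ _

theorem nielsen_inv_of_ne {k j : α} (h : j ≠ k) {u v : FreeGroup α} (hu : repl k 1 u = u)
    (hv : repl k 1 v = v) : (nielsen k u v hu hv)⁻¹ (of j) = of j := repl_of_ne h _

/-- A letter can be multiplied on the right by another letter. -/
theorem exists_letter_move (a b : α × Bool) (h : a.1 ≠ b.1) :
    ∃ e ∈ EAut α, e (mk [a]) = mk [a] * mk [b] ∧ ∀ k, k ≠ a.1 → e (of k) = of k := by
  obtain ⟨i, s⟩ := a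
  obtain ⟨j, t⟩ := b
  cases s <;> cases t <;> simp only [mk_true, mk_false] at h ⊢
  · exact ⟨_, nielsen_left_mem_EAut h, by rw [map_inv, nielsen_self]; group,
      fun k hk => nielsen_of_ne hk _ _ _ _⟩
  · exact ⟨_, inv_mem (nielsen_left_mem_EAut h), by rw [map_inv, nielsen_inv_self]; group,
      fun k hk => nielsen_inv_of_ne hk _ _⟩
  · exact ⟨_, inv_mem (nielsen_right_mem_EAut h), by rw [nielsen_inv_self]; group,
      fun k hk => nielsen_inv_of_ne hk _ _⟩
  · exact ⟨_, nielsen_right_mem_EAut h, by simp [nielsen_self],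
      fun k hk => nielsen_of_ne hk _ _ _ _⟩

variable [Fintype α]

/-- The number with the given letters as its digits in a suitable base. -/
noncomputable def wnum (w : List (α × Bool)) : ℕ :=
  Nat.ofDigits (Fintype.card (α × Bool) + 2)
    (w.reverse.map fun a => ((Fintype.equivFin (α × Bool) a : Fin _) : ℕ))

-- The base is `card + 2` so that it exceeds both every digit and 1, even for an empty alphabet.
omit [DecidableEq α] in
theorem wnum_inj {p q : List (α × Bool)} (h : p.length = q.length) (hpq : wnum p = wnum q) :
    p = q := by
  have hd : ∀ w : List (α × Bool), ∀ l ∈ w.reverse.map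
      (fun a => ((Fintype.equivFin (α × Bool) a : Fin _) : ℕ)),
      l < Fintype.card (α × Bool) + 2 := by
    intro w l hl
    obtain ⟨a, -, rfl⟩ := List.mem_map.1 hl
    have := (Fintype.equivFin (α × Bool) a).2
    omega
  have h1 := Nat.ofDigits_inj_of_len_eq (by omega) (by simp [h]) (hd p) (hd q) hpq
  have h2 := List.map_injective_iff.2
    (Fin.val_injective.comp (Fintype.equivFin (α × Bool)).injective) h1
  simpa using h2

-- The last letter is the lowest digit, so appending s multiplies both numbers by the same power of
-- the base and adds the same constant.
omit [DecidableEq α] in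
theorem wnum_append_lt {p q : List (α × Bool)} (h : wnum p < wnum q) (s : List (α × Bool)) :
    wnum (p ++ s) < wnum (q ++ s) := by
  unfold wnum at *
  simp only [List.reverse_append, List.map_append, Nat.ofDigits_append]
  gcongr

/-- The first half of a reduced word. -/
def half (u : FreeGroup α) : List (α × Bool) := u.toWord.take ((u.norm + 1) / 2)

/-- The weight that breaks ties between elements of the same length. -/
noncomputable def tie (u : FreeGroup α) : ℕ := wnum (half u) + wnum (half u⁻¹)

theorem tie_inv (u : FreeGroup α) : tie u⁻¹ = tie u := by
  rw [tie, tie, inv_inv, add_comm]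

/-- Here v = p q⁻¹ with p and q of length h, and w starts with q. Multiplying by v replaces this q
by p and touches nothing else; since 2h is at most the length of w, the second half survives and
only one of the two summands of the weight changes. -/
theorem tie_mul_lt {v w : FreeGroup α} {h : ℕ} (hv : v.norm = 2 * h) (hh : h ≤ gro v⁻¹ w)
    (hw : 2 * h ≤ w.norm) (hvw : (v * w).norm = w.norm)
    (hlt : wnum (v.toWord.take h) < wnum (v⁻¹.toWord.take h)) : tie (v * w) < tie w := by
  set p := v.toWord.take h with hp
  set q := v⁻¹.toWord.take h with hq
  have hpl : p.length = h := by
    have : v.toWord.length = 2 * h := hv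
    rw [hp, List.length_take]; omega
  have hql : q.length = h := by
    have : v⁻¹.toWord.length = 2 * h := norm_inv_eq.trans hv
    rw [hq, List.length_take]; omega
  have hv' : v.toWord = p ++ invRev q := toWord_eq_append_invRev hv
  have hw' : w.toWord = q ++ w.toWord.drop h := by
    rw [hq, take_eq_of_le_gro hh, List.take_append_drop]
  set c := w.toWord.drop h
  have hcl : w.norm = h + c.length := by
    rw [FreeGroup.norm, hw', List.length_append, hql]
  have hmul : v * w = mk (p ++ c) := by
    rw [← mk_toWord (x := v), ← mk_toWord (x := w), hv', hw', ← mul_mk, ← mul_mk, ← mul_mk,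
      ← inv_mk]
    group
  have hvw' : (v * w).toWord = p ++ c := by
    rw [hmul]
    apply toWord_mk_of_norm
    rw [← hmul, hvw, hcl, List.length_append, hpl]
  have e1 : half (v * w) = p ++ c.take ((w.norm + 1) / 2 - h) := by
    rw [half, hvw, hvw', List.take_append, List.take_of_length_le (by omega), hpl]
  have e2 : half w = q ++ c.take ((w.norm + 1) / 2 - h) := by
    conv_lhs => rw [half, hw']
    rw [List.take_append, List.take_of_length_le (by omega), hql]
  -- The half of the inverse word lies inside the inverse of c, away from the exchanged prefix.
  have hcl' : (w.norm + 1) / 2 ≤ (invRev c).length := by rw [invRev_length]; omega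
  have e3 : half (v * w)⁻¹ = half w⁻¹ := by
    rw [half, half, norm_inv_eq, norm_inv_eq, hvw, toWord_inv, toWord_inv, hvw', hw',
      invRev_append, invRev_append, List.take_append_of_le_length hcl',
      List.take_append_of_le_length hcl']
  rw [tie, tie, e1, e2, e3]
  have := wnum_append_lt hlt (c.take ((w.norm + 1) / 2 - h))
  omega

omit [Fintype α] [DecidableEq α] in
theorem mk_letter_inv (a : α × Bool) : mk [(a.1, !a.2)] = (mk [a])⁻¹ := by
  rw [inv_mk]; rfl

omit [Fintype α] [DecidableEq α] in
theorem inv_invariant_letter {β : Type*} (f : FreeGroup α → β) (hf : ∀ u, f u⁻¹ = f u)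
    (φ : MulAut (FreeGroup α)) (a : α × Bool) : f (φ (mk [a])) = f (φ (of a.1)) := by
  obtain ⟨i, s⟩ := a
  cases s
  · rw [mk_false, map_inv, hf]
  · rfl

/-- Only the summand of the generator underlying a changes, and f does not see the sign of the
letter. Applied to the length and to the weight. -/
theorem sum_letter_move {f : FreeGroup α → ℕ} (hf : ∀ u, f u⁻¹ = f u)
    (φ e : MulAut (FreeGroup α)) {a b : α × Bool}
    (he : e (mk [a]) = mk [a] * mk [b]) (hk : ∀ k, k ≠ a.1 → e (of k) = of k) :
    ∑ i, f ((φ * e) (of i)) + f (φ (mk [a])) =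
      ∑ i, f (φ (of i)) + f (φ (mk [a]) * φ (mk [b])) := by
  rw [inv_invariant_letter f hf, ← map_mul, ← he, ← MulAut.mul_apply,
    inv_invariant_letter f hf, ← Finset.add_sum_erase _ _ (Finset.mem_univ a.1),
    ← Finset.add_sum_erase (s := Finset.univ) (a := a.1) (fun i => f (φ (of i)))
      (Finset.mem_univ a.1)]
  have : ∑ x ∈ Finset.univ.erase a.1, f ((φ * e) (of x)) =
      ∑ x ∈ Finset.univ.erase a.1, f (φ (of x)) :=
    Finset.sum_congr rfl fun x hx => by
      rw [MulAut.mul_apply, hk x (Finset.ne_of_mem_erase hx)]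
  rw [this]
  omega

/-- Minimality under multiplying a letter by another one. -/
def NielsenMinimal (φ : MulAut (FreeGroup α)) : Prop :=
  ∀ a b : α × Bool, a.1 ≠ b.1 →
    (φ (mk [a])).norm ≤ (φ (mk [a]) * φ (mk [b])).norm ∧
    ((φ (mk [a]) * φ (mk [b])).norm = (φ (mk [a])).norm →
      tie (φ (mk [a])) ≤ tie (φ (mk [a]) * φ (mk [b])))

/-- Minimise the pair (total length, total weight) lexicographically over the coset of `EAut`: a
letter move that violated minimality would lower this pair. -/
theorem exists_nielsenMinimal (φ : MulAut (FreeGroup α)) :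
    ∃ e ∈ EAut α, NielsenMinimal (φ * e) := by
  let F : MulAut (FreeGroup α) → ℕ ×ₗ ℕ := fun e =>
    toLex (∑ i, ((φ * e) (of i)).norm, ∑ i, tie ((φ * e) (of i)))
  obtain ⟨-, ⟨e, he, rfl⟩, hmin⟩ :=
    (wellFounded_lt (α := ℕ ×ₗ ℕ)).has_min (F '' (EAut α)) ⟨_, 1, one_mem _, rfl⟩
  refine ⟨e, he, fun a b hab => ?_⟩
  obtain ⟨g, hg, hga, hgk⟩ := exists_letter_move a b hab
  have h := hmin (F (e * g)) ⟨_, mul_mem he hg, rfl⟩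
  have h1 := sum_letter_move (f := FreeGroup.norm) (fun u => norm_inv_eq) (φ * e) g hga hgk
  have h2 := sum_letter_move (f := tie) tie_inv (φ * e) g hga hgk
  rw [mul_assoc] at h1 h2
  rw [Prod.Lex.toLex_lt_toLex] at h
  simp only [not_or, not_and, not_lt] at h
  obtain ⟨h3, h4⟩ := h
  refine ⟨by omega, fun heq => ?_⟩
  have := h4 (by omega)
  omega

end NielsenReduction

/-! ### Nielsen minimal automorphisms do not shorten words -/

section NielsenReduced

open FreeGroup hiding map_one map_inv map_mul

variable {α : Type*} [DecidableEq α] [Fintype α]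

omit [Fintype α] [DecidableEq α] in
theorem letter_ne_one (φ : MulAut (FreeGroup α)) (a : α × Bool) : φ (mk [a]) ≠ 1 := by
  classical
  rw [Ne, EmbeddingLike.map_eq_one_iff]
  intro h
  have := norm_eq_zero.2 h
  rw [FreeGroup.norm, toWord_mk_of_isReduced IsReduced.singleton] at this
  simp at this

/-- The hypothesis says that b is not the inverse letter of a. For different generators the bound is
minimality of length; for a = b it holds for every nontrivial element. -/
theorem NielsenMinimal.two_mul_gro_le_left {φ : MulAut (FreeGroup α)} (h : NielsenMinimal φ)
    {a b : α × Bool} (hab : a.1 = b.1 → a.2 = b.2) :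
    2 * gro (φ (mk [a]))⁻¹ (φ (mk [b])) ≤ (φ (mk [b])).norm := by
  by_cases hne : a.1 = b.1
  · have : a = b := Prod.ext hne (hab hne)
    subst this
    exact (two_mul_gro_inv_self_lt (letter_ne_one φ a)).le
  · have h1 := (h a b hne).1
    have h2 := norm_mul_add (φ (mk [a])) (φ (mk [b]))
    omega

/-- This is where the tie-breaking weight is needed. At most half of φ(b) cancels on either side, so
if it is used up then exactly half cancels on both. Write φ(b) = p q⁻¹ with halves of equal length.
Neither φ(a)φ(b) nor φ(b)φ(c) changes the length of the outer factor, and minimality of the two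
weights excludes both inequalities between the numbers of p and q. Hence p = q and φ(b) = 1, which
is absurd. -/
theorem NielsenMinimal.gro_add_gro_lt {φ : MulAut (FreeGroup α)} (h : NielsenMinimal φ)
    {a b c : α × Bool} (hab : a.1 = b.1 → a.2 = b.2) (hbc : b.1 = c.1 → b.2 = c.2) :
    gro (φ (mk [a]))⁻¹ (φ (mk [b])) + gro (φ (mk [b]))⁻¹ (φ (mk [c])) < (φ (mk [b])).norm := by
  have hba' : ((b.1, !b.2) : α × Bool).1 = ((a.1, !a.2) : α × Bool).1 →
      ((b.1, !b.2) : α × Bool).2 = ((a.1, !a.2) : α × Bool).2 := fun e => by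
    simp only at e ⊢
    rw [hab e.symm]
  have hcb' : ((c.1, !c.2) : α × Bool).1 = ((b.1, !b.2) : α × Bool).1 →
      ((c.1, !c.2) : α × Bool).2 = ((b.1, !b.2) : α × Bool).2 := fun e => by
    simp only at e ⊢
    rw [hbc e.symm]
  have n1 := h.two_mul_gro_le_left hab
  have n2 := h.two_mul_gro_le_left hbc
  have n3 := h.two_mul_gro_le_left hba'
  have n4 := h.two_mul_gro_le_left hcb'
  simp only [mk_letter_inv, map_inv, inv_inv, norm_inv_eq] at n3 n4
  rw [gro_comm] at n3 n4
  by_contra! hcon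
  have hv1 : φ (mk [b]) ≠ 1 := letter_ne_one φ b
  have hane : a.1 ≠ b.1 := fun e => by
    obtain rfl : a = b := Prod.ext e (hab e)
    have := two_mul_gro_inv_self_lt hv1
    omega
  have hcne : b.1 ≠ c.1 := fun e => by
    obtain rfl : b = c := Prod.ext e (hbc e)
    have := two_mul_gro_inv_self_lt hv1
    omega
  obtain ⟨k, hk⟩ : ∃ k, (φ (mk [b])).norm = 2 * k := ⟨gro (φ (mk [b]))⁻¹ (φ (mk [c])), by omega⟩
  have g1 : gro (φ (mk [a]))⁻¹ (φ (mk [b])) = k := by omega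
  have g2 : gro (φ (mk [b]))⁻¹ (φ (mk [c])) = k := by omega
  have m1 := norm_mul_add (φ (mk [b])) (φ (mk [c]))
  have m2 := norm_mul_add (φ (mk [b]))⁻¹ (φ (mk [a]))⁻¹
  rw [inv_inv, gro_comm, norm_inv_eq, norm_inv_eq] at m2
  have hc := (h (c.1, !c.2) (b.1, !b.2) hcne.symm).2
  have ha := (h a b hane).2
  simp only [mk_letter_inv, map_inv] at hc
  rw [← mul_inv_rev, norm_inv_eq, norm_inv_eq, tie_inv, tie_inv] at hc
  have hc' := hc (by omega)
  rw [← mul_inv_rev, norm_inv_eq] at m2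
  have ha' := ha (by omega)
  have l1 : ¬ wnum ((φ (mk [b])).toWord.take k) < wnum ((φ (mk [b]))⁻¹.toWord.take k) := fun hlt =>
    absurd (tie_mul_lt hk g2.ge (by omega) (by omega) hlt) (by omega)
  have l2 : ¬ wnum ((φ (mk [b]))⁻¹.toWord.take k) < wnum ((φ (mk [b])).toWord.take k) := fun hlt => by
    have := tie_mul_lt (v := (φ (mk [b]))⁻¹) (w := (φ (mk [a]))⁻¹) (h := k)
      (by rw [norm_inv_eq, hk]) (by rw [inv_inv, gro_comm, g1]) (by rw [norm_inv_eq]; omega)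
      (by rw [← mul_inv_rev, norm_inv_eq, norm_inv_eq]; omega) (by rwa [inv_inv])
    rw [← mul_inv_rev, tie_inv, tie_inv] at this
    omega
  have hl1 : (φ (mk [b])).toWord.length = 2 * k := hk
  have hl2 : (φ (mk [b]))⁻¹.toWord.length = 2 * k := norm_inv_eq.trans hk
  have heq := wnum_inj (by rw [List.length_take, List.length_take]; omega)
    (le_antisymm (not_lt.1 l2) (not_lt.1 l1))
  have hw := toWord_eq_append_invRev hk
  rw [heq] at hw
  apply hv1
  rw [← mk_toWord (x := φ (mk [b])), hw, ← mul_mk, ← inv_mk, mul_inv_cancel]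

/-- Two facts are proved together along a reduced word: φ(a) cancels against the image of the rest
only as far as against the image of the next letter, and each further letter adds at least one to
the length. The first holds because the surviving prefix of φ(b) is longer than the part that φ(a)
can cancel, so the ultrametric inequality forces equality. -/
theorem NielsenMinimal.word_estimate {φ : MulAut (FreeGroup α)} (h : NielsenMinimal φ) :
    ∀ (L : List (α × Bool)) (a : α × Bool), IsReduced (a :: L) →
      gro (φ (mk [a]))⁻¹ (φ (mk L)) =
        (L.head?.map fun b => gro (φ (mk [a]))⁻¹ (φ (mk [b]))).getD 0 ∧
      L.length + (φ (mk [a])).norm ≤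
        (φ (mk (a :: L))).norm + gro (φ (mk [a]))⁻¹ (φ (mk L)) := by
  intro L
  induction L with
  | nil =>
    intro a _
    have h1 : φ (mk ([] : List (α × Bool))) = 1 := map_one φ
    have h2 := gro_le_right (φ (mk [a]))⁻¹ 1
    rw [FreeGroup.norm_one] at h2
    rw [h1]
    simp; omega
  | cons b L ih =>
    intro a hred
    rw [isReduced_cons_cons] at hred
    obtain ⟨hab, hred⟩ := hred
    obtain ⟨ih1, ih2⟩ := ih b hred
    have e1 : φ (mk (b :: L)) = φ (mk [b]) * φ (mk L) := by rw [← map_mul, mul_mk]; rfl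
    have e2 : φ (mk (a :: b :: L)) = φ (mk [a]) * φ (mk (b :: L)) := by
      rw [← map_mul, mul_mk]; rfl
    have n1 := norm_mul_add (φ (mk [b])) (φ (mk L))
    rw [← e1] at n1
    have n2 := norm_inv_mul (φ (mk [b])) (φ (mk (b :: L)))
    rw [e1, inv_mul_cancel_left, ← e1] at n2
    have n3 := norm_mul_add (φ (mk [a])) (φ (mk (b :: L)))
    rw [← e2] at n3
    have hlt : gro (φ (mk [a]))⁻¹ (φ (mk [b])) + gro (φ (mk [b]))⁻¹ (φ (mk L)) <
        (φ (mk [b])).norm := by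
      cases L with
      | nil =>
        simp only [List.head?_nil, Option.map_none, Option.getD_none] at ih1
        have h1 := h.two_mul_gro_le_left hab
        have h2 : (φ (mk [b])).norm ≠ 0 := fun h0 => letter_ne_one φ b (norm_eq_zero.1 h0)
        omega
      | cons c L =>
        rw [isReduced_cons_cons] at hred
        simp only [List.head?_cons, Option.map_some, Option.getD_some] at ih1
        have := h.gro_add_gro_lt hab hred.1
        omega
    have u1 := gro_ultra (φ (mk [a]))⁻¹ (φ (mk [b])) (φ (mk (b :: L)))
    have u2 := gro_ultra (φ (mk [a]))⁻¹ (φ (mk (b :: L))) (φ (mk [b]))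
    rw [gro_comm (φ (mk (b :: L)))] at u2
    have key : gro (φ (mk [a]))⁻¹ (φ (mk (b :: L))) = gro (φ (mk [a]))⁻¹ (φ (mk [b])) := by omega
    refine ⟨by simpa using key, ?_⟩
    simp only [List.length_cons]
    omega

theorem NielsenMinimal.norm_le {φ : MulAut (FreeGroup α)} (h : NielsenMinimal φ)
    (w : FreeGroup α) : w.norm ≤ (φ w).norm := by
  rcases hw : w.toWord with _ | ⟨a, L⟩
  · rw [FreeGroup.norm, hw]; simp
  · have hred : IsReduced (a :: L) := hw ▸ isReduced_toWord
    obtain ⟨h1, h2⟩ := h.word_estimate L a hred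
    have h3 : gro (φ (mk [a]))⁻¹ (φ (mk L)) < (φ (mk [a])).norm := by
      have h0 : (φ (mk [a])).norm ≠ 0 := fun h0 => letter_ne_one φ a (norm_eq_zero.1 h0)
      cases L with
      | nil => simp only [List.head?_nil, Option.map_none, Option.getD_none] at h1; omega
      | cons b L =>
        rw [isReduced_cons_cons] at hred
        simp only [List.head?_cons, Option.map_some, Option.getD_some] at h1
        have := h.two_mul_gro_le_left (b := (a.1, !a.2)) (a := (b.1, !b.2)) (fun e => by
          simp only at e ⊢; rw [hred.1 e.symm])
        simp only [mk_letter_inv, map_inv, inv_inv, norm_inv_eq] at this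
        rw [gro_comm] at this
        omega
    rw [← mk_toWord (x := w), hw, FreeGroup.norm, toWord_mk_of_isReduced hred]
    simp only [List.length_cons]
    omega

/-- Automorphisms that send every generator to a generator or its inverse. -/
def IsMonomial (φ : MulAut (FreeGroup α)) : Prop := ∀ i, ∃ a : α × Bool, φ (of i) = mk [a]

/-- **Nielsen's theorem**: up to transvections, every automorphism of a free group of finite rank
is monomial. -/
theorem exists_isMonomial_mul (φ : MulAut (FreeGroup α)) : ∃ e ∈ EAut α, IsMonomial (e * φ) := by
  -- The inverse is reduced, so that φ⁻¹e maps (e⁻¹φ)(k) to the generator k; as it does not shorten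
  -- words, (e⁻¹φ)(k) has length at most one.
  obtain ⟨e, he, hmin⟩ := exists_nielsenMinimal φ⁻¹
  refine ⟨e⁻¹, inv_mem he, fun i => ?_⟩
  have h1 := hmin.norm_le ((e⁻¹ * φ) (of i))
  rw [← MulAut.mul_apply, show φ⁻¹ * e * (e⁻¹ * φ) = 1 by group, MulAut.one_apply, norm_of] at h1
  have h0 : ((e⁻¹ * φ) (of i)).norm ≠ 0 := by
    rw [Ne, FreeGroup.norm_eq_zero, EmbeddingLike.map_eq_one_iff]
    exact of_ne_one i
  have h2 : ((e⁻¹ * φ) (of i)).toWord.length = 1 := by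
    change FreeGroup.norm _ = 1
    omega
  obtain ⟨a, ha⟩ := List.length_eq_one_iff.1 h2
  exact ⟨a, by rw [← ha, mk_toWord]⟩

end NielsenReduced

/-! ### Elementary generation of `GL(n, ℤ)` -/

section IntegralMatrices

open Matrix

variable {n : ℕ}

/-- A subgroup of `GL(n, ℤ)` that contains the transvections and the sign changes. -/
structure IsElementary (P : Subgroup (GL (Fin n) ℤ)) : Prop where
  transvection_mem : ∀ i j, i ≠ j → ∃ g ∈ P, (g : Matrix (Fin n) (Fin n) ℤ) = transvection i j 1
  sign_mem : ∀ i, ∃ g ∈ P, (g : Matrix (Fin n) (Fin n) ℤ) = diagonal (Function.update 1 i (-1))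

theorem transvection_mem_of_one {P : Subgroup (GL (Fin n) ℤ)} {i j : Fin n} (h : i ≠ j)
    (hP : ∃ g ∈ P, (g : Matrix (Fin n) (Fin n) ℤ) = transvection i j 1) (c : ℤ) :
    ∃ g ∈ P, (g : Matrix (Fin n) (Fin n) ℤ) = transvection i j c := by
  obtain ⟨g, hg, hgc⟩ := hP
  refine ⟨g ^ c, zpow_mem hg c, ?_⟩
  induction c with
  | zero => simp
  | succ c ih =>
    rw [_root_.zpow_add, zpow_one, Units.val_mul, ih, hgc, transvection_mul_transvection_same _ _ h]
  | pred c ih =>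
    have h1 : (g⁻¹ : GL (Fin n) ℤ).1 = transvection i j (-1) := by
      rw [← mul_one (g⁻¹ : GL (Fin n) ℤ).1, ← transvection_zero i j, ← add_neg_cancel (1 : ℤ),
        ← transvection_mul_transvection_same _ _ h, ← hgc, Units.inv_mul_cancel_left]
    rw [_root_.zpow_sub, zpow_one, Units.val_mul, ih, h1, transvection_mul_transvection_same _ _ h]
    rfl

/-- The first `k` rows agree with those of the identity matrix. -/
def RowsOne (k : ℕ) (A : GL (Fin n) ℤ) : Prop := ∀ i : Fin n, (i : ℕ) < k → A.1 i = (1 : Matrix (Fin n) (Fin n) ℤ) i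

theorem RowsOne.inv {k : ℕ} {A : GL (Fin n) ℤ} (h : RowsOne k A) : RowsOne k A⁻¹ := by
  intro i hi
  ext j
  have h1 : (A.1 * A⁻¹.1) i j = (1 : Matrix (Fin n) (Fin n) ℤ) i j := by
    rw [← Units.val_mul, mul_inv_cancel]; rfl
  rw [← h1, mul_apply, h i hi]
  simp [one_apply]

/-- Column i is added to column j, and for i ≥ k it vanishes in the first k rows. -/
theorem RowsOne.mul_transvection {k : ℕ} {A g : GL (Fin n) ℤ} (h : RowsOne k A) {i j : Fin n}
    {c : ℤ} (hg : g.1 = transvection i j c) (hi : k ≤ i) : RowsOne k (A * g) := by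
  intro a ha
  ext b
  rw [Units.val_mul, hg]
  by_cases hb : b = j
  · subst hb
    have : a ≠ i := fun e => by subst e; omega
    rw [mul_transvection_apply_same, h a ha, one_apply_ne this]
    simp
  · rw [mul_transvection_apply_of_ne _ _ _ _ hb, h a ha]

theorem IsElementary.exists_rowsOne_succ_of_one {P : Subgroup (GL (Fin n) ℤ)}
    (hP : IsElementary P) {A : GL (Fin n) ℤ} (k : Fin n) (hA : RowsOne k A) (hk : A.1 k k = 1) :
    ∃ g ∈ P, RowsOne (k + 1) (A * g) := by
  have key : ∀ s : Finset (Fin n), k ∉ s → ∃ g ∈ P, RowsOne k (A * g) ∧ (A * g).1 k k = 1 ∧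
      ∀ j ∈ s, (A * g).1 k j = 0 := by
    intro s
    induction s using Finset.induction_on with
    | empty => exact fun _ => ⟨1, one_mem _, by rwa [mul_one], by rwa [mul_one], by simp⟩
    | insert j s hj ih =>
      intro hks
      rw [Finset.mem_insert, not_or] at hks
      obtain ⟨g, hg, h1, h2, h3⟩ := ih hks.2
      obtain ⟨t, ht, htc⟩ := transvection_mem_of_one hks.1 (hP.transvection_mem k j hks.1)
        (-(A * g).1 k j)
      refine ⟨g * t, mul_mem hg ht, ?_⟩
      rw [← mul_assoc]
      refine ⟨h1.mul_transvection htc le_rfl, ?_, ?_⟩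
      · rw [Units.val_mul _ t, htc, mul_transvection_apply_of_ne _ _ _ _ hks.1, h2]
      · intro i hi
        rw [Units.val_mul _ t, htc]
        by_cases hij : i = j
        · subst hij
          rw [mul_transvection_apply_same, h2]; ring
        · rw [mul_transvection_apply_of_ne _ _ _ _ hij]
          exact h3 i (Finset.mem_of_mem_insert_of_ne hi hij)
  obtain ⟨g, hg, h1, h2, h3⟩ := key (Finset.univ.erase k) (Finset.notMem_erase _ _)
  refine ⟨g, hg, fun i hi => ?_⟩
  rcases Nat.lt_succ_iff_lt_or_eq.1 hi with h | h
  · exact h1 i h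
  · obtain rfl : i = k := Fin.ext h
    ext j
    by_cases hj : j = i
    · subst hj; rw [h2, one_apply_eq]
    · rw [h3 j (by simp [hj]), one_apply_ne (Ne.symm hj)]

/-- A Euclidean algorithm on the part of row k from the diagonal on. When the sum of the absolute
values there is minimal, at most one entry is nonzero; it is a unit because row k times column k of
the inverse is 1, and the earlier entries of that column vanish. -/
theorem IsElementary.exists_rowsOne_succ {P : Subgroup (GL (Fin n) ℤ)}
    (hP : IsElementary P) {A : GL (Fin n) ℤ} (k : Fin n) (hA : RowsOne k A) :
    ∃ g ∈ P, RowsOne (k + 1) (A * g) := by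
  let F : GL (Fin n) ℤ → ℕ := fun g => ∑ j with k ≤ j, ((A * g).1 k j).natAbs
  obtain ⟨-, ⟨g, ⟨hg, hgr⟩, rfl⟩, hmin⟩ :=
    (wellFounded_lt (α := ℕ)).has_min (F '' {g | g ∈ P ∧ RowsOne k (A * g)})
      ⟨_, 1, ⟨one_mem _, by rwa [mul_one]⟩, rfl⟩
  have hzero : ∀ i j, k ≤ i → k ≤ j → i ≠ j → ((A * g).1 k i).natAbs ≤ ((A * g).1 k j).natAbs →
      (A * g).1 k i = 0 := by
    intro i j hi hj hij hle
    by_contra hne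
    -- Adding or subtracting the nonzero entry of smaller or equal absolute value shrinks the other
    -- one.
    obtain ⟨c, hc⟩ : ∃ c : ℤ,
        ((A * g).1 k j + c * (A * g).1 k i).natAbs < ((A * g).1 k j).natAbs := by
      rcases lt_trichotomy ((A * g).1 k i) 0 with h1 | h1 | h1
      · rcases le_total ((A * g).1 k j) 0 with h2 | h2
        · exact ⟨-1, by omega⟩
        · exact ⟨1, by omega⟩
      · exact absurd h1 hne
      · rcases le_total ((A * g).1 k j) 0 with h2 | h2
        · exact ⟨1, by omega⟩
        · exact ⟨-1, by omega⟩
    obtain ⟨t, ht, htc⟩ := transvection_mem_of_one hij (hP.transvection_mem i j hij) c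
    refine hmin _ ⟨g * t, ⟨mul_mem hg ht, ?_⟩, rfl⟩ ?_
    · rw [← mul_assoc]
      exact hgr.mul_transvection htc hi
    · refine Finset.sum_lt_sum (fun l _ => ?_) ⟨j, by simpa using hj, ?_⟩
      · rw [← mul_assoc, Units.val_mul _ t, htc]
        by_cases hl : l = j
        · subst hl; rw [mul_transvection_apply_same]; exact hc.le
        · rw [mul_transvection_apply_of_ne _ _ _ _ hl]
      · rw [← mul_assoc, Units.val_mul _ t, htc, mul_transvection_apply_same]; exact hc
  clear hmin
  suffices H : ∃ h ∈ P, RowsOne k (A * g * h) ∧ (A * g * h).1 k k = 1 by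
    obtain ⟨h, hh, h1, h2⟩ := H
    obtain ⟨e, he, h3⟩ := hP.exists_rowsOne_succ_of_one k h1 h2
    exact ⟨g * h * e, mul_mem (mul_mem hg hh) he, by simpa only [mul_assoc] using h3⟩
  generalize A * g = C at *
  have hCinv := hgr.inv
  have hsum : ∑ l, C.1 k l * C⁻¹.1 l k = 1 := by
    rw [← mul_apply, ← Units.val_mul, mul_inv_cancel, Units.val_one, one_apply_eq]
  obtain ⟨l, hkl, hl⟩ : ∃ l, k ≤ l ∧ C.1 k l ≠ 0 := by
    by_contra! hcon
    rw [Finset.sum_eq_zero] at hsum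
    · exact zero_ne_one hsum
    · intro l _
      rcases lt_or_ge l k with h | h
      · rw [hCinv l h, one_apply_ne h.ne, mul_zero]
      · rw [hcon l h, zero_mul]
  have hunit : IsUnit (C.1 k l) := by
    rw [Finset.sum_eq_single l] at hsum
    · exact IsUnit.of_mul_eq_one _ hsum
    · intro j _ hj
      rcases lt_or_ge j k with h | h
      · rw [hCinv j h, one_apply_ne h.ne, mul_zero]
      · rcases le_total (C.1 k j).natAbs (C.1 k l).natAbs with h1 | h1
        · rw [hzero j l h hkl hj h1, zero_mul]
        · exact absurd (hzero l j hkl h hj.symm h1) hl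
    · simp
  by_cases hlk : l = k
  · subst hlk
    rcases Int.isUnit_iff.1 hunit with h | h
    · exact ⟨1, one_mem _, by rwa [mul_one], by rwa [mul_one]⟩
    · obtain ⟨s, hs, hsc⟩ := hP.sign_mem l
      refine ⟨s, hs, fun i hi => ?_, ?_⟩
      · ext j
        rw [Units.val_mul, hsc, mul_diagonal, hgr i hi]
        by_cases hj : j = l
        · have : i ≠ j := fun e => by subst e hj; omega
          rw [one_apply_ne this, zero_mul]
        · simp [hj]
      · rw [Units.val_mul, hsc, mul_diagonal, h]; simp
  -- With the unit u in column l, adding u(1 - C_kk) times column l to column k makes the diagonal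
  -- entry 1, because u² = 1.
  · obtain ⟨t, ht, htc⟩ := transvection_mem_of_one hlk (hP.transvection_mem l k hlk)
      (C.1 k l * (1 - C.1 k k))
    refine ⟨t, ht, hgr.mul_transvection htc hkl, ?_⟩
    rw [Units.val_mul, htc, mul_transvection_apply_same]
    have : C.1 k l * C.1 k l = 1 := by
      rcases Int.isUnit_iff.1 hunit with h | h <;> rw [h] <;> rfl
    linear_combination (1 - C.1 k k) * this

/-- `GL(n, ℤ)` is generated by transvections and sign changes. -/
theorem IsElementary.eq_top {P : Subgroup (GL (Fin n) ℤ)} (hP : IsElementary P) : P = ⊤ := by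
  refine eq_top_iff.2 fun A _ => ?_
  have key : ∀ k ≤ n, ∃ g ∈ P, RowsOne k (A * g) := by
    intro k
    induction k with
    | zero => exact fun _ => ⟨1, one_mem _, fun i hi => absurd hi (by omega)⟩
    | succ k ih =>
      intro hk
      obtain ⟨g, hg, h1⟩ := ih (by omega)
      obtain ⟨h, hh, h2⟩ := hP.exists_rowsOne_succ ⟨k, hk⟩ h1
      exact ⟨g * h, mul_mem hg hh, by rwa [← mul_assoc]⟩
  obtain ⟨g, hg, h⟩ := key n le_rfl
  have h1 : A * g = 1 := Units.ext (funext fun i => h i i.2)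
  rw [eq_inv_of_mul_eq_one_left h1]
  exact inv_mem hg

end IntegralMatrices

/-! ### The action on the abelianization -/

section AbelianizationMatrix

open FreeGroup hiding map_one map_inv map_mul

/-- The `ℤ`-basis of `F / F'` given by the free generators. -/
noncomputable def abBasis (α : Type*) :
    Module.Basis α ℤ (Additive (Abelianization (FreeGroup α))) :=
  FreeAbelianGroup.basis α

theorem abBasis_apply {α : Type*} (i : α) : abBasis α i = abCls (of i) := by
  have h : (abBasis α).repr (abCls (of i)) = Finsupp.single i 1 :=
    FreeAbelianGroup.toFinsupp_of i
  rw [← Module.Basis.repr_symm_single_one, ← h, LinearEquiv.symm_apply_apply]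

variable {α : Type*}

/-- The exponent sum of the generator `i` in `w`. -/
noncomputable def ex (i : α) (w : FreeGroup α) : ℤ := (abBasis α).repr (abCls w) i

theorem ex_mul (i : α) (u v : FreeGroup α) : ex i (u * v) = ex i u + ex i v := by
  rw [ex, abCls_mul, map_add]; rfl

theorem ex_inv (i : α) (u : FreeGroup α) : ex i u⁻¹ = -ex i u := by
  rw [ex, abCls_inv, map_neg]; rfl

theorem ex_one (i : α) : ex i (1 : FreeGroup α) = 0 := by
  have := ex_mul i 1 1
  rw [mul_one] at this
  omega

theorem ex_of [DecidableEq α] (i j : α) : ex i (of j) = if i = j then 1 else 0 := by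
  rw [ex, ← abBasis_apply, Module.Basis.repr_self, Finsupp.single_apply]
  simp only [eq_comm]

theorem ex_of_self (i : α) : ex i (of i) = 1 := by classical simp [ex_of]

theorem ex_of_ne {i j : α} (h : i ≠ j) : ex i (of j) = 0 := by classical simp [ex_of, h]

theorem ex_commutator (i : α) (u v : FreeGroup α) : ex i ⁅u, v⁆ = 0 := by
  simp only [commutatorElement_def, ex_mul, ex_inv]; ring

variable [DecidableEq α] [Fintype α]

/-- The matrix of the action on `F / F'`. -/
noncomputable def abMat (α : Type*) [DecidableEq α] [Fintype α] :
    MulAut (FreeGroup α) →* GL α ℤ := (matRep (abBasis α)).comp (abAut _)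

omit [DecidableEq α] [Fintype α] in
theorem matRep_apply {ι M : Type*} [Fintype ι] [DecidableEq ι] [AddCommGroup M]
    (b : Module.Basis ι ℤ M) (f : M ≃ₗ[ℤ] M) (i j : ι) :
    (matRep b f).1 i j = b.repr (f (b j)) i :=
  LinearMap.toMatrixAlgEquiv_apply b _ i j

theorem abMat_apply (φ : MulAut (FreeGroup α)) (i j : α) :
    (abMat α φ).1 i j = ex i (φ (of j)) := by
  rw [abMat, MonoidHom.comp_apply, matRep_apply, abBasis_apply]
  rfl

theorem abMat_det (φ : MulAut (FreeGroup α)) :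
    (abMat α φ).1.det = (LinearEquiv.det (abAut _ φ) : ℤ) := by
  rw [LinearEquiv.coe_det, ← LinearMap.det_toMatrix (abBasis α)]
  rfl

/-- The matrix differs from the identity only in column k, so Cramer's rule for the identity reads
off its determinant. -/
theorem abMat_det_of_fix {φ : MulAut (FreeGroup α)} (k : α)
    (h : ∀ j, j ≠ k → φ (of j) = of j) : (abMat α φ).1.det = ex k (φ (of k)) := by
  have : (abMat α φ).1 = (1 : Matrix α α ℤ).updateCol k (fun i => ex i (φ (of k))) := by
    ext i j
    rw [abMat_apply, Matrix.updateCol_apply, Matrix.one_apply]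
    split_ifs with h1 h2
    · rw [h1]
    · rw [h j h1, h2, ex_of_self]
    · rw [h j h1, ex_of_ne h2]
  rw [this, ← Matrix.cramer_apply, Matrix.cramer_one]
  rfl

omit [Fintype α] in
theorem letter_injective {a b : α × Bool} (h : (mk [a] : FreeGroup α) = mk [b]) : a = b := by
  have := congrArg toWord h
  rw [toWord_mk_of_isReduced IsReduced.singleton,
    toWord_mk_of_isReduced IsReduced.singleton] at this
  simpa using this

/-- The inversion of a generator. -/
def invGen (i : α) : MulAut (FreeGroup α) :=
  MonoidHom.toMulEquiv (repl i (of i)⁻¹) (repl i (of i)⁻¹)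
    (by
      ext j
      rcases eq_or_ne j i with rfl | hj
      · simp [repl_self]
      · simp [repl_of_ne hj])
    (by
      ext j
      rcases eq_or_ne j i with rfl | hj
      · simp [repl_self]
      · simp [repl_of_ne hj])

omit [Fintype α] in
theorem invGen_self (i : α) : invGen i (of i) = (of i)⁻¹ := repl_self _ _

omit [Fintype α] in
theorem invGen_of_ne {i j : α} (h : j ≠ i) : invGen i (of j) = of j := repl_of_ne h _

end AbelianizationMatrix

/-! ### Automorphisms of determinant one are products of transvections -/

section SpecialAutomorphisms

open FreeGroup hiding map_one map_inv map_mul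

/-- Right Nielsen moves lift the transvections, and inversions of generators lift the sign changes.
-/
theorem abMat_surjective (n : ℕ) : Function.Surjective (abMat (Fin n)) := by
  rw [← MonoidHom.range_eq_top]
  refine IsElementary.eq_top ⟨fun i j hij => ⟨_, ⟨nielsen j 1 (of i) (map_one _)
    (repl_of_letter hij.symm), rfl⟩, ?_⟩, fun i => ⟨_, ⟨invGen i, rfl⟩, ?_⟩⟩
  · ext a b
    rw [abMat_apply, Matrix.transvection, Matrix.add_apply, Matrix.one_apply, Matrix.single_apply]
    by_cases hb : b = j
    · subst hb
      rw [nielsen_self, one_mul, ex_mul, ex_of, ex_of]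
      simp [eq_comm]
    · rw [nielsen_of_ne hb, ex_of]
      simp [Ne.symm hb]
  · ext a b
    rw [abMat_apply, Matrix.diagonal_apply]
    by_cases hb : b = i
    · subst hb
      rw [invGen_self, ex_inv, ex_of]
      by_cases ha : a = b <;> simp [ha]
    · rw [invGen_of_ne hb, ex_of]
      by_cases ha : a = b <;> simp [ha, hb]

variable {m : ℕ}

theorem mem_APlus_iff {φ : MulAut (Fr m)} : φ ∈ APlus m ↔ (abMat (Fin (m + 1)) φ).1.det = 1 := by
  rw [abMat_det, APlus, MonoidHom.mem_ker, MonoidHom.comp_apply, Units.val_eq_one]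

theorem mem_IA_iff {φ : MulAut (Fr m)} : φ ∈ IA m ↔ abMat (Fin (m + 1)) φ = 1 := by
  rw [IA, MonoidHom.mem_ker, abMat, MonoidHom.comp_apply]
  refine ⟨fun h => by rw [h, map_one], fun h => ?_⟩
  have h1 : ∀ f : Additive (Abelianization (Fr m)) ≃ₗ[ℤ] Additive (Abelianization (Fr m)),
      matRep (abBasis _) f = 1 → f = 1 := by
    intro f hf
    refine LinearEquiv.toLinearMap_injective ((abBasis _).ext fun j => ?_)
    refine (abBasis _).repr.injective (Finsupp.ext fun i => ?_)
    have := matRep_apply (abBasis (Fin (m + 1))) f i j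
    rw [hf] at this
    refine this.symm.trans ?_
    rw [Units.val_one, Matrix.one_apply]
    change _ = (abBasis _).repr (abBasis _ j) i
    rw [Module.Basis.repr_self, Finsupp.single_apply]
    simp only [eq_comm]
  exact h1 _ h

theorem mem_APlus_of_fix {φ : MulAut (Fr m)} (k : Fin (m + 1))
    (h : ∀ j, j ≠ k → φ (of j) = of j) (hk : ex k (φ (of k)) = 1) : φ ∈ APlus m := by
  rw [mem_APlus_iff, abMat_det_of_fix k h, hk]

theorem EAut_le_APlus : EAut (Fin (m + 1)) ≤ APlus m := by
  refine (Subgroup.closure_le _).2 ?_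
  rintro e ⟨i, j, hij, h1, h2⟩
  refine mem_APlus_of_fix i h1 ?_
  rcases h2 with h2 | h2 <;> rw [h2, ex_mul, ex_of_self, ex_of_ne hij] <;> rfl

/-- The free-group form of writing a quarter turn in SL(2, ℤ) as a product of three transvections.
-/
theorem exists_signed_swap {α : Type*} [DecidableEq α] {a b : α} (h : a ≠ b) :
    ∃ e ∈ EAut α, e (of a) = of b ∧ e (of b) = (of a)⁻¹ ∧
      ∀ k, k ≠ a → k ≠ b → e (of k) = of k := by
  obtain ⟨p, hp, p1, p2⟩ := exists_letter_move (a, true) (b, true) h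
  obtain ⟨q, hq, q1, q2⟩ := exists_letter_move (b, true) (a, false) h.symm
  obtain ⟨s, hs, s1, s2⟩ := exists_letter_move (a, false) (b, false) h
  simp only [mk_true, mk_false, map_inv] at p1 q1 s1 p2 q2 s2
  rw [inv_eq_iff_eq_inv] at s1
  refine ⟨p * q * s, mul_mem (mul_mem hp hq) hs, ?_, ?_, fun k ha hb => ?_⟩
  · simp only [MulAut.mul_apply, s1, map_mul, map_inv, q1, q2 a h, p1, p2 b h.symm]
    group
  · simp only [MulAut.mul_apply, s2 b h.symm, map_mul, map_inv, q1, p1, p2 b h.symm]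
    group
  · simp only [MulAut.mul_apply, s2 k ha, q2 k hb, p2 k ha]

theorem IsMonomial.mul {α : Type*} {φ ψ : MulAut (FreeGroup α)} (hφ : IsMonomial φ)
    (hψ : IsMonomial ψ) : IsMonomial (φ * ψ) := by
  intro i
  obtain ⟨⟨j, s⟩, hj⟩ := hψ i
  obtain ⟨⟨k, t⟩, hk⟩ := hφ j
  rw [MulAut.mul_apply, hj]
  cases s
  · refine ⟨(k, !t), ?_⟩
    rw [mk_false, map_inv, hk, inv_mk]
    rfl
  · exact ⟨(k, t), hk⟩

theorem isMonomial_signed_swap {α : Type*} {a b : α} {e : MulAut (FreeGroup α)}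
    (h1 : e (of a) = of b) (h2 : e (of b) = (of a)⁻¹)
    (h3 : ∀ k, k ≠ a → k ≠ b → e (of k) = of k) : IsMonomial e := by
  intro i
  by_cases ha : i = a
  · exact ⟨(b, true), by rw [ha, h1]; rfl⟩
  · by_cases hb : i = b
    · exact ⟨(a, false), by rw [hb, h2]; rfl⟩
    · exact ⟨(i, true), by rw [h3 i ha hb]; rfl⟩

/-- A signed swap brings the image of generator k to k or its inverse; injectivity puts the old
image among the later generators, so the fixed ones are not disturbed. A wrong sign is passed to a
later generator by the square of a signed swap, and at the last generator it is excluded by the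
determinant. -/
theorem exists_fix_succ {φ : MulAut (Fr m)} (hφ : IsMonomial φ) (hdet : φ ∈ APlus m)
    (k : Fin (m + 1)) (hk : ∀ i < k, φ (of i) = of i) :
    ∃ e ∈ EAut (Fin (m + 1)), IsMonomial (e * φ) ∧ ∀ i ≤ k, (e * φ) (of i) = of i := by
  obtain ⟨e, he, hm, hfix, s, hs⟩ : ∃ e ∈ EAut (Fin (m + 1)), IsMonomial (e * φ) ∧
      (∀ i < k, (e * φ) (of i) = of i) ∧ ∃ s, (e * φ) (of k) = mk [(k, s)] := by
    obtain ⟨⟨j, s⟩, hj⟩ := hφ k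
    by_cases hjk : j = k
    · exact ⟨1, one_mem _, by rwa [one_mul], by rwa [one_mul], s, by rw [one_mul, hj, hjk]⟩
    · have hlt : k < j := by
        rcases lt_trichotomy j k with h | h | h
        · have h1 := hk j h
          have h2 : φ (mk [(j, s)]) = mk [(j, s)] := by
            cases s
            · rw [mk_false, map_inv, h1]
            · exact h1
          rw [← h2] at hj
          have := letter_injective (φ.injective hj : mk [(k, true)] = mk [(j, s)])
          exact absurd (congrArg Prod.fst this).symm hjk
        · exact absurd h hjk
        · exact h
      obtain ⟨e, he, h1, h2, h3⟩ := exists_signed_swap hjk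
      refine ⟨e, he, (isMonomial_signed_swap h1 h2 h3).mul hφ, fun i hi => ?_, s, ?_⟩
      · rw [MulAut.mul_apply, hk i hi, h3 i (hi.trans hlt).ne hi.ne]
      · rw [MulAut.mul_apply, hj]
        cases s
        · rw [mk_false, map_inv, h1]; rfl
        · exact h1
  cases s
  · have hex : ∃ l, k < l := by
      by_contra! hcon
      have h1 : e * φ ∈ APlus m := mul_mem (EAut_le_APlus he) hdet
      rw [mem_APlus_iff, abMat_det_of_fix k fun j hj => hfix j (lt_of_le_of_ne (hcon j) hj), hs,
        mk_false, ex_inv, ex_of_self] at h1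
      omega
    obtain ⟨l, hl⟩ := hex
    obtain ⟨g, hg, h1, h2, h3⟩ := exists_signed_swap hl.ne
    refine ⟨g * g * e, mul_mem (mul_mem hg hg) he, ?_, fun i hi => ?_⟩
    · rw [mul_assoc]
      have := isMonomial_signed_swap h1 h2 h3
      exact (this.mul this).mul hm
    · rw [mul_assoc, MulAut.mul_apply, MulAut.mul_apply]
      rcases hi.lt_or_eq with h | h
      · rw [hfix i h, h3 i h.ne (h.trans hl).ne, h3 i h.ne (h.trans hl).ne]
      · rw [h, hs, mk_false, map_inv, h1, map_inv, h2, inv_inv]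
  · refine ⟨e, he, hm, fun i hi => ?_⟩
    rcases hi.lt_or_eq with h | h
    · exact hfix i h
    · rw [h]; exact hs

/-- The automorphisms of determinant `1` are the products of transvections. -/
theorem APlus_eq_EAut : APlus m = EAut (Fin (m + 1)) := by
  refine le_antisymm (fun φ hφ => ?_) EAut_le_APlus
  obtain ⟨e, he, hm⟩ := exists_isMonomial_mul φ
  have key : ∀ k ≤ m + 1, ∃ g ∈ EAut (Fin (m + 1)), IsMonomial (g * φ) ∧
      ∀ i : Fin (m + 1), (i : ℕ) < k → (g * φ) (of i) = of i := by
    intro k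
    induction k with
    | zero => exact fun _ => ⟨e, he, hm, fun i hi => absurd hi (by omega)⟩
    | succ k ih =>
      intro hk
      obtain ⟨g, hg, h1, h2⟩ := ih (by omega)
      obtain ⟨g', hg', h3, h4⟩ := exists_fix_succ h1 (mul_mem (EAut_le_APlus hg) hφ) ⟨k, hk⟩
        (fun i hi => h2 i hi)
      refine ⟨g' * g, mul_mem hg' hg, by rwa [mul_assoc], fun i hi => ?_⟩
      rw [mul_assoc]
      exact h4 i (Fin.le_def.2 (by simp only; omega))
  obtain ⟨g, hg, -, h⟩ := key (m + 1) le_rfl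
  have h1 : g * φ = 1 := by
    refine MulEquiv.toMonoidHom_injective (FreeGroup.ext_hom _ _ fun i => ?_)
    exact h i i.2
  rw [eq_inv_of_mul_eq_one_right h1]
  exact inv_mem hg

end SpecialAutomorphisms

/-! ### The subgroup generated by the given automorphisms -/

section Evaluation

variable {m : ℕ}

theorem aut_ext {φ ψ : MulAut (Fr m)} (hX : φ (X m) = ψ (X m)) (hY : ∀ i, φ (Y i) = ψ (Y i)) :
    φ = ψ := by
  refine MulEquiv.toMonoidHom_injective (FreeGroup.ext_hom _ _ fun i => ?_)
  refine Fin.cases hX hY i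

theorem delta_X (i : Fin m) : delta i (X m) = Y i * X m := by
  rw [delta, X, nielsen_self, mul_one]

theorem delta_Y (i j : Fin m) : delta i (Y j) = Y j := nielsen_of_ne (Fin.succ_ne_zero j) _ _ _ _

theorem delta_inv_X (i : Fin m) : (delta i)⁻¹ (X m) = (Y i)⁻¹ * X m := by
  rw [delta, X, nielsen_inv_self, inv_one, mul_one]

theorem delta_inv_Y (i j : Fin m) : (delta i)⁻¹ (Y j) = Y j :=
  nielsen_inv_of_ne (Fin.succ_ne_zero j) _ _

theorem eps_X (i : Fin m) : eps i (X m) = X m * Y i := by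
  rw [eps, X, nielsen_self, one_mul]

theorem eps_Y (i j : Fin m) : eps i (Y j) = Y j := nielsen_of_ne (Fin.succ_ne_zero j) _ _ _ _

theorem eps_inv_X (i : Fin m) : (eps i)⁻¹ (X m) = X m * (Y i)⁻¹ := by
  rw [eps, X, nielsen_inv_self, inv_one, one_mul]

theorem eps_inv_Y (i j : Fin m) : (eps i)⁻¹ (Y j) = Y j :=
  nielsen_inv_of_ne (Fin.succ_ne_zero j) _ _

theorem phi_X (i : Fin m) : phi i (X m) = X m := nielsen_of_ne (Fin.succ_ne_zero i).symm _ _ _ _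

theorem phi_Y_self (i : Fin m) : phi i (Y i) = X m * Y i := by
  rw [phi, Y, nielsen_self, mul_one]

theorem Y_index_ne {i j : Fin m} (h : j ≠ i) : j.succ ≠ i.succ :=
  fun e => h (Fin.succ_injective _ e)

theorem phi_Y {i j : Fin m} (h : j ≠ i) : phi i (Y j) = Y j :=
  nielsen_of_ne (Y_index_ne h) _ _ _ _

theorem phi_inv_X (i : Fin m) : (phi i)⁻¹ (X m) = X m :=
  nielsen_inv_of_ne (Fin.succ_ne_zero i).symm _ _

theorem phi_inv_Y_self (i : Fin m) : (phi i)⁻¹ (Y i) = (X m)⁻¹ * Y i := by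
  rw [phi, Y, nielsen_inv_self, inv_one, mul_one]

theorem phi_inv_Y {i j : Fin m} (h : j ≠ i) : (phi i)⁻¹ (Y j) = Y j :=
  nielsen_inv_of_ne (Y_index_ne h) _ _

theorem psi_X (i : Fin m) : psi i (X m) = X m := nielsen_of_ne (Fin.succ_ne_zero i).symm _ _ _ _

theorem psi_Y_self (i : Fin m) : psi i (Y i) = Y i * X m := by
  rw [psi, Y, nielsen_self, one_mul]

theorem psi_Y {i j : Fin m} (h : j ≠ i) : psi i (Y j) = Y j :=
  nielsen_of_ne (Y_index_ne h) _ _ _ _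

theorem psi_inv_X (i : Fin m) : (psi i)⁻¹ (X m) = X m :=
  nielsen_inv_of_ne (Fin.succ_ne_zero i).symm _ _

theorem psi_inv_Y_self (i : Fin m) : (psi i)⁻¹ (Y i) = Y i * (X m)⁻¹ := by
  rw [psi, Y, nielsen_inv_self, inv_one, one_mul]

theorem psi_inv_Y {i j : Fin m} (h : j ≠ i) : (psi i)⁻¹ (Y j) = Y j :=
  nielsen_inv_of_ne (Y_index_ne h) _ _

theorem lam_X {i j : Fin m} (h : i ≠ j) : lam i j h (X m) = X m :=
  nielsen_of_ne (Fin.succ_ne_zero i).symm _ _ _ _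

theorem lam_Y_self {i j : Fin m} (h : i ≠ j) : lam i j h (Y i) = Y j * Y i :=
  (nielsen_self _ _ _ _ _).trans (mul_one _)

theorem lam_Y {i j k : Fin m} (h : i ≠ j) (hk : k ≠ i) : lam i j h (Y k) = Y k :=
  nielsen_of_ne (Y_index_ne hk) _ _ _ _

theorem lam_inv_X {i j : Fin m} (h : i ≠ j) : (lam i j h)⁻¹ (X m) = X m :=
  nielsen_inv_of_ne (Fin.succ_ne_zero i).symm _ _

theorem lam_inv_Y_self {i j : Fin m} (h : i ≠ j) : (lam i j h)⁻¹ (Y i) = (Y j)⁻¹ * Y i :=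
  (nielsen_inv_self _ _).trans (by rw [inv_one, mul_one]; rfl)

theorem lam_inv_Y {i j k : Fin m} (h : i ≠ j) (hk : k ≠ i) : (lam i j h)⁻¹ (Y k) = Y k :=
  nielsen_inv_of_ne (Y_index_ne hk) _ _

theorem nu_X {i j : Fin m} (h : i ≠ j) : nu i j h (X m) = X m :=
  nielsen_of_ne (Fin.succ_ne_zero i).symm _ _ _ _

theorem nu_Y_self {i j : Fin m} (h : i ≠ j) : nu i j h (Y i) = Y i * Y j :=
  (nielsen_self _ _ _ _ _).trans (by rw [one_mul]; rfl)

theorem nu_Y {i j k : Fin m} (h : i ≠ j) (hk : k ≠ i) : nu i j h (Y k) = Y k :=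
  nielsen_of_ne (Y_index_ne hk) _ _ _ _

theorem nu_inv_X {i j : Fin m} (h : i ≠ j) : (nu i j h)⁻¹ (X m) = X m :=
  nielsen_inv_of_ne (Fin.succ_ne_zero i).symm _ _

theorem nu_inv_Y_self {i j : Fin m} (h : i ≠ j) : (nu i j h)⁻¹ (Y i) = Y i * (Y j)⁻¹ :=
  (nielsen_inv_self _ _).trans (by rw [inv_one, one_mul]; rfl)

theorem nu_inv_Y {i j k : Fin m} (h : i ≠ j) (hk : k ≠ i) : (nu i j h)⁻¹ (Y k) = Y k :=
  nielsen_inv_of_ne (Y_index_ne hk) _ _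

end Evaluation

section GeneratedSubgroup

variable {m : ℕ}

/-- The subgroup generated by `gens m`. -/
def KAut (m : ℕ) : Subgroup (MulAut (Fr m)) := Subgroup.closure (gens m)

theorem delta_mem_KAut (i : Fin m) : delta i ∈ KAut m :=
  Subgroup.subset_closure (by simp [gens])

theorem eps_mem_KAut (i : Fin m) : eps i ∈ KAut m :=
  Subgroup.subset_closure (by simp [gens])

theorem lam_mem_KAut {i j : Fin m} (h : i ≠ j) : lam i j h ∈ KAut m :=
  Subgroup.subset_closure (Or.inl (Or.inl (Or.inl (Or.inr ⟨i, j, h, rfl⟩))))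

theorem nu_mem_KAut {i j : Fin m} (h : i ≠ j) : nu i j h ∈ KAut m :=
  Subgroup.subset_closure (Or.inl (Or.inl (Or.inr ⟨i, j, h, rfl⟩)))

theorem phi_sq_mem_KAut (i : Fin m) : phi i ^ 2 ∈ KAut m :=
  Subgroup.subset_closure (Or.inl (Or.inr ⟨i, rfl⟩))

/-- The partial conjugation `y_i ↦ x⁻¹ y_i x`. -/
def pconj (i : Fin m) : MulAut (Fr m) := (phi i)⁻¹ * psi i

theorem pconj_mem_KAut (i : Fin m) : pconj i ∈ KAut m :=
  Subgroup.subset_closure (Or.inr (Or.inl (Or.inr ⟨i, rfl⟩)))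

theorem pconj_X (i : Fin m) : pconj i (X m) = X m := by
  rw [pconj, MulAut.mul_apply, psi_X, phi_inv_X]

theorem pconj_Y_self (i : Fin m) : pconj i (Y i) = (X m)⁻¹ * Y i * X m := by
  rw [pconj, MulAut.mul_apply, psi_Y_self, map_mul, phi_inv_X, phi_inv_Y_self]

theorem pconj_Y {i j : Fin m} (h : j ≠ i) : pconj i (Y j) = Y j := by
  rw [pconj, MulAut.mul_apply, psi_Y h, phi_inv_Y h]

theorem pconj_inv_X (i : Fin m) : (pconj i)⁻¹ (X m) = X m := by
  rw [MulAut.inv_apply, MulEquiv.symm_apply_eq, pconj_X]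

theorem pconj_inv_Y_self (i : Fin m) : (pconj i)⁻¹ (Y i) = X m * Y i * (X m)⁻¹ := by
  rw [MulAut.inv_apply, MulEquiv.symm_apply_eq, map_mul, map_mul, map_inv, pconj_X, pconj_Y_self]
  group

theorem pconj_inv_Y {i j : Fin m} (h : j ≠ i) : (pconj i)⁻¹ (Y j) = Y j := by
  rw [MulAut.inv_apply, MulEquiv.symm_apply_eq, pconj_Y h]

theorem psi_eq (i : Fin m) : psi i = phi i * pconj i := by rw [pconj, mul_inv_cancel_left]

theorem psi_eq' (i : Fin m) : psi i = pconj i * phi i := by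
  refine aut_ext ?_ fun j => ?_
  · simp only [MulAut.mul_apply, psi_X, phi_X, pconj_X]
  · by_cases hj : j = i
    · subst hj
      simp only [MulAut.mul_apply, psi_Y_self, phi_Y_self, pconj_X, pconj_Y_self, map_mul]
      group
    · simp only [MulAut.mul_apply, psi_Y hj, phi_Y hj, pconj_Y hj]

/-- ψ_i is the commuting product of φ_i and the partial conjugation, so its square needs φ_i only
through φ_i². -/
theorem psi_sq_mem_KAut (i : Fin m) : psi i ^ 2 ∈ KAut m := by
  have h : psi i ^ 2 = pconj i * phi i ^ 2 * pconj i := by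
    rw [pow_two, pow_two]
    nth_rewrite 1 [psi_eq']
    rw [psi_eq, mul_assoc, mul_assoc, mul_assoc]
  rw [h]
  exact mul_mem (mul_mem (pconj_mem_KAut i) (phi_sq_mem_KAut i)) (pconj_mem_KAut i)

theorem pi2_eq_one_iff {f : Fr m} : pi2 m f = 1 ↔ f ∈ H m := by rw [H_eq, MonoidHom.mem_ker]

/-- `repl k.succ 1` deletes y_k, the only generator that g may move. -/
theorem apply_repl_succ_eq {k : Fin m} {g : MulAut (Fr m)} (hX : g (X m) = X m)
    (hY : ∀ l, l ≠ k → g (Y l) = Y l) (a : Fr m) : g (repl k.succ 1 a) = repl k.succ 1 a := by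
  have : (g.toMonoidHom).comp (repl k.succ 1) = repl k.succ 1 := by
    ext i
    refine Fin.cases ?_ (fun l => ?_) i
    · change g (repl k.succ 1 (X m)) = repl k.succ 1 (X m)
      rw [repl_succ_X, hX]
    · change g (repl k.succ 1 (Y l)) = repl k.succ 1 (Y l)
      by_cases h : l = k
      · subst h
        rw [Y, repl_self, map_one]
      · rw [repl_succ_Y (Ne.symm h), hY l h]
  exact DFunLike.congr_fun this a

/-- Induction over the generators x², y_i, x y_i x⁻¹ of the kernel, which φ_k², λ_ki and a conjugate
of λ_ki by the partial conjugation realise as left factors. Deleting y_k makes the generators with i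
= k trivial and keeps the factor fixed by the automorphisms in play, so factors multiply under
composition. -/
theorem exists_left_mul_mem_KAut (k : Fin m) {a : Fr m} (ha : pi2 m a = 1) :
    ∃ g ∈ KAut m, g (X m) = X m ∧ (∀ l, l ≠ k → g (Y l) = Y l) ∧
      g (Y k) = repl k.succ 1 a * Y k := by
  refine H_induction (p := fun a => ∃ g ∈ KAut m, g (X m) = X m ∧ (∀ l, l ≠ k → g (Y l) = Y l) ∧
      g (Y k) = repl k.succ 1 a * Y k) ?_ ?_ ?_ ?_ ?_ ?_ (pi2_eq_one_iff.1 ha)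
  · exact ⟨1, one_mem _, rfl, fun _ _ => rfl, by simp⟩
  · rintro a b ⟨g, hg, g1, g2, g3⟩ ⟨h, hh, h1, h2, h3⟩
    refine ⟨h * g, mul_mem hh hg, by rw [MulAut.mul_apply, g1, h1],
      fun l hl => by rw [MulAut.mul_apply, g2 l hl, h2 l hl], ?_⟩
    rw [MulAut.mul_apply, g3, map_mul, apply_repl_succ_eq h1 h2, h3, map_mul, mul_assoc]
  · rintro a ⟨g, hg, g1, g2, g3⟩
    refine ⟨g⁻¹, inv_mem hg, ?_, fun l hl => ?_, ?_⟩ <;>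
      rw [MulAut.inv_apply, MulEquiv.symm_apply_eq]
    · exact g1.symm
    · exact (g2 l hl).symm
    · rw [map_mul, apply_repl_succ_eq g1 g2, g3, map_inv, inv_mul_cancel_left]
  · refine ⟨_, phi_sq_mem_KAut k, ?_, fun l hl => ?_, ?_⟩
    · simp only [pow_two, MulAut.mul_apply, phi_X]
    · simp only [pow_two, MulAut.mul_apply, phi_Y hl]
    · simp only [pow_two, MulAut.mul_apply, phi_Y_self, phi_X, map_mul, repl_succ_X, mul_assoc]
  · intro i
    by_cases h : i = k
    · subst h
      exact ⟨1, one_mem _, rfl, fun _ _ => rfl, by rw [Y, repl_self]; simp⟩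
    · exact ⟨_, lam_mem_KAut (Ne.symm h), lam_X _, fun l hl => lam_Y _ hl, by
        rw [lam_Y_self, repl_succ_Y (Ne.symm h)]⟩
  · intro i
    by_cases h : i = k
    · subst h
      exact ⟨1, one_mem _, rfl, fun _ _ => rfl, by
        rw [map_mul, map_mul, Y, repl_self, map_inv]; simp⟩
    · refine ⟨pconj k * lam k i (Ne.symm h) * (pconj k)⁻¹,
        mul_mem (mul_mem (pconj_mem_KAut k) (lam_mem_KAut _)) (inv_mem (pconj_mem_KAut k)),
        ?_, fun l hl => ?_, ?_⟩
      · simp only [MulAut.mul_apply, pconj_inv_X, lam_X, pconj_X]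
      · simp only [MulAut.mul_apply, pconj_inv_Y hl, lam_Y _ hl, pconj_Y hl]
      · simp only [MulAut.mul_apply, pconj_inv_Y_self, map_mul, map_inv, lam_X, lam_Y_self,
          pconj_X, pconj_Y_self, pconj_Y h, repl_succ_X, repl_succ_Y (Ne.symm h)]
        group

theorem exists_right_mul_mem_KAut (k : Fin m) {a : Fr m} (ha : pi2 m a = 1) :
    ∃ g ∈ KAut m, g (X m) = X m ∧ (∀ l, l ≠ k → g (Y l) = Y l) ∧
      g (Y k) = Y k * repl k.succ 1 a := by
  refine H_induction (p := fun a => ∃ g ∈ KAut m, g (X m) = X m ∧ (∀ l, l ≠ k → g (Y l) = Y l) ∧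
      g (Y k) = Y k * repl k.succ 1 a) ?_ ?_ ?_ ?_ ?_ ?_ (pi2_eq_one_iff.1 ha)
  · exact ⟨1, one_mem _, rfl, fun _ _ => rfl, by simp⟩
  · rintro a b ⟨g, hg, g1, g2, g3⟩ ⟨h, hh, h1, h2, h3⟩
    refine ⟨g * h, mul_mem hg hh, by rw [MulAut.mul_apply, h1, g1],
      fun l hl => by rw [MulAut.mul_apply, h2 l hl, g2 l hl], ?_⟩
    rw [MulAut.mul_apply, h3, map_mul, apply_repl_succ_eq g1 g2, g3, map_mul, mul_assoc]
  · rintro a ⟨g, hg, g1, g2, g3⟩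
    refine ⟨g⁻¹, inv_mem hg, ?_, fun l hl => ?_, ?_⟩ <;>
      rw [MulAut.inv_apply, MulEquiv.symm_apply_eq]
    · exact g1.symm
    · exact (g2 l hl).symm
    · rw [map_mul, apply_repl_succ_eq g1 g2, g3, map_inv, mul_inv_cancel_right]
  · refine ⟨_, psi_sq_mem_KAut k, ?_, fun l hl => ?_, ?_⟩
    · simp only [pow_two, MulAut.mul_apply, psi_X]
    · simp only [pow_two, MulAut.mul_apply, psi_Y hl]
    · simp only [pow_two, MulAut.mul_apply, psi_Y_self, psi_X, map_mul, repl_succ_X, mul_assoc]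
  · intro i
    by_cases h : i = k
    · subst h
      exact ⟨1, one_mem _, rfl, fun _ _ => rfl, by rw [Y, repl_self]; simp⟩
    · exact ⟨_, nu_mem_KAut (Ne.symm h), nu_X _, fun l hl => nu_Y _ hl, by
        rw [nu_Y_self, repl_succ_Y (Ne.symm h)]⟩
  · intro i
    by_cases h : i = k
    · subst h
      exact ⟨1, one_mem _, rfl, fun _ _ => rfl, by
        rw [map_mul, map_mul, Y, repl_self, map_inv]; simp⟩
    · refine ⟨pconj k * nu k i (Ne.symm h) * (pconj k)⁻¹,
        mul_mem (mul_mem (pconj_mem_KAut k) (nu_mem_KAut _)) (inv_mem (pconj_mem_KAut k)),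
        ?_, fun l hl => ?_, ?_⟩
      · simp only [MulAut.mul_apply, pconj_inv_X, nu_X, pconj_X]
      · simp only [MulAut.mul_apply, pconj_inv_Y hl, nu_Y _ hl, pconj_Y hl]
      · simp only [MulAut.mul_apply, pconj_inv_Y_self, map_mul, map_inv, nu_X, nu_Y_self,
          pconj_X, pconj_Y_self, pconj_Y h, repl_succ_X, repl_succ_Y (Ne.symm h)]
        group

/-- An automorphism that only changes `y_k`, by factors in the kernel of `π` that do not involve
`y_k` and possibly a conjugation by `x`, lies in the subgroup generated by `gens m`. -/
theorem mem_KAut_of_elementary {φ : MulAut (Fr m)} (k : Fin m) (hX : φ (X m) = X m)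
    (hY : ∀ l, l ≠ k → φ (Y l) = Y l) {a b : Fr m} (ha : pi2 m a = 1) (hb : pi2 m b = 1)
    (ha' : repl k.succ 1 a = a) (hb' : repl k.succ 1 b = b)
    (h : φ (Y k) = a * Y k * b ∨ φ (Y k) = a * ((X m)⁻¹ * Y k * X m) * b) : φ ∈ KAut m := by
  obtain ⟨f, hf, f1, f2, f3⟩ := exists_left_mul_mem_KAut k ha
  obtain ⟨g, hg, g1, g2, g3⟩ := exists_right_mul_mem_KAut k hb
  have fb := apply_repl_succ_eq f1 f2 b
  have ca := apply_repl_succ_eq (pconj_X k) (fun l hl => pconj_Y hl) a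
  have cb := apply_repl_succ_eq (pconj_X k) (fun l hl => pconj_Y hl) b
  rw [ha'] at f3 ca
  rw [hb'] at g3 cb fb
  rcases h with h | h
  · have : φ = f * g := by
      refine aut_ext ?_ fun l => ?_
      · rw [MulAut.mul_apply, g1, f1, hX]
      · by_cases hl : l = k
        · rw [hl, MulAut.mul_apply, g3, map_mul, f3, fb, h]
        · rw [MulAut.mul_apply, g2 l hl, f2 l hl, hY l hl]
    rw [this]
    exact mul_mem hf hg
  · have : φ = pconj k * f * g := by
      refine aut_ext ?_ fun l => ?_
      · rw [MulAut.mul_apply, MulAut.mul_apply, g1, f1, pconj_X, hX]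
      · by_cases hl : l = k
        · rw [hl, MulAut.mul_apply, MulAut.mul_apply, g3, map_mul, f3, fb, map_mul, map_mul, ca,
            cb, pconj_Y_self, h]
        · rw [MulAut.mul_apply, MulAut.mul_apply, g2 l hl, f2 l hl, pconj_Y hl, hY l hl]
    rw [this]
    exact mul_mem (mul_mem (pconj_mem_KAut k) hf) hg

end GeneratedSubgroup

/-! ### Shears as coset representatives, and the automorphisms fixing every y_i -/

section Cosets

variable {m : ℕ}

/-- `x` or `1` according to whether `i ∈ S`. -/
def xInd (S : Finset (Fin m)) (i : Fin m) : Fr m := if i ∈ S then X m else 1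

theorem xInd_of_mem {S : Finset (Fin m)} {i : Fin m} (h : i ∈ S) : xInd S i = X m := if_pos h

theorem xInd_of_notMem {S : Finset (Fin m)} {i : Fin m} (h : i ∉ S) : xInd S i = 1 := if_neg h

theorem lift_cons_X (w : Fr m) (f : Fin m → Fr m) :
    FreeGroup.lift (Fin.cons w f : Fin (m + 1) → Fr m) (X m) = w := by simp [X]

theorem lift_cons_Y (w : Fr m) (f : Fin m → Fr m) (i : Fin m) :
    FreeGroup.lift (Fin.cons w f : Fin (m + 1) → Fr m) (Y i) = f i := by simp [Y]

theorem lift_cons_xInd (S : Finset (Fin m)) (f : Fin m → Fr m) (i : Fin m) :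
    FreeGroup.lift (Fin.cons (X m) f : Fin (m + 1) → Fr m) (xInd S i) = xInd S i := by
  by_cases h : i ∈ S
  · rw [xInd_of_mem h, lift_cons_X]
  · rw [xInd_of_notMem h, map_one]

/-- The automorphism `y_i ↦ x y_i` for `i ∈ S`. -/
def shear (S : Finset (Fin m)) : MulAut (Fr m) :=
  MonoidHom.toMulEquiv
    (FreeGroup.lift (Fin.cons (X m) fun i => xInd S i * Y i : Fin (m + 1) → Fr m))
    (FreeGroup.lift (Fin.cons (X m) fun i => (xInd S i)⁻¹ * Y i : Fin (m + 1) → Fr m))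
    (FreeGroup.ext_hom _ _ fun i => by
      refine Fin.cases ?_ (fun i => ?_) i
      · simp only [MonoidHom.comp_apply, FreeGroup.lift_apply_of, Fin.cons_zero,
          MonoidHom.id_apply]
        exact lift_cons_X _ _
      · change FreeGroup.lift _ (FreeGroup.lift _ (Y i)) = Y i
        rw [lift_cons_Y, map_mul, lift_cons_Y, lift_cons_xInd, mul_inv_cancel_left])
    (FreeGroup.ext_hom _ _ fun i => by
      refine Fin.cases ?_ (fun i => ?_) i
      · simp only [MonoidHom.comp_apply, FreeGroup.lift_apply_of, Fin.cons_zero,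
          MonoidHom.id_apply]
        exact lift_cons_X _ _
      · change FreeGroup.lift _ (FreeGroup.lift _ (Y i)) = Y i
        rw [lift_cons_Y, map_mul, map_inv, lift_cons_Y, lift_cons_xInd, inv_mul_cancel_left])

theorem shear_X (S : Finset (Fin m)) : shear S (X m) = X m :=
  lift_cons_X (X m) fun i => xInd S i * Y i

theorem shear_Y (S : Finset (Fin m)) (i : Fin m) : shear S (Y i) = xInd S i * Y i :=
  lift_cons_Y _ _ i

theorem shear_inv_X (S : Finset (Fin m)) : (shear S)⁻¹ (X m) = X m :=
  lift_cons_X (X m) fun i => (xInd S i)⁻¹ * Y i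

theorem shear_inv_Y (S : Finset (Fin m)) (i : Fin m) :
    (shear S)⁻¹ (Y i) = (xInd S i)⁻¹ * Y i := lift_cons_Y _ _ i

theorem apply_xInd {s : Fr m →* Fr m} (hX : s (X m) = X m) (S : Finset (Fin m)) (i : Fin m) :
    s (xInd S i) = xInd S i := by
  by_cases h : i ∈ S
  · rw [xInd_of_mem h, hX]
  · rw [xInd_of_notMem h, map_one]

theorem shear_empty : shear (∅ : Finset (Fin m)) = 1 := by
  refine aut_ext (shear_X _) fun i => ?_
  rw [shear_Y, xInd_of_notMem (by simp), one_mul]; rfl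

theorem shear_singleton (j : Fin m) : shear {j} = phi j := by
  refine aut_ext ((shear_X _).trans (phi_X j).symm) fun i => ?_
  by_cases h : i = j
  · subst h
    rw [shear_Y, xInd_of_mem (by simp), phi_Y_self]
  · rw [shear_Y, xInd_of_notMem (by simpa using h), phi_Y h, one_mul]

theorem pi2_shear_Y (S : Finset (Fin m)) (i : Fin m) :
    pi2 m (shear S (Y i)) = pi2 m (xInd S i) := by rw [shear_Y, map_mul, pi2_Y, mul_one]

variable {S S' : Finset (Fin m)} {i : Fin m} {s : MulAut (Fr m)} {u : Fr m}

theorem shear_mul_inv_Y_of_ne (hX : s (X m) = X m) (hS : ∀ l, l ≠ i → (l ∈ S ↔ l ∈ S'))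
    {l : Fin m} (hl : l ≠ i) (hs : s (Y l) = Y l) :
    (shear S * s * (shear S')⁻¹) (Y l) = Y l := by
  have h1 : xInd S' l = xInd S l := by simp only [xInd, hS l hl]
  have h2 := apply_xInd (s := s.toMonoidHom) hX S l
  have h3 := apply_xInd (s := (shear S).toMonoidHom) (shear_X S) S l
  simp only [MulEquiv.toMonoidHom_eq_coe, MonoidHom.coe_coe] at h2 h3
  rw [MulAut.mul_apply, MulAut.mul_apply, shear_inv_Y, h1, map_mul, map_mul, hs, map_inv, map_inv,
    h2, h3, shear_Y, inv_mul_cancel_left]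

theorem shear_mul_inv_X (hX : s (X m) = X m) : (shear S * s * (shear S')⁻¹) (X m) = X m := by
  rw [MulAut.mul_apply, MulAut.mul_apply, shear_inv_X, hX, shear_X]

theorem shear_mul_inv_Y (hX : s (X m) = X m) (i : Fin m) :
    (shear S * s * (shear S')⁻¹) (Y i) = (xInd S' i)⁻¹ * shear S (s (Y i)) := by
  have h2 := apply_xInd (s := s.toMonoidHom) hX S' i
  have h3 := apply_xInd (s := (shear S).toMonoidHom) (shear_X S) S' i
  simp only [MulEquiv.toMonoidHom_eq_coe, MonoidHom.coe_coe] at h2 h3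
  rw [MulAut.mul_apply, MulAut.mul_apply, shear_inv_Y, map_mul, map_mul, map_inv, map_inv, h2, h3]

/-- Left multiplications of `y_i` permute the cosets of the automorphisms `shear S`. -/
theorem shear_mul_mem_of_left (hX : s (X m) = X m) (hY : ∀ l, l ≠ i → s (Y l) = Y l)
    (hs : s (Y i) = u * Y i) (hu : repl i.succ 1 (shear S u) = shear S u)
    (hS : ∀ l, l ≠ i → (l ∈ S ↔ l ∈ S'))
    (hp : pi2 m (shear S u) * pi2 m (xInd S i) = pi2 m (xInd S' i)) :
    shear S * s * (shear S')⁻¹ ∈ KAut m := by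
  refine mem_KAut_of_elementary (a := (xInd S' i)⁻¹ * shear S u * xInd S i) (b := 1) i
    (shear_mul_inv_X hX) (fun l hl => shear_mul_inv_Y_of_ne hX hS hl (hY l hl)) ?_ (map_one _) ?_
    (map_one _) (Or.inl ?_)
  · rw [map_mul, map_mul, map_inv, mul_assoc, hp, inv_mul_cancel]
  · have h := repl_succ_X (1 : Fr m) i
    rw [map_mul, map_mul, map_inv, hu, apply_xInd h, apply_xInd h]
  · rw [shear_mul_inv_Y hX, hs, map_mul, shear_Y, mul_one]
    simp only [mul_assoc]

/-- Right multiplications of `y_i` permute the cosets of the automorphisms `shear S`. -/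
theorem shear_mul_mem_of_right (hX : s (X m) = X m) (hY : ∀ l, l ≠ i → s (Y l) = Y l)
    (hs : s (Y i) = Y i * u) (hu : repl i.succ 1 (shear S u) = shear S u)
    (hS : ∀ l, l ≠ i → (l ∈ S ↔ l ∈ S'))
    (hp : pi2 m (shear S u) * pi2 m (xInd S i) = pi2 m (xInd S' i)) :
    shear S * s * (shear S')⁻¹ ∈ KAut m := by
  have hr := repl_succ_X (1 : Fr m) i
  have hval : (shear S * s * (shear S')⁻¹) (Y i) =
      (xInd S' i)⁻¹ * xInd S i * Y i * shear S u := by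
    rw [shear_mul_inv_Y hX, hs, map_mul, shear_Y]
    simp only [mul_assoc]
  have hc : ∀ c : C2, c = 1 ∨ c = gC2 := by decide
  rcases hc (pi2 m (shear S u)) with h | h
  · refine mem_KAut_of_elementary (a := (xInd S' i)⁻¹ * xInd S i) (b := shear S u) i
      (shear_mul_inv_X hX) (fun l hl => shear_mul_inv_Y_of_ne hX hS hl (hY l hl)) ?_ h ?_ hu
      (Or.inl hval)
    · rw [map_mul, map_inv, ← hp, h, one_mul, inv_mul_cancel]
    · rw [map_mul, map_inv, apply_xInd hr, apply_xInd hr]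
  -- Now the right factor v has π(v) = g. Writing y v as x (x⁻¹ y x)(x⁻¹ v) moves one x to each side
  -- and puts both outer factors in the kernel, at the cost of a partial conjugation.
  · refine mem_KAut_of_elementary (a := (xInd S' i)⁻¹ * xInd S i * X m)
      (b := (X m)⁻¹ * shear S u) i
      (shear_mul_inv_X hX) (fun l hl => shear_mul_inv_Y_of_ne hX hS hl (hY l hl)) ?_ ?_ ?_ ?_
      (Or.inr ?_)
    · rw [map_mul, map_mul, map_inv, ← hp, h, pi2_X, mul_inv, inv_mul_cancel_right,
        inv_mul_cancel]
    · rw [map_mul, map_inv, h, pi2_X, inv_mul_cancel]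
    · rw [map_mul, map_mul, map_inv, apply_xInd hr, apply_xInd hr, hr]
    · rw [map_mul, map_inv, hr, hu]
    · rw [hval]; group

/-- The new set differs from S at most at i, whose membership is toggled precisely when c is the
nontrivial element. -/
theorem exists_index_set (S : Finset (Fin m)) (i : Fin m) (c : C2) :
    ∃ S' : Finset (Fin m), (∀ l, l ≠ i → (l ∈ S ↔ l ∈ S')) ∧
      c * pi2 m (xInd S i) = pi2 m (xInd S' i) := by
  have hc : ∀ c : C2, c = 1 ∨ c = gC2 := by decide
  have hg : gC2 * gC2 = 1 := by decide
  rcases hc c with rfl | rfl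
  · exact ⟨S, fun _ _ => Iff.rfl, one_mul _⟩
  · by_cases h : i ∈ S
    · refine ⟨S.erase i, fun l hl => by simp [hl], ?_⟩
      rw [xInd_of_mem h, xInd_of_notMem (Finset.notMem_erase i S), pi2_X, hg, map_one]
    · refine ⟨insert i S, fun l hl => by simp [hl], ?_⟩
      rw [xInd_of_notMem h, xInd_of_mem (Finset.mem_insert_self i S), pi2_X, map_one, mul_one]

/-- The subgroup of the automorphisms `x ↦ a x b` with `a` and `b` words in the `y_i`. -/
def DAut (m : ℕ) : Subgroup (MulAut (Fr m)) :=
  Subgroup.closure (Set.range delta ∪ Set.range eps)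

theorem delta_mem_DAut (i : Fin m) : delta i ∈ DAut m := Subgroup.subset_closure (Or.inl ⟨i, rfl⟩)

theorem eps_mem_DAut (i : Fin m) : eps i ∈ DAut m := Subgroup.subset_closure (Or.inr ⟨i, rfl⟩)

theorem DAut_le_KAut : DAut m ≤ KAut m := by
  refine (Subgroup.closure_le _).2 ?_
  rintro _ (⟨i, rfl⟩ | ⟨i, rfl⟩)
  · exact delta_mem_KAut i
  · exact eps_mem_KAut i

theorem DAut_apply_Y {d : MulAut (Fr m)} (hd : d ∈ DAut m) (i : Fin m) : d (Y i) = Y i := by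
  induction hd using Subgroup.closure_induction with
  | mem y hy =>
    rcases hy with ⟨j, rfl⟩ | ⟨j, rfl⟩
    · exact delta_Y j i
    · exact eps_Y j i
  | one => rfl
  | mul a b _ _ ha hb => rw [MulAut.mul_apply, hb, ha]
  | inv a _ ha => rw [MulAut.inv_apply, MulEquiv.symm_apply_eq, ha]

theorem apply_repl_zero_eq {g : MulAut (Fr m)} (hY : ∀ l, g (Y l) = Y l) (a : Fr m) :
    g (repl 0 1 a) = repl 0 1 a := by
  have : (g.toMonoidHom).comp (repl 0 1) = repl 0 1 := by
    ext i
    refine Fin.cases ?_ (fun l => ?_) i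
    · change g (repl 0 1 (FreeGroup.of 0)) = repl 0 1 (FreeGroup.of 0)
      rw [repl_self, map_one]
    · change g (repl 0 1 (Y l)) = repl 0 1 (Y l)
      rw [repl_zero_Y, hY]
  exact DFunLike.congr_fun this a

theorem exists_mem_DAut_left (a : Fr m) : ∃ d ∈ DAut m, d (X m) = repl 0 1 a * X m := by
  induction a using FreeGroup.induction_on with
  | C1 => exact ⟨1, one_mem _, by simp⟩
  | of j =>
    refine Fin.cases ⟨1, one_mem _, ?_⟩ (fun i => ⟨_, delta_mem_DAut i, ?_⟩) j
    · rw [repl_self]; simp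
    · exact (delta_X i).trans (congrArg (· * X m) (repl_zero_Y 1 i).symm)
  | inv_of j _ =>
    refine Fin.cases ⟨1, one_mem _, ?_⟩ (fun i => ⟨_, inv_mem (delta_mem_DAut i), ?_⟩) j
    · rw [map_inv, repl_self]; simp
    · rw [map_inv]
      exact (delta_inv_X i).trans (congrArg (fun z => z⁻¹ * X m) (repl_zero_Y 1 i).symm)
  | mul a b ha hb =>
    obtain ⟨d, hd, h1⟩ := ha
    obtain ⟨e, he, h2⟩ := hb
    refine ⟨e * d, mul_mem he hd, ?_⟩
    rw [MulAut.mul_apply, h1, map_mul, apply_repl_zero_eq (DAut_apply_Y he), h2, map_mul, mul_assoc]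

theorem exists_mem_DAut_right (a : Fr m) : ∃ d ∈ DAut m, d (X m) = X m * repl 0 1 a := by
  induction a using FreeGroup.induction_on with
  | C1 => exact ⟨1, one_mem _, by simp⟩
  | of j =>
    refine Fin.cases ⟨1, one_mem _, ?_⟩ (fun i => ⟨_, eps_mem_DAut i, ?_⟩) j
    · rw [repl_self]; simp
    · exact (eps_X i).trans (congrArg (X m * ·) (repl_zero_Y 1 i).symm)
  | inv_of j _ =>
    refine Fin.cases ⟨1, one_mem _, ?_⟩ (fun i => ⟨_, inv_mem (eps_mem_DAut i), ?_⟩) j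
    · rw [map_inv, repl_self]; simp
    · rw [map_inv]
      exact (eps_inv_X i).trans (congrArg (fun z => X m * z⁻¹) (repl_zero_Y 1 i).symm)
  | mul a b ha hb =>
    obtain ⟨d, hd, h1⟩ := ha
    obtain ⟨e, he, h2⟩ := hb
    refine ⟨d * e, mul_mem hd he, ?_⟩
    rw [MulAut.mul_apply, h2, map_mul, apply_repl_zero_eq (DAut_apply_Y hd), h1, map_mul, mul_assoc]

theorem mem_DAut {d : MulAut (Fr m)} (hY : ∀ i, d (Y i) = Y i) {a b : Fr m}
    (ha : repl 0 1 a = a) (hb : repl 0 1 b = b) (hX : d (X m) = a * X m * b) : d ∈ DAut m := by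
  obtain ⟨f, hf, h1⟩ := exists_mem_DAut_left a
  obtain ⟨g, hg, h2⟩ := exists_mem_DAut_right b
  have h3 := apply_repl_zero_eq (DAut_apply_Y hf) b
  rw [ha] at h1
  rw [hb] at h2 h3
  have : d = f * g := by
    refine aut_ext ?_ fun i => ?_
    · rw [MulAut.mul_apply, h2, map_mul, h1, h3, hX]
    · rw [MulAut.mul_apply, DAut_apply_Y hg, DAut_apply_Y hf, hY]
  rw [this]
  exact mul_mem hf hg

/-- Automorphisms of the free group on the `y_i` normalize `DAut m`. -/
theorem conj_mem_DAut {s : MulAut (Fr m)} (hX : s (X m) = X m)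
    (hY : ∀ i, repl 0 1 (s (Y i)) = s (Y i)) (hX' : s⁻¹ (X m) = X m)
    (hY' : ∀ i, repl 0 1 (s⁻¹ (Y i)) = s⁻¹ (Y i)) {d : MulAut (Fr m)} (hd : d ∈ DAut m) :
    s * d * s⁻¹ ∈ DAut m := by
  have hcl : DAut m ≤ (DAut m).comap (MulAut.conj s).toMonoidHom := by
    refine (Subgroup.closure_le _).2 ?_
    have hfix : ∀ d : MulAut (Fr m), d ∈ DAut m → ∀ i, (s * d * s⁻¹) (Y i) = Y i := by
      intro d hd i
      have h1 := apply_repl_zero_eq (DAut_apply_Y hd) (s⁻¹ (Y i))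
      rw [hY'] at h1
      rw [MulAut.mul_apply, MulAut.mul_apply, h1, ← MulAut.mul_apply, mul_inv_cancel]
      rfl
    rintro _ (⟨i, rfl⟩ | ⟨i, rfl⟩)
    · refine mem_DAut (hfix _ (delta_mem_DAut i)) (hY i) (map_one _) ?_
      change (s * delta i * s⁻¹) (X m) = _
      rw [MulAut.mul_apply, MulAut.mul_apply, hX', delta_X, map_mul, hX, mul_one]
    · refine mem_DAut (hfix _ (eps_mem_DAut i)) (map_one _) (hY i) ?_
      change (s * eps i * s⁻¹) (X m) = _
      rw [MulAut.mul_apply, MulAut.mul_apply, hX', eps_X, map_mul, hX, one_mul]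
  exact hcl hd

theorem conj_lam_mem_DAut {i j : Fin m} (h : i ≠ j) {d : MulAut (Fr m)} (hd : d ∈ DAut m) :
    lam i j h * d * (lam i j h)⁻¹ ∈ DAut m := by
  refine conj_mem_DAut (lam_X h) (fun k => ?_) (lam_inv_X h) (fun k => ?_) hd
  · by_cases hk : k = i
    · rw [hk, lam_Y_self, map_mul, repl_zero_Y, repl_zero_Y]
    · rw [lam_Y h hk, repl_zero_Y]
  · by_cases hk : k = i
    · rw [hk, lam_inv_Y_self, map_mul, map_inv, repl_zero_Y, repl_zero_Y]
    · rw [lam_inv_Y h hk, repl_zero_Y]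

theorem conj_lam_inv_mem_DAut {i j : Fin m} (h : i ≠ j) {d : MulAut (Fr m)} (hd : d ∈ DAut m) :
    (lam i j h)⁻¹ * d * lam i j h ∈ DAut m := by
  refine conj_mem_DAut (s := (lam i j h)⁻¹) (lam_inv_X h) (fun k => ?_) (lam_X h) (fun k => ?_) hd
  · by_cases hk : k = i
    · rw [hk, lam_inv_Y_self, map_mul, map_inv, repl_zero_Y, repl_zero_Y]
    · rw [lam_inv_Y h hk, repl_zero_Y]
  · rw [inv_inv]
    by_cases hk : k = i
    · rw [hk, lam_Y_self, map_mul, repl_zero_Y, repl_zero_Y]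
    · rw [lam_Y h hk, repl_zero_Y]

theorem conj_nu_mem_DAut {i j : Fin m} (h : i ≠ j) {d : MulAut (Fr m)} (hd : d ∈ DAut m) :
    nu i j h * d * (nu i j h)⁻¹ ∈ DAut m := by
  refine conj_mem_DAut (nu_X h) (fun k => ?_) (nu_inv_X h) (fun k => ?_) hd
  · by_cases hk : k = i
    · rw [hk, nu_Y_self, map_mul, repl_zero_Y, repl_zero_Y]
    · rw [nu_Y h hk, repl_zero_Y]
  · by_cases hk : k = i
    · rw [hk, nu_inv_Y_self, map_mul, map_inv, repl_zero_Y, repl_zero_Y]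
    · rw [nu_inv_Y h hk, repl_zero_Y]

theorem conj_nu_inv_mem_DAut {i j : Fin m} (h : i ≠ j) {d : MulAut (Fr m)} (hd : d ∈ DAut m) :
    (nu i j h)⁻¹ * d * nu i j h ∈ DAut m := by
  refine conj_mem_DAut (s := (nu i j h)⁻¹) (nu_inv_X h) (fun k => ?_) (nu_X h) (fun k => ?_) hd
  · by_cases hk : k = i
    · rw [hk, nu_inv_Y_self, map_mul, map_inv, repl_zero_Y, repl_zero_Y]
    · rw [nu_inv_Y h hk, repl_zero_Y]
  · rw [inv_inv]
    by_cases hk : k = i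
    · rw [hk, nu_Y_self, map_mul, repl_zero_Y, repl_zero_Y]
    · rw [nu_Y h hk, repl_zero_Y]

end Cosets

/-! ### Conjugates of the generated subgroup cover `DAut` up to one δ_j -/

section IndexTwo

/-- The two alternatives say that right multiplication by y fixes the cosets N and Ne, or exchanges
them; so the orbit of N under the generated group stays in these two cosets. -/
theorem mem_or_mul_inv_mem_of_mem_closure {G : Type*} [Group G] {N : Subgroup G} {e : G}
    {s : Set G} (h : ∀ y ∈ s, (y ∈ N ∧ e * y * e⁻¹ ∈ N) ∨ (e * y ∈ N ∧ y * e⁻¹ ∈ N)) {d : G}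
    (hd : d ∈ Subgroup.closure s) : d ∈ N ∨ d * e⁻¹ ∈ N := by
  induction hd using Subgroup.closure_induction_right with
  | one => exact Or.inl (one_mem _)
  | mul_right x hx y hy ih =>
    rcases h y hy with ⟨h1, h2⟩ | ⟨h1, h2⟩ <;> rcases ih with ih | ih
    · exact Or.inl (mul_mem ih h1)
    · refine Or.inr ?_
      convert mul_mem ih h2 using 1; group
    · refine Or.inr ?_
      convert mul_mem ih h2 using 1; group
    · refine Or.inl ?_
      convert mul_mem ih h1 using 1; group
  | mul_inv_cancel x hx y hy ih =>
    rcases h y hy with ⟨h1, h2⟩ | ⟨h1, h2⟩ <;> rcases ih with ih | ih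
    · exact Or.inl (mul_mem ih (inv_mem h1))
    · refine Or.inr ?_
      convert mul_mem ih (inv_mem h2) using 1; group
    · refine Or.inr ?_
      convert mul_mem ih (inv_mem h1) using 1; group
    · refine Or.inl ?_
      convert mul_mem ih (inv_mem h2) using 1; group

variable {m : ℕ}

/-- The automorphisms that are conjugated by `shear S` into the subgroup generated by `gens m`. -/
def conjKAut (S : Finset (Fin m)) : Subgroup (MulAut (Fr m)) :=
  (KAut m).comap (MulAut.conj (shear S)).toMonoidHom

theorem mem_conjKAut {S : Finset (Fin m)} {d : MulAut (Fr m)} :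
    d ∈ conjKAut S ↔ shear S * d * (shear S)⁻¹ ∈ KAut m := Iff.rfl

theorem mem_conjKAut_singleton {j : Fin m} {d : MulAut (Fr m)} :
    d ∈ conjKAut {j} ↔ phi j * d * (phi j)⁻¹ ∈ KAut m := by
  rw [mem_conjKAut, shear_singleton]

theorem delta_mem_conjKAut {i j : Fin m} (h : i ≠ j) : delta i ∈ conjKAut {j} := by
  rw [mem_conjKAut_singleton]
  -- Conjugation by φ_j has the same effect on x as δ_i itself; after removing δ_i, only a left
  -- factor in the kernel remains at y_j.
  have h1 : (delta i)⁻¹ * (phi j * delta i * (phi j)⁻¹) ∈ KAut m := by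
    refine mem_KAut_of_elementary (a := (X m)⁻¹ * (Y i)⁻¹ * X m) (b := 1) j ?_
      (fun l hl => ?_) (by simp) (map_one _)
      (by rw [map_mul, map_mul, map_inv, map_inv, repl_succ_X, repl_succ_Y h.symm])
      (map_one _) (Or.inl ?_)
    · simp only [MulAut.mul_apply, phi_inv_X, delta_X, map_mul, phi_X, phi_Y h, delta_inv_X,
        delta_inv_Y]
      group
    · simp only [MulAut.mul_apply, phi_inv_Y hl, delta_Y, phi_Y hl, delta_inv_Y]
    · simp only [MulAut.mul_apply, phi_inv_Y_self, map_mul, map_inv, delta_X, delta_Y, phi_X,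
        phi_Y h, phi_Y_self, delta_inv_X, delta_inv_Y]
      group
  have h2 := mul_mem (delta_mem_KAut i) h1
  rwa [mul_inv_cancel_left] at h2

theorem eps_mem_conjKAut {i j : Fin m} (h : i ≠ j) : eps i ∈ conjKAut {j} := by
  rw [mem_conjKAut_singleton]
  have h1 : (eps i)⁻¹ * (phi j * eps i * (phi j)⁻¹) ∈ KAut m := by
    refine mem_KAut_of_elementary (a := (Y i)⁻¹) (b := 1) j ?_
      (fun l hl => ?_) (by simp) (map_one _)
      (by rw [map_inv, repl_succ_Y h.symm])
      (map_one _) (Or.inl ?_)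
    · simp only [MulAut.mul_apply, phi_inv_X, eps_X, map_mul, phi_X, phi_Y h, eps_inv_X,
        eps_inv_Y]
      group
    · simp only [MulAut.mul_apply, phi_inv_Y hl, eps_Y, phi_Y hl, eps_inv_Y]
    · simp only [MulAut.mul_apply, phi_inv_Y_self, map_mul, map_inv, eps_X, eps_Y, phi_X,
        phi_Y h, phi_Y_self, eps_inv_X, eps_inv_Y]
      group
  have h2 := mul_mem (eps_mem_KAut i) h1
  rwa [mul_inv_cancel_left] at h2

/-- ε_j δ_j⁻¹ conjugates x by y_j. Its conjugate by φ_j is itself times the partial conjugation of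
y_j by x. -/
theorem eps_mul_delta_inv_mem_conjKAut (j : Fin m) : eps j * (delta j)⁻¹ ∈ conjKAut {j} := by
  rw [mem_conjKAut_singleton]
  have h1 : (eps j * (delta j)⁻¹)⁻¹ * (phi j * (eps j * (delta j)⁻¹) * (phi j)⁻¹) ∈ KAut m := by
    refine mem_KAut_of_elementary (a := 1) (b := 1) j ?_
      (fun l hl => ?_) (map_one _) (map_one _) (map_one _) (map_one _) (Or.inr ?_)
    · simp only [mul_inv_rev, inv_inv, MulAut.mul_apply, phi_inv_X, delta_inv_X, map_mul, map_inv,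
        eps_X, eps_Y, phi_X, phi_Y_self, eps_inv_X, eps_inv_Y, delta_X, delta_Y]
      group
    · simp only [mul_inv_rev, inv_inv, MulAut.mul_apply, phi_inv_Y hl, delta_inv_Y, eps_Y, phi_Y hl,
        eps_inv_Y, delta_Y]
    · simp only [mul_inv_rev, inv_inv, MulAut.mul_apply, phi_inv_Y_self, delta_inv_X, delta_inv_Y,
        map_mul, map_inv, eps_X, eps_Y, phi_X, phi_Y_self, eps_inv_X, eps_inv_Y, delta_X, delta_Y]
      group
  have h2 := mul_mem (mul_mem (eps_mem_KAut j) (inv_mem (delta_mem_KAut j))) h1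
  rwa [mul_inv_cancel_left] at h2

/-- The conjugate by φ_j sends x to x y_j x² y_j. Membership comes from an explicit identity,
checked on generators, that involves only x and y_j and expresses the conjugate through elements of
the generated subgroup. -/
theorem delta_mul_eps_mem_conjKAut (j : Fin m) : delta j * eps j ∈ conjKAut {j} := by
  rw [mem_conjKAut_singleton]
  have h1 : phi j * (delta j * eps j) * (phi j)⁻¹ = phi j ^ 2 *
      ((eps j * (delta j)⁻¹)⁻¹ * (phi j ^ 2 * (delta j)⁻¹) ^ 2 * pconj j) *
        (eps j ^ 2)⁻¹ := by
    refine aut_ext ?_ fun l => ?_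
    · simp only [pow_two, mul_inv_rev, inv_inv, MulAut.mul_apply, phi_inv_X, delta_inv_X, map_mul,
        map_inv, eps_X, phi_X, phi_Y_self, eps_inv_X, eps_inv_Y, delta_X, delta_Y, pconj_X,
        pconj_Y_self, delta_inv_Y, mul_assoc, inv_mul_cancel_left, mul_inv_cancel_left,
        mul_inv_cancel, mul_one]
    · by_cases hl : l = j
      · subst hl
        simp only [pow_two, mul_inv_rev, inv_inv, MulAut.mul_apply, phi_inv_Y_self, delta_inv_X,
          map_mul, map_inv, eps_X, eps_Y, phi_X, phi_Y_self, eps_inv_X, eps_inv_Y, delta_X, delta_Y,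
          pconj_Y_self, delta_inv_Y]
        group
      · simp only [pow_two, mul_inv_rev, inv_inv, MulAut.mul_apply, phi_inv_Y hl, eps_Y, phi_Y hl,
          eps_inv_Y, delta_Y, pconj_Y hl, delta_inv_Y]
  have hp := phi_sq_mem_KAut j
  have hd := delta_mem_KAut j
  have he := eps_mem_KAut j
  rw [h1]
  exact mul_mem (mul_mem hp (mul_mem (mul_mem (inv_mem (mul_mem he (inv_mem hd)))
    (pow_mem (mul_mem hp (inv_mem hd)) 2)) (pconj_mem_KAut j))) (inv_mem (pow_mem he 2))

theorem delta_mul_eps (i j : Fin m) : delta i * eps j = eps j * delta i := by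
  refine aut_ext ?_ fun l => ?_
  · simp only [MulAut.mul_apply, eps_X, delta_X, map_mul, eps_Y, delta_Y, mul_assoc]
  · simp only [MulAut.mul_apply, eps_Y, delta_Y]

/-- As δ_j and ε_j commute, δ_j² is the quotient of δ_j ε_j by ε_j δ_j⁻¹. -/
theorem delta_mul_delta_mem_conjKAut (j : Fin m) : delta j * delta j ∈ conjKAut {j} := by
  have h1 := mul_mem (delta_mul_eps_mem_conjKAut j) (inv_mem (eps_mul_delta_inv_mem_conjKAut j))
  rw [mul_inv_rev, inv_inv, delta_mul_eps, mul_assoc, ← mul_assoc, ← mul_assoc] at h1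
  have h2 : eps j * delta j * delta j * (eps j)⁻¹ = delta j * delta j := by
    rw [← delta_mul_eps, mul_assoc (delta j), ← delta_mul_eps]
    group
  rwa [h2] at h1

/-- The generators with i ≠ j fix the two cosets, while δ_j and ε_j exchange them. -/
theorem mem_or_of_singleton (j : Fin m) {d : MulAut (Fr m)} (hd : d ∈ DAut m) :
    d ∈ conjKAut {j} ∨ d * (delta j)⁻¹ ∈ conjKAut {j} := by
  refine mem_or_mul_inv_mem_of_mem_closure ?_ hd
  rintro _ (⟨i, rfl⟩ | ⟨i, rfl⟩)
  · by_cases h : i = j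
    · subst h
      exact Or.inr ⟨delta_mul_delta_mem_conjKAut i, by rw [mul_inv_cancel]; exact one_mem _⟩
    · refine Or.inl ⟨delta_mem_conjKAut h, ?_⟩
      have h1 := delta_mul_eps_mem_conjKAut j
      have h2 := mul_mem (mul_mem h1 (delta_mem_conjKAut h)) (inv_mem h1)
      have h3 : delta j * eps j * delta i * (delta j * eps j)⁻¹ =
          delta j * delta i * (delta j)⁻¹ := by
        rw [mul_assoc (delta j), ← delta_mul_eps]; group
      rwa [h3] at h2
  · by_cases h : i = j
    · subst h
      exact Or.inr ⟨delta_mul_eps_mem_conjKAut i, eps_mul_delta_inv_mem_conjKAut i⟩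
    · refine Or.inl ⟨eps_mem_conjKAut h, ?_⟩
      rw [delta_mul_eps, mul_inv_cancel_right]
      exact eps_mem_conjKAut h

theorem lam_mul_delta {j k : Fin m} (h : k ≠ j) :
    lam k j h * delta j = delta j * lam k j h := by
  refine aut_ext ?_ fun l => ?_
  · simp only [MulAut.mul_apply, delta_X, map_mul, lam_X, lam_Y h h.symm]
  · by_cases hl : l = k
    · subst hl
      simp only [MulAut.mul_apply, delta_Y, lam_Y_self, map_mul]
    · simp only [MulAut.mul_apply, delta_Y, lam_Y h hl]

theorem repl_xInd (S : Finset (Fin m)) (i k : Fin m) :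
    repl k.succ 1 (xInd S i) = xInd S i := apply_xInd (repl_succ_X _ _) S i

/-- Reduction to S = {j}: as y_j is already sheared, λ_kj adds k to the index set of a shear modulo
the generated subgroup. It also normalises `DAut` and commutes with δ_j, so the dichotomy passes
from the smaller set to the larger. -/
theorem mem_or_of_mem {S : Finset (Fin m)} {j : Fin m} (hj : j ∈ S) {d : MulAut (Fr m)}
    (hd : d ∈ DAut m) : d ∈ conjKAut S ∨ d * (delta j)⁻¹ ∈ conjKAut S := by
  have key : ∀ S : Finset (Fin m), j ∉ S → ∀ d ∈ DAut m,
      d ∈ conjKAut (insert j S) ∨ d * (delta j)⁻¹ ∈ conjKAut (insert j S) := by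
    intro S
    induction S using Finset.induction_on with
    | empty =>
      intro _ d hd
      exact mem_or_of_singleton j hd
    | insert k S hk ih =>
      intro hjk d hd
      rw [Finset.mem_insert, not_or] at hjk
      obtain ⟨hjk, hjS⟩ := hjk
      have hne : k ≠ j := Ne.symm hjk
      have hkS : k ∉ insert j S := by simp [hne, hk]
      have h1 : shear (insert j S) * lam k j hne * (shear (insert j (insert k S)))⁻¹ ∈ KAut m := by
        refine shear_mul_mem_of_left (lam_X hne) (fun l hl => lam_Y hne hl) (lam_Y_self hne) ?_
          (fun l hl => by simp [hl]) ?_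
        · rw [shear_Y, map_mul, repl_xInd, repl_succ_Y hne]
        · rw [pi2_shear_Y, xInd_of_mem (by simp), xInd_of_notMem hkS, xInd_of_mem (by simp),
            map_one, mul_one]
      have h2 : ∀ d, lam k j hne * d * (lam k j hne)⁻¹ ∈ conjKAut (insert j S) →
          d ∈ conjKAut (insert j (insert k S)) := by
        intro d hd
        rw [mem_conjKAut] at hd ⊢
        convert mul_mem (mul_mem (inv_mem h1) hd) h1 using 1
        group
      rcases ih hjS _ (conj_lam_mem_DAut hne hd) with h3 | h3
      · exact Or.inl (h2 _ h3)
      · refine Or.inr (h2 _ ?_)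
        convert h3 using 1
        have h4 : (lam k j hne)⁻¹ * (delta j)⁻¹ = (delta j)⁻¹ * (lam k j hne)⁻¹ := by
          rw [← mul_inv_rev, ← mul_inv_rev, lam_mul_delta]
        rw [mul_assoc _ _ (delta j)⁻¹, h4]
        group
  have := key (S.erase j) (Finset.notMem_erase j S) d hd
  rwa [Finset.insert_erase hj] at this

end IndexTwo

/-! ### Double cosets covering the automorphisms of determinant one -/

section CosetCover

variable {m : ℕ}

/-- The union of the double cosets of the automorphisms `shear S`. -/
def cosetCover (m : ℕ) : Set (MulAut (Fr m)) :=
  {g | ∃ S, ∃ k ∈ KAut m, ∃ d ∈ DAut m, g = k * shear S * d}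

theorem mul_mem_cosetCover {k g : MulAut (Fr m)} (hk : k ∈ KAut m) (hg : g ∈ cosetCover m) :
    k * g ∈ cosetCover m := by
  obtain ⟨S, l, hl, d, hd, rfl⟩ := hg
  exact ⟨S, k * l, mul_mem hk hl, d, hd, by simp only [mul_assoc]⟩

theorem mem_cosetCover_mul {d g : MulAut (Fr m)} (hg : g ∈ cosetCover m) (hd : d ∈ DAut m) :
    g * d ∈ cosetCover m := by
  obtain ⟨S, l, hl, e, he, rfl⟩ := hg
  exact ⟨S, l, hl, e * d, mul_mem he hd, by simp only [mul_assoc]⟩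

theorem shear_mem_cosetCover (S : Finset (Fin m)) : shear S ∈ cosetCover m :=
  ⟨S, 1, one_mem _, 1, one_mem _, by simp⟩

theorem phi_mem_cosetCover (i : Fin m) : phi i ∈ cosetCover m :=
  shear_singleton i ▸ shear_mem_cosetCover {i}

theorem mul_mem_cosetCover_of_normalizes {s : MulAut (Fr m)}
    (h1 : ∀ S, ∃ S', shear S * s * (shear S')⁻¹ ∈ KAut m)
    (h2 : ∀ d ∈ DAut m, s⁻¹ * d * s ∈ DAut m) {g : MulAut (Fr m)} (hg : g ∈ cosetCover m) :
    g * s ∈ cosetCover m := by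
  obtain ⟨S, k, hk, d, hd, rfl⟩ := hg
  obtain ⟨S', hS'⟩ := h1 S
  refine ⟨S', k * (shear S * s * (shear S')⁻¹), mul_mem hk hS', _, h2 d hd, ?_⟩
  group

theorem exists_shear_mul_of_left {s : MulAut (Fr m)} {i : Fin m} {u : Fr m}
    (hX : s (X m) = X m) (hY : ∀ l, l ≠ i → s (Y l) = Y l)
    (hs : s (Y i) = u * Y i) (S : Finset (Fin m))
    (hu : repl i.succ 1 (shear S u) = shear S u) :
    ∃ S', shear S * s * (shear S')⁻¹ ∈ KAut m := by
  obtain ⟨S', h1, h2⟩ := exists_index_set S i (pi2 m (shear S u))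
  exact ⟨S', shear_mul_mem_of_left hX hY hs hu h1 h2⟩

theorem exists_shear_mul_of_right {s : MulAut (Fr m)} {i : Fin m} {u : Fr m}
    (hX : s (X m) = X m) (hY : ∀ l, l ≠ i → s (Y l) = Y l)
    (hs : s (Y i) = Y i * u) (S : Finset (Fin m))
    (hu : repl i.succ 1 (shear S u) = shear S u) :
    ∃ S', shear S * s * (shear S')⁻¹ ∈ KAut m := by
  obtain ⟨S', h1, h2⟩ := exists_index_set S i (pi2 m (shear S u))
  exact ⟨S', shear_mul_mem_of_right hX hY hs hu h1 h2⟩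

theorem repl_shear_Y {i j : Fin m} (h : i ≠ j) (S : Finset (Fin m)) :
    repl i.succ 1 (shear S (Y j)) = shear S (Y j) := by
  rw [shear_Y, map_mul, repl_xInd, repl_succ_Y h]

theorem mul_lam_mem_cosetCover {i j : Fin m} (h : i ≠ j) {g : MulAut (Fr m)}
    (hg : g ∈ cosetCover m) : g * lam i j h ∈ cosetCover m :=
  mul_mem_cosetCover_of_normalizes (fun S => exists_shear_mul_of_left (lam_X h)
    (fun _ hl => lam_Y h hl) (lam_Y_self h) S (repl_shear_Y h S))
    (fun _ hd => conj_lam_inv_mem_DAut h hd) hg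

theorem mul_lam_inv_mem_cosetCover {i j : Fin m} (h : i ≠ j) {g : MulAut (Fr m)}
    (hg : g ∈ cosetCover m) : g * (lam i j h)⁻¹ ∈ cosetCover m :=
  mul_mem_cosetCover_of_normalizes (fun S => exists_shear_mul_of_left (lam_inv_X h)
    (fun _ hl => lam_inv_Y h hl) (lam_inv_Y_self h) S
      (by rw [map_inv, map_inv, repl_shear_Y h S]))
    (fun _ hd => by rw [inv_inv]; exact conj_lam_mem_DAut h hd) hg

theorem mul_nu_mem_cosetCover {i j : Fin m} (h : i ≠ j) {g : MulAut (Fr m)}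
    (hg : g ∈ cosetCover m) : g * nu i j h ∈ cosetCover m :=
  mul_mem_cosetCover_of_normalizes (fun S => exists_shear_mul_of_right (nu_X h)
    (fun _ hl => nu_Y h hl) (nu_Y_self h) S (repl_shear_Y h S))
    (fun _ hd => conj_nu_inv_mem_DAut h hd) hg

theorem mul_nu_inv_mem_cosetCover {i j : Fin m} (h : i ≠ j) {g : MulAut (Fr m)}
    (hg : g ∈ cosetCover m) : g * (nu i j h)⁻¹ ∈ cosetCover m :=
  mul_mem_cosetCover_of_normalizes (fun S => exists_shear_mul_of_right (nu_inv_X h)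
    (fun _ hl => nu_inv_Y h hl) (nu_inv_Y_self h) S
      (by rw [map_inv, map_inv, repl_shear_Y h S]))
    (fun _ hd => by rw [inv_inv]; exact conj_nu_mem_DAut h hd) hg

/-- If S is nonempty, pick j in S, different from i when possible: the factor from `DAut` can be
absorbed on the left up to 1 or δ_j, so two products per S have to be checked. If S is empty, the
whole factor is absorbed. Taking j = i is unavoidable only for S = {i}, which is the third
hypothesis. -/
theorem mul_mem_cosetCover_of_steps {s : MulAut (Fr m)} {i : Fin m}
    (h1 : ∀ S, shear S * s ∈ cosetCover m)
    (h2 : ∀ S, ∀ j ∈ S, j ≠ i → shear S * (delta j * s) ∈ cosetCover m)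
    (h3 : phi i * (delta i * s) ∈ cosetCover m) {g : MulAut (Fr m)} (hg : g ∈ cosetCover m) :
    g * s ∈ cosetCover m := by
  obtain ⟨S, k, hk, d, hd, rfl⟩ := hg
  have key : ∀ j ∈ S, shear S * (delta j * s) ∈ cosetCover m →
      k * shear S * d * s ∈ cosetCover m := by
    intro j hj hjs
    rcases mem_or_of_mem hj hd with h | h
    · convert mul_mem_cosetCover (mul_mem hk (mem_conjKAut.1 h)) (h1 S) using 1
      group
    · convert mul_mem_cosetCover (mul_mem hk (mem_conjKAut.1 h)) hjs using 1
      group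
  by_cases hne : ∃ j ∈ S, j ≠ i
  · obtain ⟨j, hj, hji⟩ := hne
    exact key j hj (h2 S j hj hji)
  · push Not at hne
    by_cases hi : i ∈ S
    · have hS : S = {i} := Finset.eq_singleton_iff_unique_mem.2 ⟨hi, hne⟩
      refine key i hi ?_
      rwa [hS, shear_singleton]
    · have hS : S = ∅ := Finset.eq_empty_of_forall_notMem fun j hj => hi (hne j hj ▸ hj)
      have h4 := mul_mem_cosetCover (mul_mem hk (DAut_le_KAut hd)) (h1 ∅)
      rw [hS, shear_empty, mul_one]
      rwa [shear_empty, one_mul] at h4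

theorem mem_cosetCover_of_mul_inv {g : MulAut (Fr m)} {S : Finset (Fin m)}
    (h : g * (shear S)⁻¹ ∈ KAut m) : g ∈ cosetCover m := by
  have := mul_mem_cosetCover h (shear_mem_cosetCover S)
  rwa [inv_mul_cancel_right] at this

theorem shear_delta_mul_mem {s : MulAut (Fr m)} {j : Fin m} {S : Finset (Fin m)}
    (h : shear S * (delta j * s * (delta j)⁻¹) * (shear S)⁻¹ ∈ KAut m) :
    shear S * (delta j * s) ∈ cosetCover m := by
  have := mem_cosetCover_mul (mem_cosetCover_of_mul_inv h) (delta_mem_DAut j)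
  convert this using 1
  group

theorem mul_mem_cosetCover_of_left {s : MulAut (Fr m)} {i : Fin m} {u : Fr m}
    (hX : s (X m) = X m) (hY : ∀ l, l ≠ i → s (Y l) = Y l) (hs : s (Y i) = u * Y i)
    (hu : u = X m ∨ u = (X m)⁻¹) (h3 : phi i * (delta i * s) ∈ cosetCover m)
    {g : MulAut (Fr m)} (hg : g ∈ cosetCover m) : g * s ∈ cosetCover m := by
  refine mul_mem_cosetCover_of_steps (fun S => ?_) (fun S j hj hji => ?_) h3 hg
  · obtain ⟨S', h⟩ := exists_shear_mul_of_left hX hY hs S (by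
      rcases hu with rfl | rfl <;> simp only [map_inv, shear_X, repl_succ_X])
    exact mem_cosetCover_of_mul_inv h
  -- Conjugation by δ_j turns the factor x into y_j x, which the shear maps to x y_j x because j is
  -- in S; this lies in the kernel, so the index set does not change. The inverse sign is analogous.
  · refine shear_delta_mul_mem (shear_mul_mem_of_left (i := i) (u := delta j u)
      ?_ (fun l hl => ?_) ?_ ?_ (fun _ _ => Iff.rfl) ?_)
    · simp only [MulAut.mul_apply, delta_inv_X, map_mul, map_inv, hY j hji, hX, delta_X, delta_Y,
        inv_mul_cancel_left]
    · simp only [MulAut.mul_apply, delta_inv_Y, hY l hl, delta_Y]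
    · simp only [MulAut.mul_apply, delta_inv_Y, hs, map_mul, delta_Y]
    · rcases hu with rfl | rfl <;>
        simp only [map_inv, delta_X, map_mul, shear_X, repl_shear_Y hji.symm, repl_succ_X]
    · have hg : gC2 * gC2 = 1 := by decide
      rcases hu with rfl | rfl <;>
        simp only [map_inv, delta_X, map_mul, shear_X, pi2_shear_Y, xInd_of_mem hj, pi2_X, hg,
          inv_one, one_mul]

theorem mul_mem_cosetCover_of_right {s : MulAut (Fr m)} {i : Fin m} {u : Fr m}
    (hX : s (X m) = X m) (hY : ∀ l, l ≠ i → s (Y l) = Y l) (hs : s (Y i) = Y i * u)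
    (hu : u = X m ∨ u = (X m)⁻¹) (h3 : phi i * (delta i * s) ∈ cosetCover m)
    {g : MulAut (Fr m)} (hg : g ∈ cosetCover m) : g * s ∈ cosetCover m := by
  refine mul_mem_cosetCover_of_steps (fun S => ?_) (fun S j hj hji => ?_) h3 hg
  · obtain ⟨S', h⟩ := exists_shear_mul_of_right hX hY hs S (by
      rcases hu with rfl | rfl <;> simp only [map_inv, shear_X, repl_succ_X])
    exact mem_cosetCover_of_mul_inv h
  -- As for left factors: after the shear, the factor x^±1 has become (x y_j x)^±1, an element of
  -- the kernel.
  · refine shear_delta_mul_mem (shear_mul_mem_of_right (i := i) (u := delta j u)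
      ?_ (fun l hl => ?_) ?_ ?_ (fun _ _ => Iff.rfl) ?_)
    · simp only [MulAut.mul_apply, delta_inv_X, map_mul, map_inv, hY j hji, hX, delta_X, delta_Y,
        inv_mul_cancel_left]
    · simp only [MulAut.mul_apply, delta_inv_Y, hY l hl, delta_Y]
    · simp only [MulAut.mul_apply, delta_inv_Y, hs, map_mul, delta_Y]
    · rcases hu with rfl | rfl <;>
        simp only [map_inv, delta_X, map_mul, shear_X, repl_shear_Y hji.symm, repl_succ_X]
    · have hg : gC2 * gC2 = 1 := by decide
      rcases hu with rfl | rfl <;>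
        simp only [map_inv, delta_X, map_mul, shear_X, pi2_shear_Y, xInd_of_mem hj, pi2_X, hg,
          inv_one, one_mul]

/-- The braid relation of the two opposite elementary moves on x and y_i, lifted from SL(2, ℤ). -/
theorem phi_delta_inv_phi (i : Fin m) :
    phi i * (delta i)⁻¹ * phi i = (delta i)⁻¹ * phi i * (delta i)⁻¹ := by
  refine aut_ext ?_ fun l => ?_
  · simp only [MulAut.mul_apply, phi_X, delta_inv_X, map_mul, map_inv, phi_Y_self, delta_inv_Y]
    group
  · by_cases hl : l = i
    · subst hl
      simp only [MulAut.mul_apply, phi_X, delta_inv_X, map_mul, map_inv, phi_Y_self, delta_inv_Y]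
      group
    · simp only [MulAut.mul_apply, delta_inv_Y, phi_Y hl]

theorem psi_eps_inv_psi (i : Fin m) :
    psi i * (eps i)⁻¹ * psi i = (eps i)⁻¹ * psi i * (eps i)⁻¹ := by
  refine aut_ext ?_ fun l => ?_
  · simp only [MulAut.mul_apply, psi_X, eps_inv_X, map_mul, map_inv, psi_Y_self, eps_inv_Y]
    group
  · by_cases hl : l = i
    · subst hl
      simp only [MulAut.mul_apply, psi_X, eps_inv_X, map_mul, map_inv, psi_Y_self, eps_inv_Y]
      group
    · simp only [MulAut.mul_apply, eps_inv_Y, psi_Y hl]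

theorem psi_mem_cosetCover (i : Fin m) : psi i ∈ cosetCover m :=
  psi_eq' i ▸ mul_mem_cosetCover (pconj_mem_KAut i) (phi_mem_cosetCover i)

/-- Used with a = φ_i or ψ_i and b = δ_i or ε_i: on the right a occurs only as a² and once to the
first power, which displays the element in K · a · D up to factors already known to lie in K. -/
theorem inv_mul_inv_of_braid {G : Type*} [Group G] {a b : G}
    (h : a * b⁻¹ * a = b⁻¹ * a * b⁻¹) : a * b * a⁻¹ = a ^ 2 * b * (a ^ 2)⁻¹ * a * b := by
  have h1 := congrArg (·⁻¹) h
  simp only [mul_inv_rev, inv_inv] at h1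
  calc a * b * a⁻¹ = a ^ 2 * (a⁻¹ * (b * a⁻¹)) := by group
    _ = a ^ 2 * b * (a ^ 2)⁻¹ * a * b := by rw [h1]; group

theorem mul_phi_mem_cosetCover (i : Fin m) {g : MulAut (Fr m)} (hg : g ∈ cosetCover m) :
    g * phi i ∈ cosetCover m := by
  refine mul_mem_cosetCover_of_left (phi_X i) (fun _ hl => phi_Y hl) (phi_Y_self i) (Or.inl rfl)
    ?_ hg
  have h1 := mem_conjKAut_singleton.1 (delta_mul_delta_mem_conjKAut i)
  have h2 := mem_cosetCover_mul (mul_mem_cosetCover (mul_mem h1 (inv_mem (delta_mem_KAut i)))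
    (phi_mem_cosetCover i)) (inv_mem (delta_mem_DAut i))
  convert h2 using 1
  have h3 := phi_delta_inv_phi i
  -- Splitting δ_i as δ_i² δ_i⁻¹ isolates a conjugate of δ_i², already known to lie in K, and leaves
  -- one side of the braid relation.
  calc phi i * (delta i * phi i) = phi i * (delta i * delta i) * (phi i)⁻¹ *
        (phi i * (delta i)⁻¹ * phi i) := by group
    _ = _ := by rw [h3]; simp only [mul_assoc]

theorem mul_phi_inv_mem_cosetCover (i : Fin m) {g : MulAut (Fr m)} (hg : g ∈ cosetCover m) :
    g * (phi i)⁻¹ ∈ cosetCover m := by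
  refine mul_mem_cosetCover_of_left (phi_inv_X i) (fun _ hl => phi_inv_Y hl) (phi_inv_Y_self i)
    (Or.inr rfl) ?_ hg
  rw [← mul_assoc, inv_mul_inv_of_braid (phi_delta_inv_phi i)]
  exact mem_cosetCover_mul (mul_mem_cosetCover (mul_mem (mul_mem (phi_sq_mem_KAut i)
    (delta_mem_KAut i)) (inv_mem (phi_sq_mem_KAut i))) (phi_mem_cosetCover i)) (delta_mem_DAut i)

theorem mul_psi_mem_cosetCover (i : Fin m) {g : MulAut (Fr m)} (hg : g ∈ cosetCover m) :
    g * psi i ∈ cosetCover m := by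
  refine mul_mem_cosetCover_of_right (psi_X i) (fun _ hl => psi_Y hl) (psi_Y_self i) (Or.inl rfl)
    ?_ hg
  have h1 := mem_conjKAut_singleton.1 (delta_mul_eps_mem_conjKAut i)
  have h2 := mem_cosetCover_mul (mul_mem_cosetCover (mul_mem (mul_mem h1
    (inv_mem (pconj_mem_KAut i))) (inv_mem (eps_mem_KAut i)))
    (psi_mem_cosetCover i)) (inv_mem (eps_mem_DAut i))
  convert h2 using 1
  have h3 := psi_eps_inv_psi i
  have h4 : phi i = (pconj i)⁻¹ * psi i := by rw [psi_eq', inv_mul_cancel_left]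
  -- Here δ_i is split as (δ_i ε_i) ε_i⁻¹, and φ_i is replaced by ψ_i up to a partial conjugation,
  -- so that the braid relation of ψ_i and ε_i applies.
  calc phi i * (delta i * psi i) = phi i * (delta i * eps i) * (phi i)⁻¹ *
        (phi i * (eps i)⁻¹ * psi i) := by group
    _ = phi i * (delta i * eps i) * (phi i)⁻¹ * (pconj i)⁻¹ *
        (psi i * (eps i)⁻¹ * psi i) := by nth_rewrite 3 [h4]; simp only [mul_assoc]
    _ = _ := by rw [h3]; simp only [mul_assoc]

theorem mul_psi_inv_mem_cosetCover (i : Fin m) {g : MulAut (Fr m)} (hg : g ∈ cosetCover m) :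
    g * (psi i)⁻¹ ∈ cosetCover m := by
  refine mul_mem_cosetCover_of_right (psi_inv_X i) (fun _ hl => psi_inv_Y hl) (psi_inv_Y_self i)
    (Or.inr rfl) ?_ hg
  have h1 := mem_conjKAut_singleton.1 (inv_mem (eps_mul_delta_inv_mem_conjKAut i))
  rw [mul_inv_rev, inv_inv] at h1
  have h2 := mem_cosetCover_mul (mul_mem_cosetCover (mul_mem (mul_mem h1
    (inv_mem (pconj_mem_KAut i))) (mul_mem (mul_mem (psi_sq_mem_KAut i)
    (eps_mem_KAut i)) (inv_mem (psi_sq_mem_KAut i)))) (psi_mem_cosetCover i)) (eps_mem_DAut i)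
  convert h2 using 1
  have h3 := inv_mul_inv_of_braid (psi_eps_inv_psi i)
  have h4 : phi i = (pconj i)⁻¹ * psi i := by rw [psi_eq', inv_mul_cancel_left]
  calc phi i * (delta i * (psi i)⁻¹) = phi i * (delta i * (eps i)⁻¹) * (phi i)⁻¹ *
        (phi i * eps i * (psi i)⁻¹) := by group
    _ = phi i * (delta i * (eps i)⁻¹) * (phi i)⁻¹ * (pconj i)⁻¹ *
        (psi i * eps i * (psi i)⁻¹) := by nth_rewrite 3 [h4]; simp only [mul_assoc]
    _ = _ := by rw [h3]; simp only [mul_assoc]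

theorem transvection_cases {e : MulAut (Fr m)} (he : e ∈ transvections (Fin (m + 1))) :
    (∃ i, e = delta i) ∨ (∃ i, e = eps i) ∨ (∃ i, e = phi i) ∨ (∃ i, e = psi i) ∨
      (∃ i j h, e = lam i j h) ∨ ∃ i j h, e = nu i j h := by
  obtain ⟨a, b, hab, h1, h2⟩ := he
  have hX : ∀ i : Fin m, a = i.succ → e (X m) = X m := fun i hi =>
    h1 0 (hi ▸ (Fin.succ_ne_zero i).symm)
  have hY : ∀ i : Fin m, a = i.succ → ∀ l, l ≠ i → e (Y l) = Y l := fun i hi l hl =>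
    h1 l.succ (hi ▸ Y_index_ne hl)
  rcases Fin.eq_zero_or_eq_succ a with rfl | ⟨i, rfl⟩
  · rcases Fin.eq_zero_or_eq_succ b with rfl | ⟨j, rfl⟩
    · exact absurd rfl hab
    · have hY : ∀ l : Fin m, e (Y l) = Y l := fun l => h1 l.succ (Fin.succ_ne_zero l)
      rcases h2 with h2 | h2
      · exact Or.inr (Or.inl ⟨j, aut_ext (h2.trans (eps_X j).symm) fun l => by
          rw [hY, eps_Y]⟩)
      · exact Or.inl ⟨j, aut_ext (h2.trans (delta_X j).symm) fun l => by
          rw [hY, delta_Y]⟩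
  · rcases Fin.eq_zero_or_eq_succ b with rfl | ⟨j, rfl⟩
    · rcases h2 with h2 | h2
      · refine Or.inr (Or.inr (Or.inr (Or.inl ⟨i, aut_ext ?_ fun l => ?_⟩)))
        · rw [hX i rfl, psi_X]
        · by_cases hl : l = i
          · subst hl; exact h2.trans (psi_Y_self l).symm
          · rw [hY i rfl l hl, psi_Y hl]
      · refine Or.inr (Or.inr (Or.inl ⟨i, aut_ext ?_ fun l => ?_⟩))
        · rw [hX i rfl, phi_X]
        · by_cases hl : l = i
          · subst hl; exact h2.trans (phi_Y_self l).symm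
          · rw [hY i rfl l hl, phi_Y hl]
    · have hij : i ≠ j := fun h => hab (congrArg Fin.succ h)
      rcases h2 with h2 | h2
      · refine Or.inr (Or.inr (Or.inr (Or.inr (Or.inr ⟨i, j, hij, aut_ext ?_ fun l => ?_⟩))))
        · rw [hX i rfl, nu_X]
        · by_cases hl : l = i
          · subst hl; exact h2.trans (nu_Y_self hij).symm
          · rw [hY i rfl l hl, nu_Y hij hl]
      · refine Or.inr (Or.inr (Or.inr (Or.inr (Or.inl ⟨i, j, hij, aut_ext ?_ fun l => ?_⟩))))
        · rw [hX i rfl, lam_X]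
        · by_cases hl : l = i
          · subst hl; exact h2.trans (lam_Y_self hij).symm
          · rw [hY i rfl l hl, lam_Y hij hl]

/-- The cover contains 1 and is stable under right multiplication by every transvection and its
inverse. -/
theorem APlus_subset_cosetCover {g : MulAut (Fr m)} (hg : g ∈ APlus m) : g ∈ cosetCover m := by
  rw [APlus_eq_EAut] at hg
  induction hg using Subgroup.closure_induction_right with
  | one => exact shear_empty (m := m) ▸ shear_mem_cosetCover ∅
  | mul_right x _ y hy ih =>
    rcases transvection_cases hy with ⟨i, rfl⟩ | ⟨i, rfl⟩ | ⟨i, rfl⟩ | ⟨i, rfl⟩ | ⟨i, j, h, rfl⟩ |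
      ⟨i, j, h, rfl⟩
    · exact mem_cosetCover_mul ih (delta_mem_DAut i)
    · exact mem_cosetCover_mul ih (eps_mem_DAut i)
    · exact mul_phi_mem_cosetCover i ih
    · exact mul_psi_mem_cosetCover i ih
    · exact mul_lam_mem_cosetCover h ih
    · exact mul_nu_mem_cosetCover h ih
  | mul_inv_cancel x _ y hy ih =>
    rcases transvection_cases hy with ⟨i, rfl⟩ | ⟨i, rfl⟩ | ⟨i, rfl⟩ | ⟨i, rfl⟩ | ⟨i, j, h, rfl⟩ |
      ⟨i, j, h, rfl⟩
    · exact mem_cosetCover_mul ih (inv_mem (delta_mem_DAut i))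
    · exact mem_cosetCover_mul ih (inv_mem (eps_mem_DAut i))
    · exact mul_phi_inv_mem_cosetCover i ih
    · exact mul_psi_inv_mem_cosetCover i ih
    · exact mul_lam_inv_mem_cosetCover h ih
    · exact mul_nu_inv_mem_cosetCover h ih

end CosetCover

/-! ### The generators of Γ⁺ -/

section GenerationOfGamPlus

variable {m : ℕ}

/-- Inducing the identity on F / ker π amounts to π ∘ φ = π, and this already forces φ to preserve
the kernel. -/
theorem mem_Gam_iff {F G : Type*} [Group F] [Group G] {π : F →* G} {φ : MulAut F} :
    φ ∈ Gam π ↔ ∀ f, π (φ f) = π f := by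
  refine ⟨Gam_map_eq, fun h => ⟨?_, fun f => ?_⟩⟩
  · change π.ker.map φ.toMonoidHom = π.ker
    ext f
    rw [Subgroup.mem_map]
    constructor
    · rintro ⟨g, hg, rfl⟩
      rw [MonoidHom.mem_ker] at hg ⊢
      exact (h g).trans hg
    · intro hf
      refine ⟨φ⁻¹ f, ?_, MulAut.apply_inv_self _ _ _⟩
      rw [MonoidHom.mem_ker] at hf ⊢
      rw [← h, MulAut.apply_inv_self, hf]
  · rw [QuotientGroup.eq, MonoidHom.mem_ker, map_mul, map_inv, h, inv_mul_cancel]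

theorem mem_Gam_pi2 {φ : MulAut (Fr m)} (hX : pi2 m (φ (X m)) = gC2)
    (hY : ∀ i, pi2 m (φ (Y i)) = 1) : φ ∈ Gam (pi2 m) := by
  rw [mem_Gam_iff]
  have : (pi2 m).comp φ.toMonoidHom = pi2 m := by
    refine FreeGroup.ext_hom _ _ fun i => Fin.cases ?_ (fun l => ?_) i
    · exact hX.trans pi2_X.symm
    · exact (hY l).trans (pi2_Y l).symm
  exact fun f => DFunLike.congr_fun this f

theorem nielsen_mem_APlus {k : Fin (m + 1)} {u v : Fr m} (hu : repl k 1 u = u)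
    (hv : repl k 1 v = v) (h : ex k u + ex k v = 0) : nielsen k u v hu hv ∈ APlus m := by
  refine mem_APlus_of_fix k (fun j hj => nielsen_of_ne hj _ _ _ _) ?_
  rw [nielsen_self, ex_mul, ex_mul, ex_of_self]
  linarith

theorem ex_zero_Y (i : Fin m) : ex 0 (Y i) = 0 := ex_of_ne (Fin.succ_ne_zero i).symm

theorem ex_succ_X (i : Fin m) : ex i.succ (X m) = 0 := ex_of_ne (Fin.succ_ne_zero i)

theorem ex_succ_Y {i j : Fin m} (h : i ≠ j) : ex i.succ (Y j) = 0 := ex_of_ne (Y_index_ne h)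

theorem delta_mem_APlus (i : Fin m) : delta i ∈ APlus m :=
  nielsen_mem_APlus _ _ (by rw [ex_zero_Y, ex_one, add_zero])

theorem eps_mem_APlus (i : Fin m) : eps i ∈ APlus m :=
  nielsen_mem_APlus _ _ (by rw [ex_zero_Y, ex_one, add_zero])

theorem phi_mem_APlus (i : Fin m) : phi i ∈ APlus m :=
  nielsen_mem_APlus _ _ (by rw [ex_succ_X, ex_one, add_zero])

theorem psi_mem_APlus (i : Fin m) : psi i ∈ APlus m :=
  nielsen_mem_APlus _ _ (by rw [ex_succ_X, ex_one, add_zero])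

theorem lam_mem_APlus {i j : Fin m} (h : i ≠ j) : lam i j h ∈ APlus m :=
  nielsen_mem_APlus _ _ (by rw [ex_succ_Y h, ex_one, add_zero])

theorem nu_mem_APlus {i j : Fin m} (h : i ≠ j) : nu i j h ∈ APlus m :=
  nielsen_mem_APlus _ _ (by rw [ex_succ_Y h, ex_one, add_zero])

theorem nielsen_mem_Gam {k : Fin (m + 1)} {u v : Fr m} (hu : repl k 1 u = u)
    (hv : repl k 1 v = v) (h : pi2 m (u * v) = 1) : nielsen k u v hu hv ∈ Gam (pi2 m) := by
  have h1 : ∀ j, pi2 m (nielsen k u v hu hv (FreeGroup.of j)) = pi2 m (FreeGroup.of j) := by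
    intro j
    by_cases hj : j = k
    · rw [hj, nielsen_self, map_mul, map_mul, mul_right_comm, ← map_mul, h, one_mul]
    · rw [nielsen_of_ne hj]
  exact mem_Gam_pi2 ((h1 0).trans pi2_X) fun i => (h1 i.succ).trans (pi2_Y i)

theorem tau_mem_GamPlus {i j : Fin m} (h : i ≠ j) : tau i j h ∈ GamPlus m :=
  ⟨nielsen_mem_Gam _ _ (by simp [commutatorElement_def]),
    nielsen_mem_APlus _ _ (by rw [ex_one, ex_commutator, add_zero])⟩

theorem lam_mem_GamPlus {i j : Fin m} (h : i ≠ j) : lam i j h ∈ GamPlus m :=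
  ⟨nielsen_mem_Gam _ _ (by simp), lam_mem_APlus h⟩

theorem nu_mem_GamPlus {i j : Fin m} (h : i ≠ j) : nu i j h ∈ GamPlus m :=
  ⟨nielsen_mem_Gam _ _ (by simp), nu_mem_APlus h⟩

theorem delta_mem_GamPlus (i : Fin m) : delta i ∈ GamPlus m :=
  ⟨nielsen_mem_Gam _ _ (by simp), delta_mem_APlus i⟩

theorem eps_mem_GamPlus (i : Fin m) : eps i ∈ GamPlus m :=
  ⟨nielsen_mem_Gam _ _ (by simp), eps_mem_APlus i⟩

theorem pconj_mem_GamPlus (i : Fin m) : pconj i ∈ GamPlus m := by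
  refine ⟨mem_Gam_pi2 (by rw [pconj_X, pi2_X]) fun l => ?_,
    (APlus m).mul_mem ((APlus m).inv_mem (phi_mem_APlus i)) (psi_mem_APlus i)⟩
  by_cases hl : l = i
  · rw [hl, pconj_Y_self]; simp
  · rw [pconj_Y hl, pi2_Y]

theorem phi_sq_mem_GamPlus (i : Fin m) : phi i ^ 2 ∈ GamPlus m := by
  refine ⟨mem_Gam_pi2 ?_ fun l => ?_, pow_mem (phi_mem_APlus i) 2⟩
  · rw [pow_two, MulAut.mul_apply, phi_X, phi_X, pi2_X]
  · have hg : gC2 * gC2 = 1 := by decide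
    by_cases hl : l = i
    · rw [hl, pow_two, MulAut.mul_apply, phi_Y_self, map_mul, phi_X, phi_Y_self]
      simp [hg]
    · rw [pow_two, MulAut.mul_apply, phi_Y hl, phi_Y hl, pi2_Y]

theorem KAut_le_GamPlus : KAut m ≤ GamPlus m := by
  refine (Subgroup.closure_le _).2 ?_
  rintro a (((((⟨i, rfl⟩ | ⟨i, rfl⟩) | ⟨i, j, h, rfl⟩) | ⟨i, j, h, rfl⟩) | ⟨i, rfl⟩) |
    (((((⟨j, k, rfl⟩ | ⟨i, j, k, hj, hk, rfl⟩) | ⟨i, j, h, rfl⟩) | ⟨i, rfl⟩) | ⟨i, rfl⟩) |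
      ⟨i, j, h, rfl⟩))
  · exact delta_mem_GamPlus i
  · exact eps_mem_GamPlus i
  · exact lam_mem_GamPlus h
  · exact nu_mem_GamPlus h
  · exact phi_sq_mem_GamPlus i
  · exact ⟨nielsen_mem_Gam _ _ (by simp [commutatorElement_def]),
      nielsen_mem_APlus _ _ (by rw [ex_one, ex_commutator, add_zero])⟩
  · exact ⟨nielsen_mem_Gam _ _ (by simp [commutatorElement_def]),
      nielsen_mem_APlus _ _ (by rw [ex_one, ex_commutator, add_zero])⟩
  · exact tau_mem_GamPlus h
  · exact (GamPlus m).mul_mem ((GamPlus m).inv_mem (delta_mem_GamPlus i)) (eps_mem_GamPlus i)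
  · exact pconj_mem_GamPlus i
  · exact (GamPlus m).mul_mem (lam_mem_GamPlus h) ((GamPlus m).inv_mem (nu_mem_GamPlus h))

theorem closure_gens_eq_GamPlus : Subgroup.closure (gens m) = GamPlus m := by
  refine le_antisymm KAut_le_GamPlus fun g hg => ?_
  obtain ⟨S, k, hk, d, hd, rfl⟩ := APlus_subset_cosetCover hg.2
  have hS : S = ∅ := by
    refine Finset.eq_empty_of_forall_notMem fun i hi => ?_
    -- For i in S, the value of π on the image of y_i would be g instead of 1, since d fixes y_i and
    -- k preserves π.
    have h1 := Gam_map_eq hg.1 (Y i)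
    rw [MulAut.mul_apply, MulAut.mul_apply, DAut_apply_Y hd, Gam_map_eq (KAut_le_GamPlus hk).1,
      pi2_shear_Y, xInd_of_mem hi, pi2_X, pi2_Y] at h1
    exact absurd h1 (by decide)
  rw [hS, shear_empty, mul_one]
  exact mul_mem hk (DAut_le_KAut hd)

end GenerationOfGamPlus

/-! ### The representation on the invariant part and the index -/

section SigmaPlus

variable {m : ℕ}

/-- The map of the relation module to `F / F'` induced by the inclusion. -/
noncomputable def relToAb (m : ℕ) : RelMod (pi2 m) →+ Additive (Abelianization (Fr m)) :=
  MonoidHom.toAdditive (Abelianization.map (pi2 m).ker.subtype)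

theorem relToAb_abCls (r : (pi2 m).ker) : relToAb m (abCls r) = abCls (r : Fr m) := rfl

theorem relToAb_rhoBar (φ : Gam (pi2 m)) (a : RelMod (pi2 m)) :
    relToAb m (rhoBar (pi2 m) φ a) = abAut (Fr m) φ (relToAb m a) := by
  induction a using abCls_induction with
  | h r => rfl

theorem relToAb_xx : relToAb m (xx m) = 2 • abBasis (Fin (m + 1)) 0 := by
  have h : relToAb m (xx m) = abCls (X m ^ 2) := rfl
  rw [h, pow_two, abCls_mul, two_nsmul, abBasis_apply]
  rfl

theorem relToAb_yb (i : Fin m) : relToAb m (yb i) = abBasis (Fin (m + 1)) i.succ := by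
  rw [yb, relToAb_abCls, abBasis_apply]
  rfl

theorem relToAb_xyx (i : Fin m) : relToAb m (xyx i) = abBasis (Fin (m + 1)) i.succ := by
  rw [xyx, relToAb_abCls, abCls_mul, abCls_mul, abCls_inv, abBasis_apply, add_neg_cancel_comm]
  rfl

/-- Both x² and y_i + x y_i x⁻¹ become divisible by exactly 2 in F / F', which makes this basis a
uniform multiple of the standard one. -/
theorem relToAb_vecPlus (i : Fin (m + 1)) :
    relToAb m (vecPlus m i : RelMod (pi2 m)) = 2 • abBasis (Fin (m + 1)) i := by
  refine Fin.cases relToAb_xx (fun i => ?_) i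
  change relToAb m (yb i + xyx i) = _
  rw [map_add, relToAb_yb, relToAb_xyx, two_nsmul]

theorem repr_relToAb (a : RPlus m) (i : Fin (m + 1)) :
    (abBasis (Fin (m + 1))).repr (relToAb m (a : RelMod (pi2 m))) i =
      2 * (basisPlus m).repr a i := by
  conv_lhs => rw [← (basisPlus m).sum_repr a]
  have h : ∀ j, basisPlus m j = vecPlus m j := fun j => Module.Basis.mk_apply _ _ _
  simp only [Submodule.coe_sum, Submodule.coe_smul, map_sum, map_zsmul, h, relToAb_vecPlus,
    map_nsmul, Module.Basis.repr_self, Finsupp.coe_finsetSum, Finset.sum_apply, Finsupp.coe_smul,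
    Pi.smul_apply, Finsupp.single_apply]
  simp [mul_comm]

/-- The map to F / F' is equivariant and takes one basis to twice the other; the factor 2 cancels,
so the two matrices agree. -/
theorem sigmaPlus_eq_abMat (φ : GamPlus m) : sigmaPlus m φ = abMat (Fin (m + 1)) φ := by
  ext i j
  have h1 : (sigmaPlus m φ).1 i j = (basisPlus m).repr (eigenAct (pi2 m) (pi2_surjective m) gC2 1
      (Subgroup.inclusion inf_le_left φ) (basisPlus m j)) i := matRep_apply _ _ _ _
  have h2 := repr_relToAb (eigenAct (pi2 m) (pi2_surjective m) gC2 1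
      (Subgroup.inclusion inf_le_left φ) (basisPlus m j)) i
  have h3 : basisPlus m j = vecPlus m j := Module.Basis.mk_apply _ _ _
  have h4 : ((eigenAct (pi2 m) (pi2_surjective m) gC2 1
      (Subgroup.inclusion inf_le_left φ) (basisPlus m j) : RPlus m) : RelMod (pi2 m)) =
      rhoBar (pi2 m) (Subgroup.inclusion inf_le_left φ) (vecPlus m j) := by rw [h3]; rfl
  have h5 : (abMat (Fin (m + 1)) φ).1 i j = (abBasis (Fin (m + 1))).repr
      (abAut (Fr m) φ (abBasis (Fin (m + 1)) j)) i := matRep_apply _ _ _ _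
  rw [h4, relToAb_rhoBar, relToAb_vecPlus, map_nsmul, map_nsmul, Finsupp.smul_apply] at h2
  rw [h1, h5]
  have h6 : ((Subgroup.inclusion inf_le_left φ : Gam (pi2 m)) : MulAut (Fr m)) = φ := rfl
  rw [h6] at h2
  simp only [nsmul_eq_mul, Nat.cast_ofNat] at h2
  omega

theorem toAdd_pi2 (f : Fr m) : Multiplicative.toAdd (pi2 m f) = (ex 0 f : ZMod 2) := by
  induction f using FreeGroup.induction_on with
  | C1 => rw [map_one, ex_one]; rfl
  | of j =>
    refine Fin.cases ?_ (fun i => ?_) j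
    · change Multiplicative.toAdd (pi2 m (X m)) = _
      rw [pi2_X, ex_of_self, Int.cast_one]; rfl
    · change Multiplicative.toAdd (pi2 m (Y i)) = (ex 0 (Y i) : ZMod 2)
      rw [pi2_Y, ex_zero_Y, Int.cast_zero]; rfl
  | inv_of j h => rw [map_inv, toAdd_inv, h, ex_inv, Int.cast_neg]
  | mul a b ha hb => rw [map_mul, toAdd_mul, ha, hb, ex_mul, Int.cast_add]

theorem pi2_eq_iff {f g : Fr m} : pi2 m f = pi2 m g ↔ ex 0 f ≡ ex 0 g [ZMOD (2 : ℕ)] := by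
  rw [← ZMod.intCast_eq_intCast_iff, ← toAdd_pi2, ← toAdd_pi2]
  exact Multiplicative.toAdd.injective.eq_iff.symm

/-- π is the exponent sum of x modulo 2, so preserving it is a condition on the row of x. -/
theorem mem_Gam_pi2_iff {φ : MulAut (Fr m)} : φ ∈ Gam (pi2 m) ↔
    ∀ j, (abMat (Fin (m + 1)) φ).1 0 j ≡ (Pi.single 0 1 : Fin (m + 1) → ℤ) j [ZMOD (2 : ℕ)] := by
  have h0 : ∀ j, (Pi.single 0 1 : Fin (m + 1) → ℤ) j = ex 0 (FreeGroup.of j) := fun j => by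
    rw [ex_of, Pi.single_apply]; simp only [eq_comm]
  simp only [abMat_apply, h0, ← pi2_eq_iff]
  refine ⟨fun h j => Gam_map_eq h _, fun h => mem_Gam_pi2 ((h 0).trans pi2_X) fun i => ?_⟩
  exact (h i.succ).trans (pi2_Y i)

theorem range_sigmaPlus :
    (sigmaPlus m).range = (Gamma1 m 2).map Matrix.SpecialLinearGroup.toGL := by
  ext A
  simp only [MonoidHom.mem_range, Subgroup.mem_map]
  constructor
  · rintro ⟨φ, rfl⟩
    refine ⟨⟨(abMat (Fin (m + 1)) φ).1, mem_APlus_iff.1 φ.2.2⟩, mem_Gam_pi2_iff.1 φ.2.1, ?_⟩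
    rw [sigmaPlus_eq_abMat]
    exact Units.ext rfl
  · rintro ⟨A, hA, rfl⟩
    obtain ⟨φ, hφ⟩ := abMat_surjective (m + 1) (Matrix.SpecialLinearGroup.toGL A)
    refine ⟨⟨φ, mem_Gam_pi2_iff.2 ?_, mem_APlus_iff.2 ?_⟩, ?_⟩
    · rw [hφ]; exact hA
    · rw [hφ]; exact A.2
    · rw [sigmaPlus_eq_abMat]; exact hφ

end SigmaPlus

/-! ### The index of Γ⁺ in the automorphisms of determinant one -/

section Index

variable {m : ℕ}

theorem shear_mem_APlus (S : Finset (Fin m)) : shear S ∈ APlus m := by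
  induction S using Finset.induction_on with
  | empty => rw [shear_empty]; exact one_mem _
  | insert i S hi ih =>
    have h : shear (insert i S) = phi i * shear S := by
      refine aut_ext ?_ fun l => ?_
      · rw [MulAut.mul_apply, shear_X, shear_X, phi_X]
      · have h1 := apply_xInd (s := (phi i).toMonoidHom) (phi_X i) S l
        simp only [MulEquiv.toMonoidHom_eq_coe, MonoidHom.coe_coe] at h1
        rw [MulAut.mul_apply, shear_Y, shear_Y, map_mul, h1]
        by_cases hl : l = i
        · subst hl
          rw [phi_Y_self, xInd_of_notMem hi, xInd_of_mem (by simp), one_mul]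
        · rw [phi_Y hl]
          simp [xInd, hl]
    rw [h]
    exact mul_mem (phi_mem_APlus i) ih

/-- Determinant `1` automorphisms are transitive on the nontrivial homomorphisms to `C2`. -/
theorem exists_mem_APlus_pi2 {v : Fin (m + 1) → C2} (hv : v ≠ 1) :
    ∃ φ ∈ APlus m, ∀ j, pi2 m (φ (FreeGroup.of j)) = v j := by
  have hc : ∀ c : C2, c = 1 ∨ c = gC2 := by decide
  let S : Finset (Fin m) := Finset.univ.filter fun i => v i.succ = gC2
  have hS : ∀ i, pi2 m (xInd S i) = v i.succ := by
    intro i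
    rcases hc (v i.succ) with h | h
    · rw [h, xInd_of_notMem, map_one]
      have h1 : (1 : C2) ≠ gC2 := by decide
      simp [S, h, h1]
    · rw [h, xInd_of_mem (by simp [S, h]), pi2_X]
  rcases hc (v 0) with h0 | h0
  · obtain ⟨i, hi⟩ : ∃ i : Fin m, v i.succ = gC2 := by
      by_contra! hcon
      refine hv (funext fun j => Fin.cases h0 (fun i => ?_) j)
      exact (hc _).resolve_right (hcon i)
    -- To give x the value 1, x is first multiplied by a y_i that the shear maps to an element of
    -- value g, so that the two values cancel.
    refine ⟨shear S * delta i, mul_mem (shear_mem_APlus S) (delta_mem_APlus i), fun j => ?_⟩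
    refine Fin.cases ?_ (fun l => ?_) j
    · change pi2 m ((shear S * delta i) (X m)) = _
      rw [MulAut.mul_apply, delta_X, map_mul, map_mul, shear_X, pi2_shear_Y, hS, hi, pi2_X, h0]
      decide
    · change pi2 m ((shear S * delta i) (Y l)) = _
      rw [MulAut.mul_apply, delta_Y, pi2_shear_Y, hS]
  · refine ⟨shear S, shear_mem_APlus S, fun j => Fin.cases ?_ (fun l => ?_) j⟩
    · change pi2 m (shear S (X m)) = _
      rw [shear_X, pi2_X, h0]
    · change pi2 m (shear S (Y l)) = _
      rw [pi2_shear_Y, hS]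

/-- The values of the homomorphism `π φ⁻¹` on the free generators. -/
def translate (φ : MulAut (Fr m)) : Fin (m + 1) → C2 := fun j => pi2 m (φ⁻¹ (FreeGroup.of j))

/-- Γ is the stabiliser of π, so its left cosets are separated by the translates of π. -/
theorem translate_eq_iff {φ ψ : MulAut (Fr m)} :
    translate φ = translate ψ ↔ φ⁻¹ * ψ ∈ Gam (pi2 m) := by
  have h1 : translate φ = translate ψ ↔
      (pi2 m).comp (φ⁻¹).toMonoidHom = (pi2 m).comp (ψ⁻¹).toMonoidHom :=
    ⟨fun h => FreeGroup.ext_hom _ _ fun j => congrFun h j,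
      fun h => funext fun j => DFunLike.congr_fun h _⟩
  rw [h1, mem_Gam_iff]
  constructor
  · intro h f
    have h2 := DFunLike.congr_fun h (ψ f)
    change pi2 m (φ⁻¹ (ψ f)) = pi2 m (ψ⁻¹ (ψ f)) at h2
    rwa [MulAut.inv_apply_self] at h2
  · intro h
    ext f
    have h2 := h (ψ⁻¹ (FreeGroup.of f))
    rw [MulAut.mul_apply, MulAut.apply_inv_self] at h2
    exact congrArg _ h2

theorem translate_ne_one (φ : MulAut (Fr m)) : translate φ ≠ 1 := by
  intro h
  have h1 : (pi2 m).comp (φ⁻¹).toMonoidHom = 1 := FreeGroup.ext_hom _ _ fun j => congrFun h j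
  have h2 := DFunLike.congr_fun h1 (φ (X m))
  change pi2 m (φ⁻¹ (φ (X m))) = 1 at h2
  rw [MulAut.inv_apply_self, pi2_X] at h2
  exact absurd h2 (by decide)

theorem relIndex_GamPlus : (GamPlus m).relIndex (APlus m) = 2 ^ (m + 1) - 1 := by
  have hrel : ∀ a b : APlus m,
      (QuotientGroup.leftRel ((GamPlus m).subgroupOf (APlus m))) a b ↔
        translate (a : MulAut (Fr m)) = translate (b : MulAut (Fr m)) := by
    intro a b
    rw [QuotientGroup.leftRel_apply, Subgroup.mem_subgroupOf, translate_eq_iff]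
    exact ⟨fun h => h.1, fun h => ⟨h, (a⁻¹ * b).2⟩⟩
  let F : (APlus m ⧸ (GamPlus m).subgroupOf (APlus m)) → {v : Fin (m + 1) → C2 // v ≠ 1} :=
    Quotient.lift (fun a => ⟨translate (a : MulAut (Fr m)), translate_ne_one _⟩)
      fun a b h => Subtype.ext ((hrel a b).1 h)
  have hF : Function.Bijective F := by
    constructor
    · intro a b
      induction a using Quotient.inductionOn
      induction b using Quotient.inductionOn
      intro h
      exact Quotient.sound ((hrel _ _).2 (congrArg Subtype.val h))
    · rintro ⟨v, hv⟩
      obtain ⟨φ, hφ, h⟩ := exists_mem_APlus_pi2 hv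
      refine ⟨Quotient.mk _ ⟨φ⁻¹, inv_mem hφ⟩, Subtype.ext (funext fun j => ?_)⟩
      change pi2 m (φ⁻¹⁻¹ (FreeGroup.of j)) = v j
      rw [inv_inv, h]
  have hcard : Nat.card {v : Fin (m + 1) → C2 // v ≠ 1} = 2 ^ (m + 1) - 1 := by
    rw [Nat.card_eq_fintype_card, Fintype.card_subtype_compl, Fintype.card_subtype_eq]
    simp [C2]
  rw [Subgroup.relIndex, Subgroup.index, Nat.card_eq_of_bijective F hF, hcard]

end Index

/-! ### The representation on the anti-invariant part -/

section SigmaMinus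

variable {m : ℕ}

theorem coordY_relAct (a : RelMod (pi2 m)) (i : Fin m) :
    coordY m (relAct (pi2 m) (pi2_surjective m) gC2 a) i = (coordY m a i).swap := by
  obtain ⟨⟨k, p, q⟩, rfl⟩ := comb_surjective a
  rw [relAct_comb, coordY_comb, coordY_comb]
  rfl

theorem repr_relToAb_succ (a : RelMod (pi2 m)) (i : Fin m) :
    (abBasis (Fin (m + 1))).repr (relToAb m a) i.succ = (coordY m a i).1 + (coordY m a i).2 := by
  obtain ⟨⟨k, p, q⟩, rfl⟩ := comb_surjective a
  rw [coordY_comb, comb_apply]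
  simp only [map_add, map_sum, map_zsmul, relToAb_xx, relToAb_yb, relToAb_xyx, map_nsmul,
    Module.Basis.repr_self, Finsupp.add_apply, Finsupp.coe_finsetSum, Finset.sum_apply,
    Finsupp.smul_apply, Finsupp.single_apply]
  simp [Fin.succ_inj, (Fin.succ_ne_zero i).symm]

theorem coordY_eq_repr (a : RMinus m) (i : Fin m) :
    (coordY m (a : RelMod (pi2 m)) i).1 = (basisMinus m).repr a i := by
  conv_lhs => rw [← (basisMinus m).sum_repr a]
  have h : ∀ j, basisMinus m j = vecMinus m j := fun j => Module.Basis.mk_apply _ _ _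
  have h1 : ((∑ j, (basisMinus m).repr a j • basisMinus m j : RMinus m) : RelMod (pi2 m)) =
      comb m (0, (basisMinus m).repr a, -(basisMinus m).repr a) := by
    simp only [h]
    exact sum_vecMinus _
  rw [h1, coordY_comb]

/-- The class of `φ(y_j)` in the relation module. -/
noncomputable def imY (φ : GamPlus m) (j : Fin m) : RelMod (pi2 m) :=
  rhoBar (pi2 m) (Subgroup.inclusion inf_le_left φ) (yb j)

/-- The image of w_j is the image of y_j minus its translate by g, which exchanges the coefficients
of y_i and x y_i x⁻¹; the coefficient of w_i is therefore their difference. -/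
theorem sigmaMinus_apply (φ : GamPlus m) (i j : Fin m) :
    (sigmaMinus m φ).1 i j = (coordY m (imY φ j) i).1 - (coordY m (imY φ j) i).2 := by
  have h1 : (sigmaMinus m φ).1 i j =
      (basisMinus m).repr (eigenAct (pi2 m) (pi2_surjective m) gC2 (-1)
      (Subgroup.inclusion inf_le_left φ) (basisMinus m j)) i := matRep_apply _ _ _ _
  have h3 : basisMinus m j = vecMinus m j := Module.Basis.mk_apply _ _ _
  have h4 : ((eigenAct (pi2 m) (pi2_surjective m) gC2 (-1)
      (Subgroup.inclusion inf_le_left φ) (basisMinus m j) : RMinus m) : RelMod (pi2 m)) =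
      rhoBar (pi2 m) (Subgroup.inclusion inf_le_left φ) (yb j - xyx j) := by rw [h3]; rfl
  rw [h1, ← coordY_eq_repr, h4, map_sub, ← relAct_yb, rhoBar_relAct, map_sub, Pi.sub_apply,
    coordY_relAct]
  rfl

theorem ex_succ_apply_Y (φ : GamPlus m) (i j : Fin m) :
    ex i.succ ((φ : MulAut (Fr m)) (Y j)) =
      (coordY m (imY φ j) i).1 + (coordY m (imY φ j) i).2 := by
  rw [← repr_relToAb_succ]
  rfl

theorem Y_mem_ker (i : Fin m) : Y i ∈ (pi2 m).ker := by simp [MonoidHom.mem_ker]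

theorem XYX_mem_ker (i : Fin m) : X m * Y i * (X m)⁻¹ ∈ (pi2 m).ker := by simp [MonoidHom.mem_ker]

theorem imY_of_eq {φ : GamPlus m} {j : Fin m} {r : (pi2 m).ker}
    (h : (φ : MulAut (Fr m)) (Y j) = r) : imY φ j = abCls r :=
  congrArg abCls (Subtype.ext h)

theorem imY_of_fix {φ : GamPlus m} {j : Fin m} (h : (φ : MulAut (Fr m)) (Y j) = Y j) :
    imY φ j = yb j := imY_of_eq (r := ⟨Y j, Y_mem_ker j⟩) h

/-- Conjugation by x⁻¹ and by x differ by x², an element of R, which acts trivially on R / R'. -/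
theorem abCls_conj (i : Fin m) (h : (X m)⁻¹ * Y i * X m ∈ (pi2 m).ker) :
    abCls (⟨(X m)⁻¹ * Y i * X m, h⟩ : (pi2 m).ker) = xyx i := by
  have hx : X m ^ 2 ∈ (pi2 m).ker := by rw [MonoidHom.mem_ker, map_pow, pi2_X]; decide
  have h1 : (⟨(X m)⁻¹ * Y i * X m, h⟩ : (pi2 m).ker) =
      ⟨_, hx⟩⁻¹ * ⟨_, XYX_mem_ker i⟩ * ⟨_, hx⟩ := by
    ext
    simp only [Subgroup.coe_mul, Subgroup.coe_inv]
    group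
  rw [h1, abCls_mul, abCls_mul, abCls_inv, neg_add_cancel_comm]
  rfl

theorem sigmaMinus_col_of_fix {φ : GamPlus m} {j : Fin m}
    (h : (φ : MulAut (Fr m)) (Y j) = Y j) (i : Fin m) :
    (sigmaMinus m φ).1 i j = (1 : Matrix (Fin m) (Fin m) ℤ) i j := by
  rw [sigmaMinus_apply, imY_of_fix h, coordY_yb, Matrix.one_apply]
  by_cases hij : i = j
  · simp [hij]
  · simp [hij]

theorem sigmaMinus_pconj (i a b : Fin m) : (sigmaMinus m ⟨pconj i, pconj_mem_GamPlus i⟩).1 a b =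
    Matrix.diagonal (Function.update 1 i (-1)) a b := by
  by_cases hb : b = i
  · subst hb
    have hk : (X m)⁻¹ * Y b * X m ∈ (pi2 m).ker := by simp [MonoidHom.mem_ker]
    have h1 : imY ⟨pconj b, pconj_mem_GamPlus b⟩ b = xyx b :=
      (imY_of_eq (r := ⟨_, hk⟩) (pconj_Y_self b)).trans (abCls_conj b hk)
    rw [sigmaMinus_apply, h1, coordY_xyx]
    by_cases ha : a = b <;> simp [ha]
  · rw [sigmaMinus_col_of_fix (pconj_Y hb), Matrix.diagonal_apply, Matrix.one_apply]
    by_cases ha : a = b <;> simp [ha, hb]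

theorem sigmaMinus_lam {i j : Fin m} (h : i ≠ j) (a b : Fin m) :
    (sigmaMinus m ⟨lam i j h, lam_mem_GamPlus h⟩).1 a b = Matrix.transvection j i 1 a b := by
  rw [Matrix.transvection, Matrix.add_apply, Matrix.single_apply]
  by_cases hb : b = i
  · subst hb
    have h1 : imY ⟨lam b j h, lam_mem_GamPlus h⟩ b = yb j + yb b :=
      imY_of_eq (r := ⟨_, Y_mem_ker j⟩ * ⟨_, Y_mem_ker b⟩) (lam_Y_self h)
    rw [sigmaMinus_apply, h1, map_add, coordY_yb, coordY_yb, Matrix.one_apply]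
    by_cases ha : a = b
    · subst ha; simp [h, h.symm]
    · by_cases ha' : a = j
      · subst ha'; simp [ha]
      · simp [ha, ha', Ne.symm ha']
  · rw [sigmaMinus_col_of_fix (lam_Y h hb)]
    simp [Ne.symm hb]

theorem sigmaMinus_surjective : Function.Surjective (sigmaMinus m) := by
  rw [← MonoidHom.range_eq_top]
  refine IsElementary.eq_top ⟨fun i j hij => ⟨_, ⟨⟨lam j i hij.symm, lam_mem_GamPlus _⟩, rfl⟩, ?_⟩,
    fun i => ⟨_, ⟨⟨pconj i, pconj_mem_GamPlus i⟩, rfl⟩, ?_⟩⟩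
  · ext a b
    exact sigmaMinus_lam hij.symm a b
  · ext a b
    exact sigmaMinus_pconj i a b

theorem IA_le_GamPlus : IA m ≤ GamPlus m := by
  intro φ hφ
  rw [mem_IA_iff] at hφ
  refine ⟨mem_Gam_pi2_iff.2 fun j => ?_, mem_APlus_iff.2 ?_⟩
  · rw [hφ, Units.val_one, Matrix.one_apply, Pi.single_apply]
    simp only [eq_comm]
    rfl
  · rw [hφ, Units.val_one, Matrix.det_one]

/-- Difference and sum of the two coefficients agree modulo 2, and the sum is an entry of the matrix
on F / F', here the identity. -/
theorem sigmaMinus_modEq_of_mem_IA {φ : GamPlus m} (h : (φ : MulAut (Fr m)) ∈ IA m)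
    (i j : Fin m) :
    (sigmaMinus m φ).1 i j ≡ (1 : Matrix (Fin m) (Fin m) ℤ) i j [ZMOD 2] := by
  rw [mem_IA_iff] at h
  have h1 := abMat_apply (φ : MulAut (Fr m)) i.succ j.succ
  rw [h, Units.val_one, Matrix.one_apply] at h1
  have h2 := ex_succ_apply_Y φ i j
  have h3 : ex i.succ ((φ : MulAut (Fr m)) (Y j)) =
      ex i.succ ((φ : MulAut (Fr m)) (FreeGroup.of j.succ)) := rfl
  rw [h3, ← h1] at h2
  simp only [Fin.succ_inj] at h2
  rw [sigmaMinus_apply, Matrix.one_apply, h2, Int.modEq_iff_dvd]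
  exact ⟨(coordY m (imY φ j) i).2, by ring⟩

theorem mem_IA_of_ex {φ : MulAut (Fr m)} (hX : ∀ i, ex i (φ (X m)) = ex i (X m))
    (hY : ∀ i j, ex i (φ (Y j)) = ex i (Y j)) : φ ∈ IA m := by
  rw [mem_IA_iff]
  ext i j
  rw [abMat_apply, Units.val_one, Matrix.one_apply, ← ex_of]
  refine Fin.cases (hX i) (fun l => hY i l) j

theorem pconj_mem_IA (i : Fin m) : pconj i ∈ IA m := by
  refine mem_IA_of_ex (fun a => by rw [pconj_X]) fun a j => ?_
  by_cases h : j = i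
  · rw [h, pconj_Y_self, ex_mul, ex_mul, ex_inv]; ring
  · rw [pconj_Y h]

theorem tau_Y_self {i j : Fin m} (h : i ≠ j) : tau i j h (Y i) = Y i * ⁅X m, Y j⁆ :=
  (nielsen_self _ _ _ _ _).trans (by rw [one_mul]; rfl)

theorem tau_Y {i j k : Fin m} (h : i ≠ j) (hk : k ≠ i) : tau i j h (Y k) = Y k :=
  nielsen_of_ne (Y_index_ne hk) _ _ _ _

theorem tau_X {i j : Fin m} (h : i ≠ j) : tau i j h (X m) = X m :=
  nielsen_of_ne (Fin.succ_ne_zero i).symm _ _ _ _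

theorem tau_mem_IA {i j : Fin m} (h : i ≠ j) : tau i j h ∈ IA m := by
  refine mem_IA_of_ex (fun a => by rw [tau_X]) fun a k => ?_
  by_cases hk : k = i
  · rw [hk, tau_Y_self, ex_mul, ex_commutator, add_zero]
  · rw [tau_Y h hk]

/-- The commutator [x, y_j] has class -w_j, and w_i receives it twice: from y_i, and with opposite
sign from its translate. -/
theorem sigmaMinus_tau {i j : Fin m} (h : i ≠ j) (a b : Fin m) :
    (sigmaMinus m ⟨tau i j h, tau_mem_GamPlus h⟩).1 a b = Matrix.transvection j i (-2) a b := by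
  rw [Matrix.transvection, Matrix.add_apply, Matrix.single_apply]
  by_cases hb : b = i
  · subst hb
    have h1 : imY ⟨tau b j h, tau_mem_GamPlus h⟩ b = yb b + (xyx j - yb j) := by
      refine (imY_of_eq (r := ⟨_, Y_mem_ker b⟩ * (⟨_, XYX_mem_ker j⟩ * ⟨_, Y_mem_ker j⟩⁻¹))
        ((tau_Y_self h).trans ?_)).trans ?_
      · simp only [Subgroup.coe_mul, Subgroup.coe_inv, commutatorElement_def]
      · rw [abCls_mul, abCls_mul, abCls_inv, sub_eq_add_neg]
        rfl
    rw [sigmaMinus_apply, h1, map_add, map_sub, coordY_yb, coordY_yb, coordY_xyx, Matrix.one_apply]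
    by_cases ha : a = b
    · subst ha; simp [h, h.symm]
    · by_cases ha' : a = j
      · subst ha'; simp [ha]
      · simp [ha, ha', Ne.symm ha']
  · rw [sigmaMinus_col_of_fix (tau_Y h hb)]
    simp [Ne.symm hb]

end SigmaMinus

/-! ### The level two congruence subgroup of `GL(2, ℤ)` -/

section LevelTwo

/-- The subgroup of `GL(2, ℤ)` generated by the sign changes and the squares of the elementary
matrices. -/
noncomputable def levelTwo : Subgroup (GL (Fin 2) ℤ) :=
  Subgroup.closure {mat2 (-1) 0 0 1 (by norm_num), mat2 1 0 0 (-1) (by norm_num),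
    mat2 1 2 0 1 (by norm_num), mat2 1 0 2 1 (by norm_num)}

theorem mat2_val (a b c d : ℤ) (h : a * d - b * c = 1 ∨ a * d - b * c = -1) :
    (mat2 a b c d h).1 = !![a, b; c, d] := rfl

theorem exists_lower_mem_levelTwo (k : ℤ) : ∃ g ∈ levelTwo, g.1 = !![1, 0; 2 * k, 1] := by
  refine ⟨mat2 1 0 2 1 (by norm_num) ^ k, zpow_mem (Subgroup.subset_closure (by simp)) k, ?_⟩
  have hinv : (mat2 1 0 2 1 (by norm_num))⁻¹ = mat2 1 0 (-2) 1 (by norm_num) := by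
    rw [inv_eq_iff_mul_eq_one]
    refine Units.ext ?_
    rw [Units.val_mul, mat2_val, mat2_val, Matrix.mul_fin_two, Units.val_one, Matrix.one_fin_two]
    norm_num
  induction k with
  | zero => rw [zpow_zero, Units.val_one, Matrix.one_fin_two]; norm_num
  | succ k ih =>
    rw [zpow_add_one, Units.val_mul, ih, mat2_val, Matrix.mul_fin_two]
    congr 3
    all_goals ring_nf
  | pred k ih =>
    rw [zpow_sub_one, Units.val_mul, ih, hinv, mat2_val, Matrix.mul_fin_two]
    congr 3
    all_goals ring_nf

theorem exists_upper_mem_levelTwo (k : ℤ) : ∃ g ∈ levelTwo, g.1 = !![1, 2 * k; 0, 1] := by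
  refine ⟨mat2 1 2 0 1 (by norm_num) ^ k, zpow_mem (Subgroup.subset_closure (by simp)) k, ?_⟩
  have hinv : (mat2 1 2 0 1 (by norm_num))⁻¹ = mat2 1 (-2) 0 1 (by norm_num) := by
    rw [inv_eq_iff_mul_eq_one]
    refine Units.ext ?_
    rw [Units.val_mul, mat2_val, mat2_val, Matrix.mul_fin_two, Units.val_one, Matrix.one_fin_two]
    norm_num
  induction k with
  | zero => rw [zpow_zero, Units.val_one, Matrix.one_fin_two]; norm_num
  | succ k ih =>
    rw [zpow_add_one, Units.val_mul, ih, mat2_val, Matrix.mul_fin_two]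
    congr 3
    all_goals ring_nf
  | pred k ih =>
    rw [zpow_sub_one, Units.val_mul, ih, hinv, mat2_val, Matrix.mul_fin_two]
    congr 3
    all_goals ring_nf

theorem mem_levelTwo_of_mul {A g : GL (Fin 2) ℤ} (hg : g ∈ levelTwo) (h : A * g ∈ levelTwo) :
    A ∈ levelTwo := by
  have := mul_mem h (inv_mem hg)
  rwa [mul_inv_cancel_right] at this

/-- A Euclidean algorithm on the first row (a, b) by even column operations. As a is odd and b even,
the absolute values differ; while b ≠ 0, adding or subtracting twice the smaller entry strictly
shrinks the larger one. The odd entry never vanishes, so the process ends at b = 0. -/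
theorem mem_levelTwo_of_entries (n : ℕ) : ∀ (A : GL (Fin 2) ℤ) (a b c d : ℤ),
    A.1 = !![a, b; c, d] → a.natAbs + b.natAbs = n → a % 2 = 1 → b % 2 = 0 → c % 2 = 0 →
    d % 2 = 1 → A ∈ levelTwo := by
  induction n using Nat.strong_induction_on with
  | _ n ih =>
    intro A a b c d hA hn ha hb hc hd
    by_cases hb0 : b = 0
    · subst hb0
      have hdet : IsUnit (a * d) := by
        have h1 : IsUnit A.1.det := (Matrix.isUnit_iff_isUnit_det _).1 A.isUnit
        rwa [hA, Matrix.det_fin_two_of, zero_mul, sub_zero] at h1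
      have hs : ∀ u : ℤ, IsUnit u → ∃ g ∈ levelTwo, g.1 = !![u, 0; 0, 1] := by
        intro u hu
        rcases Int.isUnit_iff.1 hu with rfl | rfl
        · exact ⟨1, one_mem _, by rw [Units.val_one, Matrix.one_fin_two]⟩
        · exact ⟨_, Subgroup.subset_closure (by simp), mat2_val (-1) 0 0 1 (by norm_num)⟩
      have ht : ∀ u : ℤ, IsUnit u → ∃ g ∈ levelTwo, g.1 = !![1, 0; 0, u] := by
        intro u hu
        rcases Int.isUnit_iff.1 hu with rfl | rfl
        · exact ⟨1, one_mem _, by rw [Units.val_one, Matrix.one_fin_two]⟩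
        · exact ⟨_, Subgroup.subset_closure (by simp), mat2_val 1 0 0 (-1) (by norm_num)⟩
      obtain ⟨g, hg, hg'⟩ := hs a (isUnit_of_mul_isUnit_left hdet)
      obtain ⟨h, hh, hh'⟩ := ht d (isUnit_of_mul_isUnit_right hdet)
      -- The lower left entry is taken as ca because the final factor diag(a, 1) multiplies it by a
      -- once more, and a² = 1.
      obtain ⟨l, hl, hl'⟩ := exists_lower_mem_levelTwo (c * a / 2)
      have haa : a * a = 1 := Int.isUnit_mul_self (isUnit_of_mul_isUnit_left hdet)
      have hca : 2 * (c * a / 2) = c * a :=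
        Int.mul_ediv_cancel' (Dvd.dvd.mul_right (Int.dvd_of_emod_eq_zero hc) a)
      have : A = l * h * g := by
        refine Units.ext ?_
        have hca' : c * a * a = c := by rw [mul_assoc, haa, mul_one]
        rw [Units.val_mul, Units.val_mul, hl', hh', hg', hA, Matrix.mul_fin_two,
          Matrix.mul_fin_two, hca]
        simp [hca']
      rw [this]
      exact mul_mem (mul_mem hl hh) hg
    · rcases lt_or_ge a.natAbs b.natAbs with hlt | hge
      · obtain ⟨k, hk⟩ : ∃ k : ℤ, (b + 2 * k * a).natAbs < b.natAbs := by
          rcases le_total a 0 with h1 | h1 <;> rcases le_total b 0 with h2 | h2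
          · exact ⟨-1, by omega⟩
          · exact ⟨1, by omega⟩
          · exact ⟨1, by omega⟩
          · exact ⟨-1, by omega⟩
        obtain ⟨g, hg, hg'⟩ := exists_upper_mem_levelTwo k
        refine mem_levelTwo_of_mul hg (ih (a.natAbs + (b + 2 * k * a).natAbs) (by omega) (A * g)
          a (b + 2 * k * a) c (d + 2 * k * c) ?_ rfl ha ?_ hc ?_)
        · rw [Units.val_mul, hA, hg', Matrix.mul_fin_two]
          congr 3
          all_goals ring_nf
        · rw [mul_assoc]; omega
        · rw [mul_assoc]; omega
      · obtain ⟨k, hk⟩ : ∃ k : ℤ, (a + 2 * k * b).natAbs < a.natAbs := by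
          rcases le_total a 0 with h1 | h1 <;> rcases le_total b 0 with h2 | h2
          · exact ⟨-1, by omega⟩
          · exact ⟨1, by omega⟩
          · exact ⟨1, by omega⟩
          · exact ⟨-1, by omega⟩
        obtain ⟨g, hg, hg'⟩ := exists_lower_mem_levelTwo k
        refine mem_levelTwo_of_mul hg (ih ((a + 2 * k * b).natAbs + b.natAbs) (by omega) (A * g)
          (a + 2 * k * b) b (c + 2 * k * d) d ?_ rfl ?_ hb ?_ hd)
        · rw [Units.val_mul, hA, hg', Matrix.mul_fin_two]
          congr 3
          all_goals ring_nf
        · rw [mul_assoc]; omega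
        · rw [mul_assoc]; omega

theorem mem_levelTwo_of_modEq {A : GL (Fin 2) ℤ}
    (h : ∀ i j, A.1 i j ≡ (1 : Matrix (Fin 2) (Fin 2) ℤ) i j [ZMOD 2]) : A ∈ levelTwo := by
  have h00 : A.1 0 0 % 2 = 1 := h 0 0
  have h01 : A.1 0 1 % 2 = 0 := h 0 1
  have h10 : A.1 1 0 % 2 = 0 := h 1 0
  have h11 : A.1 1 1 % 2 = 1 := h 1 1
  exact mem_levelTwo_of_entries _ A _ _ _ _ (Matrix.eta_fin_two A.1) rfl h00 h01 h10 h11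

theorem map_IA_sigmaMinus :
    ((IA 2).subgroupOf (GamPlus 2)).map (sigmaMinus 2) = levelTwo := by
  refine le_antisymm ?_ ((Subgroup.closure_le _).2 ?_)
  · rintro _ ⟨φ, hφ, rfl⟩
    exact mem_levelTwo_of_modEq (sigmaMinus_modEq_of_mem_IA hφ)
  · have h01 : (0 : Fin 2) ≠ 1 := by decide
    have hp : ∀ i : Fin 2, sigmaMinus 2 ⟨pconj i, pconj_mem_GamPlus i⟩ ∈
        ((IA 2).subgroupOf (GamPlus 2)).map (sigmaMinus 2) := fun i =>
      Subgroup.mem_map_of_mem _ (Subgroup.mem_subgroupOf.2 (pconj_mem_IA i))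
    -- Inverses are taken because τ_ij itself has off-diagonal entry -2.
    have ht : ∀ (i j : Fin 2) (h : i ≠ j), (sigmaMinus 2 ⟨tau i j h, tau_mem_GamPlus h⟩)⁻¹ ∈
        ((IA 2).subgroupOf (GamPlus 2)).map (sigmaMinus 2) :=
      fun i j h => inv_mem
        (Subgroup.mem_map_of_mem _ (Subgroup.mem_subgroupOf.2 (tau_mem_IA h)))
    rintro g (rfl | rfl | rfl | rfl) <;> rw [SetLike.mem_coe]
    · convert hp 0 using 1
      ext a b
      rw [sigmaMinus_pconj, mat2_val]
      fin_cases a <;> fin_cases b <;> simp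
    · convert hp 1 using 1
      ext a b
      rw [sigmaMinus_pconj, mat2_val]
      fin_cases a <;> fin_cases b <;> simp
    · convert ht 1 0 h01.symm using 1
      rw [eq_inv_iff_mul_eq_one]
      have h1 : (sigmaMinus 2 ⟨tau 1 0 h01.symm, tau_mem_GamPlus h01.symm⟩).1 =
          !![1, -2; 0, 1] := by
        ext a b
        rw [sigmaMinus_tau]
        fin_cases a <;> fin_cases b <;> simp [Matrix.transvection]
      refine Units.ext ?_
      rw [Units.val_mul, mat2_val, h1, Matrix.mul_fin_two, Units.val_one, Matrix.one_fin_two]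
      norm_num
    · convert ht 0 1 h01 using 1
      rw [eq_inv_iff_mul_eq_one]
      have h1 : (sigmaMinus 2 ⟨tau 0 1 h01, tau_mem_GamPlus h01⟩).1 = !![1, 0; -2, 1] := by
        ext a b
        rw [sigmaMinus_tau]
        fin_cases a <;> fin_cases b <;> simp [Matrix.transvection]
      refine Units.ext ?_
      rw [Units.val_mul, mat2_val, h1, Matrix.mul_fin_two, Units.val_one, Matrix.one_fin_two]
      norm_num

end LevelTwo

end AutFree

theorem mainTheorem5 :
    (∀ m : ℕ, 1 ≤ m →
      Subgroup.closure (AutFree.gens m) = AutFree.GamPlus m ∧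
      (AutFree.sigmaPlus m).range =
        (AutFree.Gamma1 m 2).map Matrix.SpecialLinearGroup.toGL ∧
      (AutFree.GamPlus m).relIndex (AutFree.APlus m) = 2 ^ (m + 1) - 1 ∧
      Function.Surjective (AutFree.sigmaMinus m)) ∧
    (AutFree.IA 2 ≤ AutFree.GamPlus 2 ∧
      ((AutFree.IA 2).subgroupOf (AutFree.GamPlus 2)).map (AutFree.sigmaMinus 2) =
        Subgroup.closure {AutFree.mat2 (-1) 0 0 1 (by norm_num),
          AutFree.mat2 1 0 0 (-1) (by norm_num), AutFree.mat2 1 2 0 1 (by norm_num),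
          AutFree.mat2 1 0 2 1 (by norm_num)}) :=
  ⟨fun _ _ => ⟨AutFree.closure_gens_eq_GamPlus, AutFree.range_sigmaPlus,
    AutFree.relIndex_GamPlus, AutFree.sigmaMinus_surjective⟩,
    AutFree.IA_le_GamPlus, AutFree.map_IA_sigmaMinus⟩
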